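/- Let $K$ be a field. A dual quasi-bialgebra over $K$ is a coassociative counital coalgebra $(H,\Delta,\varepsilon)$ with a grouplike element $1\in H$, a (not necessarily associative) multiplication $H\otimes H\to H$ that is a coalgebra map, and a convolution invertible $\varphi\in(H\otimes H\otimes H)^*$ such that for all $h,g,f,e\in H$ (Sweedler notation) $$h_1(g_1f_1)\varphi(h_2,g_2,f_2)=\varphi(h_1,g_1,f_1)(h_2g_2)f_2,\qquad 1h=h1=h,$$ $$\varphi(h_1,g_1,f_1e_1)\varphi(h_2g_2,f_2,e_2)=\varphi(g_1,f_1,e_1)\varphi(h_1,g_2f_2,e_2)\varphi(h_2,g_3,f_3),\qquad \varphi(h,1,g)=\varepsilon(h)\varepsilon(g).$$ It is a dual quasi-Hopf algebra if it comes with an antimorphism of coalgebras $S:H\to H$ and $\alpha,\beta\in H^*$ such that for all $h\in H$ $$S(h_1)\alpha(h_2)h_3=\alpha(h)1,\qquad h_1\beta(h_2)S(h_3)=\beta(h)1,$$ $$\varphi(h_1\beta(h_2),S(h_3),\alpha(h_4)h_5)=\varphi^{-1}(S(h_1),\alpha(h_2)h_3,\beta(h_4)S(h_5))=\varepsilon(h).$$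 Let $*$ denote the convolution product of $H^*$. A left integral is a $T\in H^*$ with $h^**T=h^*(1)T$ for all $h^*\in H^*$. $Rat(H^*)$ denotes the rational part of the right $H^*$-module $H^*$, that is, the set of $f\in H^*$ for which there are $c_i\in H$, $f_i\in H^*$ $(1\le i\le n)$ with $f*h^*=\sum_i h^*(c_i)f_i$ for all $h^*\in H^*$; it is a left $H$-comodule $f\mapsto f_{-1}\otimes f_0$ by $f*h^*=h^*(f_{-1})f_0$. Let $\sigma,\sigma^{-1}:H\otimes H\to H^*$ be $\sigma(h\otimes g)(f)=\varphi(f,h,g)$ and its convolution inverse $\sigma^{-1}(h\otimes g)(f)=\varphi^{-1}(f,h,g)$, and let $(h\rightharpoonup T)(g)=T(gh)$. **Proposition.** Let $H$ be a dual quasi-Hopf algebra and $T\neq0$ a left integral on $H$. Then there is exactly one grouplike element $a\in H$ (the distinguished grouplike) with $T*h^*=h^*(a)T$ for all $h^*\in H^*$, and $S$ has a linear left inverse. Moreover, let ${}^aH$ be the vector space $H$ with the left $H$-comodule structure $h\mapsto aS(h_2)\otimes h_1$, and let $S^l:H\to H$ be any linear map with $S^l\circ S=\mathrm{id}_H$.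 Then $$p(h)=\sigma\bigl(S(S^l(h_3))\otimes\alpha(S^l(h_2))S^l(h_1)\bigr)*(h_4\rightharpoonup T)*\sigma^{-1}\bigl(h_5\beta(h_6)\otimes S(h_7)\bigr)$$ lies in $Rat(H^*)$ for every $h\in H$, and $p:{}^aH\to Rat(H^*)$ is a surjective morphism of left $H$-comodules. -/

import Mathlib

open scoped TensorProduct

noncomputable section

namespace DualQuasi

/-! ### Convolution -/

section Convolution

variable {K C A B D : Type*} [Field K] [AddCommGroup C] [Module K C] [Coalgebra K C]
  [AddCommGroup A] [Module K A] [AddCommGroup B] [Module K B] [AddCommGroup D] [Module K D]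

/-- The convolution of two linear maps `f`, `g` on a coalgebra with respect to a bilinear map `μ`:
in Sweedler notation `c ↦ μ (f c₁) (g c₂)`. -/
def conv (μ : A →ₗ[K] B →ₗ[K] D) (f : C →ₗ[K] A) (g : C →ₗ[K] B) : C →ₗ[K] D :=
  TensorProduct.lift (μ.compl₁₂ f g) ∘ₗ Coalgebra.comul

/-- `c ↦ f(c₁) • F(c₂)`, for a functional `f` and a linear map `F`. -/
def convLeft (f : Module.Dual K C) (F : C →ₗ[K] A) : C →ₗ[K] A :=
  conv (LinearMap.lsmul K A) f F

/-- `c ↦ f(c₂) • F(c₁)`, for a linear map `F` and a functional `f`. -/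
def convRight (F : C →ₗ[K] A) (f : Module.Dual K C) : C →ₗ[K] A :=
  conv (LinearMap.lsmul K A).flip F f

variable (K C) in
/-- The product of the dual algebra `C*`, as a bilinear map: `(f * g)(c) = f(c₁) g(c₂)`.
Its unit is the counit of `C`. -/
def dualMul : Module.Dual K C →ₗ[K] Module.Dual K C →ₗ[K] Module.Dual K C :=
  LinearMap.mk₂ K (fun f g => conv (LinearMap.mul K K) f g)
    (fun f f' g => by
      simp only [conv, ← LinearMap.add_comp]; congr 1; ext; simp)
    (fun r f g => by
      simp only [conv, ← LinearMap.smul_comp]; congr 1; ext; simp [mul_assoc])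
    (fun f g g' => by
      simp only [conv, ← LinearMap.add_comp]; congr 1; ext; simp [mul_add])
    (fun r f g => by
      simp only [conv, ← LinearMap.smul_comp]; congr 1; ext; simp [mul_left_comm])

end Convolution

/-! ### Dual quasi-Hopf algebras -/

/-- A dual quasi-bialgebra structure on a (coassociative, counital) coalgebra `H`.  All maps and
functionals are written on iterated tensor products bracketed to the right. -/
structure DualQuasiBialgebra (K H : Type*) [Field K] [AddCommGroup H] [Module K H]
    [Coalgebra K H] where
  /-- the unit element; that `u : K → H`, `u 1 = one` is a coalgebra map says it is grouplike -/
  one : H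
  isGroupLikeElem_one : IsGroupLikeElem K one
  /-- the multiplication, a coalgebra map, not necessarily associative -/
  mul : H ⊗[K] H →ₗc[K] H
  /-- the reassociator `φ` -/
  reassoc : Module.Dual K (H ⊗[K] (H ⊗[K] H))
  /-- the convolution inverse of `φ` -/
  reassocInv : Module.Dual K (H ⊗[K] (H ⊗[K] H))
  reassoc_mul_inv : dualMul K _ reassoc reassocInv = Coalgebra.counit
  reassocInv_mul : dualMul K _ reassocInv reassoc = Coalgebra.counit
  /-- `h₁(g₁f₁) φ(h₂,g₂,f₂) = φ(h₁,g₁,f₁) (h₂g₂)f₂` -/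
  quasi_assoc :
    convRight (mul.toLinearMap ∘ₗ TensorProduct.map LinearMap.id mul.toLinearMap) reassoc =
      convLeft reassoc (mul.toLinearMap ∘ₗ TensorProduct.map mul.toLinearMap LinearMap.id ∘ₗ
        (TensorProduct.assoc K H H H).symm.toLinearMap)
  one_mul : ∀ h, mul (one ⊗ₜ[K] h) = h
  mul_one : ∀ h, mul (h ⊗ₜ[K] one) = h
  /-- `φ(h₁,g₁,f₁e₁) φ(h₂g₂,f₂,e₂) = φ(g₁,f₁,e₁) φ(h₁,g₂f₂,e₂) φ(h₂,g₃,f₃)`: on the right,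
  the three factors are `ε ⊗ φ`, `φ ∘ (id ⊗ mul ⊗ id)` and `φ ⊗ ε` on `H ⊗ H ⊗ H ⊗ H`. -/
  pentagon :
    dualMul K (H ⊗[K] (H ⊗[K] (H ⊗[K] H)))
      (reassoc ∘ₗ TensorProduct.map LinearMap.id (TensorProduct.map LinearMap.id mul.toLinearMap))
      (reassoc ∘ₗ TensorProduct.map mul.toLinearMap LinearMap.id ∘ₗ
        (TensorProduct.assoc K H H (H ⊗[K] H)).symm.toLinearMap) =
    dualMul K (H ⊗[K] (H ⊗[K] (H ⊗[K] H)))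
      (LinearMap.mul' K K ∘ₗ TensorProduct.map Coalgebra.counit reassoc)
      (dualMul K (H ⊗[K] (H ⊗[K] (H ⊗[K] H)))
        (reassoc ∘ₗ TensorProduct.map LinearMap.id
          (TensorProduct.map mul.toLinearMap LinearMap.id ∘ₗ
            (TensorProduct.assoc K H H H).symm.toLinearMap))
        (LinearMap.mul' K K ∘ₗ
          TensorProduct.map reassoc (Coalgebra.counit (R := K) (A := H)) ∘ₗ
          (TensorProduct.assoc K H (H ⊗[K] H) H).symm.toLinearMap ∘ₗ
          TensorProduct.map LinearMap.id (TensorProduct.assoc K H H H).symm.toLinearMap))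
  reassoc_one : ∀ h g : H,
    reassoc (h ⊗ₜ[K] (one ⊗ₜ[K] g)) = Coalgebra.counit (R := K) h * Coalgebra.counit (R := K) g

/-- `h ↦ h₁ ⊗ h₂ ⊗ h₃`. -/
def comul₃ (K H : Type*) [Field K] [AddCommGroup H] [Module K H] [Coalgebra K H] :
    H →ₗ[K] H ⊗[K] (H ⊗[K] H) :=
  TensorProduct.map LinearMap.id Coalgebra.comul ∘ₗ Coalgebra.comul

/-- A dual quasi-Hopf algebra structure on a coalgebra `H`. -/
structure DualQuasiHopfAlgebra (K H : Type*) [Field K] [AddCommGroup H] [Module K H]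
    [Coalgebra K H] extends DualQuasiBialgebra K H where
  /-- the antipode `S`, an antimorphism of coalgebras -/
  antipode : H →ₗ[K] H
  /-- `Δ(S h) = S(h₂) ⊗ S(h₁)` -/
  comul_antipode : Coalgebra.comul ∘ₗ antipode =
    TensorProduct.map antipode antipode ∘ₗ (TensorProduct.comm K H H).toLinearMap ∘ₗ
      Coalgebra.comul
  counit_antipode : Coalgebra.counit ∘ₗ antipode = Coalgebra.counit (R := K) (A := H)
  α : Module.Dual K H
  β : Module.Dual K H
  /-- `S(h₁) α(h₂) h₃ = α(h) 1` -/
  antipode_left : conv (TensorProduct.curry mul.toLinearMap) (convRight antipode α) LinearMap.id =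
    α.smulRight one
  /-- `h₁ β(h₂) S(h₃) = β(h) 1` -/
  antipode_right : conv (TensorProduct.curry mul.toLinearMap) (convRight LinearMap.id β) antipode =
    β.smulRight one
  /-- `φ(h₁β(h₂), S(h₃), α(h₄)h₅) = ε(h)` -/
  reassoc_antipode :
    reassoc ∘ₗ TensorProduct.map (convRight LinearMap.id β)
      (TensorProduct.map antipode (convLeft α LinearMap.id)) ∘ₗ comul₃ K H = Coalgebra.counit
  /-- `φ⁻¹(S(h₁), α(h₂)h₃, β(h₄)S(h₅)) = ε(h)` -/
  reassocInv_antipode :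
    reassocInv ∘ₗ TensorProduct.map antipode
      (TensorProduct.map (convLeft α LinearMap.id) (convLeft β antipode)) ∘ₗ comul₃ K H =
      Coalgebra.counit

/-! ### Left comodules -/

section Comodule

variable {K C M N : Type*} [Field K] [AddCommGroup C] [Module K C] [Coalgebra K C]
  [AddCommMonoid M] [Module K M] [AddCommMonoid N] [Module K N]

variable (K C M) in
/-- A left comodule structure over a coalgebra `C`. -/
structure LeftComodule where
  /-- `m ↦ m₋₁ ⊗ m₀` -/
  coact : M →ₗ[K] C ⊗[K] M
  coassoc : (TensorProduct.assoc K C C M).toLinearMap ∘ₗ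
    TensorProduct.map Coalgebra.comul LinearMap.id ∘ₗ coact =
      TensorProduct.map LinearMap.id coact ∘ₗ coact
  counit_coact : (TensorProduct.lid K M).toLinearMap ∘ₗ
    TensorProduct.map Coalgebra.counit LinearMap.id ∘ₗ coact = LinearMap.id

/-- Morphisms of left comodules (left colinear maps). -/
def IsColinear (ρ : LeftComodule K C M) (ρ' : LeftComodule K C N) (p : M →ₗ[K] N) : Prop :=
  TensorProduct.map LinearMap.id p ∘ₗ ρ.coact = ρ'.coact ∘ₗ p

end Comodule

/-! ### The rational part of the right `C*`-module `C*` -/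

section Rational

variable {K C M : Type*} [Field K] [AddCommGroup C] [Module K C]
  [AddCommMonoid M] [Module K M]

/-- `x ⊗ m ↦ c(x) m` for a functional `c`. -/
def slice (c : Module.Dual K C) : C ⊗[K] M →ₗ[K] M :=
  (TensorProduct.lid K M).toLinearMap ∘ₗ TensorProduct.map c LinearMap.id

@[simp] theorem slice_tmul (c : Module.Dual K C) (x : C) (m : M) :
    slice c (x ⊗ₜ[K] m) = c x • m := rfl

theorem slice_add_left (c d : Module.Dual K C) (t : C ⊗[K] M) :
    slice (c + d) t = slice c t + slice d t := by
  simp [slice, TensorProduct.map_add_left]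

theorem eq_of_slice {t u : C ⊗[K] M} (h : ∀ c : Module.Dual K C, slice c t = slice c u) :
    t = u := by
  classical
  let b := Module.Basis.ofVectorSpace K C
  apply (TensorProduct.equivFinsuppOfBasisLeft (N := M) b).injective
  ext i
  rw [TensorProduct.equivFinsuppOfBasisLeft_apply, TensorProduct.equivFinsuppOfBasisLeft_apply]
  exact h (b.coord i)

theorem slice_map_id {N : Type*} [AddCommMonoid N] [Module K N] (g : M →ₗ[K] N)
    (c : Module.Dual K C) (t : C ⊗[K] M) :
    slice c (TensorProduct.map LinearMap.id g t) = g (slice c t) := by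
  induction t with
  | zero => simp
  | add y z hy hz => simp only [map_add, hy, hz]
  | tmul y m => simp

variable [Coalgebra K C]

theorem dualMul_apply (f g : Module.Dual K C) (x : C) :
    dualMul K C f g x = LinearMap.mul' K K (TensorProduct.map f g (Coalgebra.comul x)) := by
  change TensorProduct.lift _ _ = _
  induction (Coalgebra.comul (R := K) x) with
  | zero => simp
  | tmul y z => simp
  | add y z hy hz => rw [map_add, hy, hz, map_add, map_add]

theorem dualMul_counit (f : Module.Dual K C) : dualMul K C f Coalgebra.counit = f := by
  ext x
  have h := congrArg (fun t => LinearMap.mul' K K (TensorProduct.map f LinearMap.id t))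
    (Coalgebra.lTensor_counit_comul (R := K) x)
  rw [dualMul_apply]
  refine Eq.trans ?_ (h.trans (by simp))
  induction (Coalgebra.comul (R := K) x) with
  | zero => simp
  | tmul y z => simp
  | add y z hy hz => simp only [map_add, hy, hz]

theorem dualMul_assoc (f g k : Module.Dual K C) :
    dualMul K C (dualMul K C f g) k = dualMul K C f (dualMul K C g k) := by
  have e : ∀ a b : Module.Dual K C, dualMul K C a b =
      LinearMap.mul' K K ∘ₗ TensorProduct.map a b ∘ₗ Coalgebra.comul := fun a b => by
    ext x; exact dualMul_apply a b x
  ext x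
  have h := congrArg (fun t => LinearMap.mul' K K (TensorProduct.map f
    (LinearMap.mul' K K ∘ₗ TensorProduct.map g k) t)) (Coalgebra.coassoc_apply (R := K) x)
  have h1 : ∀ t : C ⊗[K] C, LinearMap.mul' K K (TensorProduct.map (dualMul K C f g) k t) =
      LinearMap.mul' K K (TensorProduct.map f (LinearMap.mul' K K ∘ₗ TensorProduct.map g k)
        (TensorProduct.assoc K C C C (Coalgebra.comul.rTensor C t))) := by
    intro t
    induction t with
    | zero => simp
    | add y z hy hz => simp only [map_add, hy, hz]
    | tmul y z =>
      rw [e]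
      simp only [TensorProduct.map_tmul, LinearMap.comp_apply, LinearMap.rTensor_tmul]
      induction (Coalgebra.comul (R := K) y) with
      | zero => simp
      | add y z hy hz =>
        simp only [map_add, TensorProduct.add_tmul] at hy hz ⊢
        rw [hy, hz]
      | tmul y z => simp [mul_assoc]
  rw [dualMul_apply, h1, dualMul_apply, h]
  generalize Coalgebra.comul (R := K) x = t
  induction t with
  | zero => simp
  | add y z hy hz => simp only [map_add, hy, hz]
  | tmul y z => rw [e]; simp

variable (K C) in
/-- `Rat(C*)`, the rational part of the right `C*`-module `C*`: those `f` for which there are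
`c₁, …, cₙ ∈ C` and `f₁, …, fₙ ∈ C*` with `f * c = ∑ᵢ c(cᵢ) fᵢ` for all `c ∈ C*`. -/
def ratDual : Submodule K (Module.Dual K C) where
  carrier := {f | ∃ t : C ⊗[K] Module.Dual K C, ∀ c, dualMul K C f c = slice c t}
  zero_mem' := ⟨0, fun c => by simp⟩
  add_mem' := by
    rintro f g ⟨t, ht⟩ ⟨u, hu⟩
    exact ⟨t + u, fun c => by simp [ht, hu]⟩
  smul_mem' := by
    rintro r f ⟨t, ht⟩
    exact ⟨r • t, fun c => by simp [ht]⟩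

theorem slice_dualMul (d c : Module.Dual K C) (t : C ⊗[K] M) :
    slice (dualMul K C d c) t = slice c (slice d ((TensorProduct.assoc K C C M)
      (TensorProduct.map Coalgebra.comul LinearMap.id t))) := by
  induction t with
  | zero => simp
  | add y z hy hz => simp only [map_add, hy, hz]
  | tmul y m =>
    simp only [slice_tmul, dualMul_apply, TensorProduct.map_tmul, LinearMap.id_apply]
    induction (Coalgebra.comul (R := K) y) with
    | zero => simp
    | add y z hy hz => simp only [map_add, TensorProduct.add_tmul, add_smul, hy, hz]
    | tmul y z => simp [mul_smul]

theorem dualMul_mem_ratDual {f : Module.Dual K C} (hf : f ∈ ratDual K C)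
    (d : Module.Dual K C) : dualMul K C f d ∈ ratDual K C := by
  obtain ⟨t, ht⟩ := hf
  exact ⟨_, fun c => by rw [dualMul_assoc, ht, slice_dualMul]⟩

theorem exists_ratCoact (f : ratDual K C) :
    ∃ u : C ⊗[K] ratDual K C, ∀ c, ((slice c u : ratDual K C) : Module.Dual K C) = dualMul K C f c := by
  classical
  obtain ⟨f, hf⟩ := f
  obtain ⟨t, ht⟩ := id hf
  let b := Module.Basis.ofVectorSpace K C
  let e := TensorProduct.equivFinsuppOfBasisLeft (N := Module.Dual K C) b
  have hmem : ∀ i, e t i ∈ ratDual K C := fun i => by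
    have h : e t i = dualMul K C f (b.coord i) := by
      rw [ht]; exact TensorProduct.equivFinsuppOfBasisLeft_apply b t i
    rw [h]; exact dualMul_mem_ratDual hf _
  refine ⟨∑ i ∈ (e t).support, b i ⊗ₜ[K] ⟨e t i, hmem i⟩, fun c => ?_⟩
  have h : t = ∑ i ∈ (e t).support, b i ⊗ₜ[K] e t i := by
    conv_lhs => rw [← e.symm_apply_apply t]
    exact TensorProduct.equivFinsuppOfBasisLeft_symm_apply b (e t)
  change _ = dualMul K C f c
  rw [ht]
  conv_rhs => rw [h]
  simp

theorem ratCoact_unique {u v : C ⊗[K] ratDual K C}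
    (h : ∀ c, ((slice c u : ratDual K C) : Module.Dual K C) = (slice c v : ratDual K C)) : u = v :=
  eq_of_slice fun c => Subtype.ext (h c)

variable (K C) in
/-- The coaction `f ↦ f₋₁ ⊗ f₀` of `Rat(C*)`, determined by `f * c = c(f₋₁) f₀` for `c ∈ C*`. -/
def ratCoact : ratDual K C →ₗ[K] C ⊗[K] ratDual K C where
  toFun f := (exists_ratCoact f).choose
  map_add' f g := ratCoact_unique fun c => by
    rw [(exists_ratCoact (f + g)).choose_spec c, map_add (slice c), Submodule.coe_add,
      Submodule.coe_add, (exists_ratCoact f).choose_spec c, (exists_ratCoact g).choose_spec c,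
      map_add, LinearMap.add_apply]
  map_smul' r f := ratCoact_unique fun c => by
    rw [(exists_ratCoact (r • f)).choose_spec c, RingHom.id_apply, map_smul (slice c), Submodule.coe_smul,
      Submodule.coe_smul, (exists_ratCoact f).choose_spec c, map_smul, LinearMap.smul_apply]

theorem slice_ratCoact (c : Module.Dual K C) (f : ratDual K C) :
    ((slice c (ratCoact K C f) : ratDual K C) : Module.Dual K C) = dualMul K C f c :=
  (exists_ratCoact f).choose_spec c

variable (K C) in
/-- `Rat(C*)` as a left `C`-comodule. -/
def ratComodule : LeftComodule K C (ratDual K C) where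
  coact := ratCoact K C
  coassoc := by
    refine LinearMap.ext fun f => eq_of_slice fun d => ratCoact_unique fun c => ?_
    simp only [LinearMap.comp_apply, LinearEquiv.coe_coe]
    have h := slice_map_id (ratCoact K C) d (ratCoact K C f)
    rw [← slice_dualMul, slice_ratCoact]
    refine Eq.trans ?_ (congrArg (fun u => ((slice c u : ratDual K C) : Module.Dual K C)) h).symm
    simp only [slice_ratCoact, dualMul_assoc]
  counit_coact := by
    refine LinearMap.ext fun f => Subtype.ext ?_
    exact (slice_ratCoact _ f).trans (dualMul_counit _)

end Rational

/-! ### Integrals, the twisted comodule and the map `p` -/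

/-- `a` is the distinguished grouplike attached to the integral `T`: it is grouplike and the left
coaction of `KT ⊆ Rat(H*)` is `T ↦ a ⊗ T`, that is, `T * f = f(a) T` for all `f ∈ H*`. -/
structure IsDistinguishedGrouplike {K H : Type*} [Field K] [AddCommGroup H] [Module K H]
    [Coalgebra K H] (T : Module.Dual K H) (a : H) : Prop where
  isGroupLikeElem : IsGroupLikeElem K a
  mul_eq : ∀ f : Module.Dual K H, dualMul K H T f = f a • T

namespace DualQuasiHopfAlgebra

variable {K H : Type*} [Field K] [AddCommGroup H] [Module K H] [Coalgebra K H]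
  (Q : DualQuasiHopfAlgebra K H)

/-- Left integrals: `f * T = f(1) T` for all `f ∈ H*`. -/
def IsLeftIntegral (T : Module.Dual K H) : Prop :=
  ∀ f : Module.Dual K H, dualMul K H f T = f Q.one • T

/-- `h ↦ a S(h)`. -/
def mulAntipode (a : H) : H →ₗ[K] H :=
  TensorProduct.curry Q.mul.toLinearMap a ∘ₗ Q.antipode

theorem comul_mulAntipode {a : H} (ha : IsGroupLikeElem K a) (h : H) :
    Coalgebra.comul (R := K) (Q.mulAntipode a h) =
      TensorProduct.map (Q.mulAntipode a) (Q.mulAntipode a)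
        (TensorProduct.comm K H H (Coalgebra.comul h)) := by
  change Coalgebra.comul (R := K) (Q.mul (a ⊗ₜ[K] Q.antipode h)) = _
  rw [← CoalgHomClass.map_comp_comul_apply, TensorProduct.comul_tmul, ha.comul_eq_tmul_self]
  have := LinearMap.congr_fun Q.comul_antipode h
  simp only [LinearMap.comp_apply, LinearEquiv.coe_coe] at this
  rw [this]
  induction (TensorProduct.comm K H H (Coalgebra.comul h)) with
  | zero => simp
  | add y z hy hz => simp only [map_add, TensorProduct.tmul_add, hy, hz]
  | tmul y z => rfl

theorem counit_mulAntipode {a : H} (ha : IsGroupLikeElem K a) (h : H) :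
    Coalgebra.counit (R := K) (Q.mulAntipode a h) = Coalgebra.counit (R := K) h := by
  change Coalgebra.counit (R := K) (Q.mul (a ⊗ₜ[K] Q.antipode h)) = _
  rw [CoalgHomClass.counit_comp_apply, TensorProduct.counit_tmul, ha.counit_eq_one]
  have := LinearMap.congr_fun Q.counit_antipode h
  simp only [LinearMap.comp_apply] at this
  rw [this]; simp

/-- The left comodule `ᵃH`: the space `H` with coaction `h ↦ a S(h₂) ⊗ h₁`. -/
def twistedComodule (a : H) (ha : IsGroupLikeElem K a) : LeftComodule K H H where
  coact := TensorProduct.map (Q.mulAntipode a) LinearMap.id ∘ₗ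
    (TensorProduct.comm K H H).toLinearMap ∘ₗ Coalgebra.comul
  coassoc := by
    let F := Q.mulAntipode a
    let G : H ⊗[K] (H ⊗[K] H) →ₗ[K] H ⊗[K] (H ⊗[K] H) :=
      (TensorProduct.assoc K H H H).toLinearMap ∘ₗ (TensorProduct.comm K _ _).toLinearMap ∘ₗ
        TensorProduct.map LinearMap.id (TensorProduct.map F F ∘ₗ
          (TensorProduct.comm K H H).toLinearMap)
    ext h
    have key := congrArg G (Coalgebra.coassoc_apply (R := K) h)
    simp only [LinearMap.comp_apply, LinearEquiv.coe_coe]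
    refine Eq.trans ?_ (key.symm.trans ?_)
    · induction (Coalgebra.comul (R := K) h) with
      | zero => simp
      | add y z hy hz => simp only [map_add, hy, hz]
      | tmul y z =>
        simp only [TensorProduct.comm_tmul, TensorProduct.map_tmul, LinearMap.id_apply,
          comul_mulAntipode Q ha, LinearMap.lTensor_tmul]
        rfl
    · induction (Coalgebra.comul (R := K) h) with
      | zero => simp
      | add y z hy hz => simp only [map_add, hy, hz]
      | tmul y z =>
        simp only [TensorProduct.comm_tmul, TensorProduct.map_tmul, LinearMap.id_apply,
          LinearMap.rTensor_tmul, LinearMap.comp_apply, LinearEquiv.coe_coe]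
        induction (Coalgebra.comul (R := K) y) with
        | zero => simp
        | add y z hy hz =>
          simp only [map_add, TensorProduct.add_tmul, TensorProduct.tmul_add, hy, hz]
        | tmul y w => rfl
  counit_coact := by
    ext h
    have key := congrArg (TensorProduct.rid K H) (Coalgebra.lTensor_counit_comul (R := K) h)
    rw [TensorProduct.rid_tmul, one_smul] at key
    simp only [LinearMap.comp_apply, LinearEquiv.coe_coe, LinearMap.id_apply]
    refine Eq.trans ?_ key
    induction (Coalgebra.comul (R := K) h) with
    | zero => simp
    | add y z hy hz => simp only [map_add, hy, hz]
    | tmul y z => simp [counit_mulAntipode Q ha]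

/-- `σ : H ⊗ H → H*`, `σ(h ⊗ g)(f) = φ(f, h, g)`. -/
def sigma : H ⊗[K] H →ₗ[K] Module.Dual K H := (TensorProduct.curry Q.reassoc).flip

/-- `σ⁻¹ : H ⊗ H → H*`, `σ⁻¹(h ⊗ g)(f) = φ⁻¹(f, h, g)`. -/
def sigmaInv : H ⊗[K] H →ₗ[K] Module.Dual K H := (TensorProduct.curry Q.reassocInv).flip

theorem conv_flip_curry (φ ψ : Module.Dual K (H ⊗[K] (H ⊗[K] H))) (x : H ⊗[K] H) (f : H) :
    conv (dualMul K H) (TensorProduct.curry φ).flip (TensorProduct.curry ψ).flip x f =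
      dualMul K _ φ ψ (f ⊗ₜ[K] x) := by
  rw [dualMul_apply, TensorProduct.comul_tmul]
  change (TensorProduct.lift ((dualMul K H).compl₁₂ (TensorProduct.curry φ).flip
    (TensorProduct.curry ψ).flip) (Coalgebra.comul (R := K) x) : Module.Dual K H) f = _
  induction (Coalgebra.comul (R := K) x) with
  | zero => simp
  | add y z hy hz =>
    simp only [map_add, LinearMap.add_apply, TensorProduct.tmul_add, hy, hz]
  | tmul y z =>
    simp only [TensorProduct.lift.tmul, LinearMap.compl₁₂_apply, dualMul_apply]
    induction (Coalgebra.comul (R := K) f) with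
    | zero => simp
    | add u v hu hv => simp only [map_add, TensorProduct.add_tmul, hu, hv]
    | tmul u v => rfl

/-- `σ⁻¹` is the convolution inverse of `σ` in `Hom(H ⊗ H, H*)` (first half). -/
theorem sigma_conv_sigmaInv :
    conv (dualMul K H) Q.sigma Q.sigmaInv =
      (Coalgebra.counit (R := K) (A := H ⊗[K] H)).smulRight (Coalgebra.counit (R := K) (A := H)) :=
  LinearMap.ext fun x => LinearMap.ext fun f => by
    rw [sigma, sigmaInv, conv_flip_curry, Q.reassoc_mul_inv, TensorProduct.counit_tmul]; rfl

/-- `σ⁻¹` is the convolution inverse of `σ` in `Hom(H ⊗ H, H*)` (second half). -/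
theorem sigmaInv_conv_sigma :
    conv (dualMul K H) Q.sigmaInv Q.sigma =
      (Coalgebra.counit (R := K) (A := H ⊗[K] H)).smulRight (Coalgebra.counit (R := K) (A := H)) :=
  LinearMap.ext fun x => LinearMap.ext fun f => by
    rw [sigma, sigmaInv, conv_flip_curry, Q.reassocInv_mul, TensorProduct.counit_tmul]; rfl

/-- `h ↦ (h ⇀ T)`, where `(h ⇀ T)(g) = T(gh)`. -/
def hit (T : Module.Dual K H) : H →ₗ[K] Module.Dual K H :=
  (TensorProduct.curry (T ∘ₗ Q.mul.toLinearMap)).flip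

/-- The map `p : H → H*`,
`p(h) = σ(S(Sˡ(h₃)) ⊗ α(Sˡ(h₂)) Sˡ(h₁)) * (h₄ ⇀ T) * σ⁻¹(h₅ β(h₆) ⊗ S(h₇))`,
written as the convolution of its three factors in `Hom(H, H*)`. -/
def pMap (T : Module.Dual K H) (Sl : H →ₗ[K] H) : H →ₗ[K] Module.Dual K H :=
  conv (dualMul K H)
    (Q.sigma ∘ₗ TensorProduct.map (Q.antipode ∘ₗ Sl) (convRight Sl (Q.α ∘ₗ Sl)) ∘ₗ
      (TensorProduct.comm K H H).toLinearMap ∘ₗ Coalgebra.comul)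
    (conv (dualMul K H) (Q.hit T)
      (Q.sigmaInv ∘ₗ TensorProduct.map (convRight LinearMap.id Q.β) Q.antipode ∘ₗ
        Coalgebra.comul))

end DualQuasiHopfAlgebra

end DualQuasi

end

noncomputable section

namespace DualQuasi

/-! ### The dual algebra -/

section DualAlgebra

variable {K C : Type*} [Field K] [AddCommGroup C] [Module K C] [Coalgebra K C]

/-! The map `Sl` enters only through `Sl ∘ S = id`, so `pMap` is transparent on the image of the
antipode: p(S(h)) = θ(h) with θ(h) = q(h₂) * u(S(h₁)) and u(y) = (y₁ ⇀ T) * `pInvMap`(y₂). Once θ is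
known to be injective and to fill Rat(H*), the proposition follows.

Four families of functionals built from φ, φ⁻¹, α and β take the place of associativity and of the
antipode cancellations of a Hopf algebra: `qMap`, `pInvMap`, `lMap`, `mMap`. Quasi-associativity
contracted with α or β shows that any functional f can be moved past them at the cost of translating
f (`mul_qMap`, `pInvMap_mul`, `mul_lMap`, `mMap_mul`). The pentagon contracted with both α and β
shows that q and p, and likewise l and m, are inverse to each other up to a translation. Sweedler
sums become matrix products in the algebra H*, because a coalgebra is spanned by entries of
comatrices.

For a left integral T these rules give f * θ(h) = θ(f(h₂)h₁), so ker θ is a coideal. Also u(S(h)) =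
θ(β(h₂)h₁), and T is recovered from u ∘ S. Hence ε vanishes on ker θ and θ is injective
(`theta_injective`). A mirrored map θ' does the same for right integrals; there u'(S(h)) =
θ'(α(h₁)h₂). If S(h) = 0, this forces α(h₁)h₂ = 0, then q(h) = 0, and since ker S is a coideal also
θ(h) = 0: the antipode is injective.

Conversely, a finite family of functionals on which H* acts through a comatrix can be averaged with
β into left integrals P, and the family is recovered from the maps θ_P (`sum_theta_integralOf`), as
in the structure theorem for Hopf modules. So the functionals generating finite dimensional left
ideals are spanned by values of the θ_P. They also separate points (`eq_zero_of_leftRat`), so some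
θ_U(h)(1) is nonzero, and W(h) = θ_U(h)(1) is a nonzero right integral. Computing W * θ_V(h) in two
ways yields uniqueness of left integrals. Uniqueness turns T * f into f(a)T, which gives a and the
colinearity of p, and lets the single map θ_T reach all left rational functionals. Separation of
points shows that Rat(H*) consists of such functionals. -/

theorem counit_dualMul (f : Module.Dual K C) : dualMul K C Coalgebra.counit f = f := by
  ext x
  have h := congrArg (fun t => LinearMap.mul' K K (TensorProduct.map LinearMap.id f t))
    (Coalgebra.rTensor_counit_comul (R := K) x)
  rw [dualMul_apply]
  refine Eq.trans ?_ (h.trans (by simp))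
  induction (Coalgebra.comul (R := K) x) with
  | zero => simp
  | tmul y z => simp
  | add y z hy hz => simp only [map_add, hy, hz]

/-- The dual algebra of a coalgebra: the product is convolution. -/
@[reducible] def dualRing (K C : Type*) [Field K] [AddCommGroup C] [Module K C] [Coalgebra K C] :
    Ring (Module.Dual K C) where
  mul f g := dualMul K C f g
  one := Coalgebra.counit
  left_distrib f g k := by change dualMul K C f (g + k) = _; rw [map_add]; rfl
  right_distrib f g k := by
    change dualMul K C (f + g) k = _; rw [map_add, LinearMap.add_apply]; rfl
  zero_mul f := by change dualMul K C 0 f = 0; rw [map_zero, LinearMap.zero_apply]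
  mul_zero f := by change dualMul K C f 0 = 0; rw [map_zero]
  mul_assoc := dualMul_assoc
  one_mul := counit_dualMul
  mul_one := dualMul_counit
  neg_add_cancel := neg_add_cancel
  zsmul := fun n f => n • f
  nsmul := fun n f => n • f
  zsmul_zero' := SubNegMonoid.zsmul_zero'
  zsmul_succ' := SubNegMonoid.zsmul_succ'
  zsmul_neg' := SubNegMonoid.zsmul_neg'
  nsmul_zero := AddMonoid.nsmul_zero
  nsmul_succ := AddMonoid.nsmul_succ
  sub_eq_add_neg := sub_eq_add_neg

attribute [local instance] dualRing

theorem dualIsScalarTower (K C : Type*) [Field K] [AddCommGroup C] [Module K C]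
    [Coalgebra K C] : IsScalarTower K (Module.Dual K C) (Module.Dual K C) :=
  ⟨fun r f g => by
    change dualMul K C (r • f) g = r • dualMul K C f g
    rw [map_smul, LinearMap.smul_apply]⟩

theorem dualSMulCommClass (K C : Type*) [Field K] [AddCommGroup C] [Module K C]
    [Coalgebra K C] : SMulCommClass K (Module.Dual K C) (Module.Dual K C) :=
  ⟨fun r f g => by
    change r • dualMul K C f g = dualMul K C f (r • g)
    rw [map_smul]⟩

attribute [local instance] dualIsScalarTower dualSMulCommClass

theorem dual_mul_apply (f g : Module.Dual K C) (x : C) :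
    (f * g) x = LinearMap.mul' K K (TensorProduct.map f g (Coalgebra.comul x)) :=
  dualMul_apply f g x

/-- The left hit action on `C`: `x ↦ k(x₁) x₂`. -/
def coact (k : Module.Dual K C) : C →ₗ[K] C := slice k ∘ₗ Coalgebra.comul

theorem slice_comul_mul (k l : Module.Dual K C) (x : C) :
    coact (k * l) x = coact l (coact k x) := by
  change slice (dualMul K C k l) (Coalgebra.comul x) =
    slice l (Coalgebra.comul (slice k (Coalgebra.comul x)))
  refine (slice_dualMul k l _).trans ((congrArg (fun t => slice l (slice k t))
    (Coalgebra.coassoc_apply (R := K) x)).trans (congrArg (slice l) ?_))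
  exact slice_map_id Coalgebra.comul k _

theorem apply_coact (k l : Module.Dual K C) (x : C) : l (coact k x) = (k * l) x := by
  rw [dual_mul_apply]
  change l (slice k _) = _
  induction (Coalgebra.comul (R := K) x) with
  | zero => simp
  | tmul y z => simp
  | add y z hy hz => simp only [map_add, hy, hz]

end DualAlgebra

/-! ### Comatrices -/

section Comatrix

variable {K C D : Type*} [Field K] [AddCommGroup C] [Module K C] [Coalgebra K C]
  [AddCommGroup D] [Module K D] [Coalgebra K D]

attribute [local instance] dualRing dualIsScalarTower dualSMulCommClass

variable (K) in
/-- A comatrix: a square matrix over a coalgebra with `Δ(cᵢⱼ) = ∑ cᵢₖ ⊗ cₖⱼ`, `ε(cᵢⱼ) = δᵢⱼ`. -/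
structure IsComatrix {ι : Type*} [Fintype ι] [DecidableEq ι] (c : ι → ι → C) : Prop where
  comul_eq : ∀ i j, Coalgebra.comul (R := K) (c i j) = ∑ k, c i k ⊗ₜ[K] c k j
  counit_eq : ∀ i j, Coalgebra.counit (R := K) (c i j) = if i = j then 1 else 0

namespace IsComatrix

variable {ι κ : Type*} [Fintype ι] [DecidableEq ι] [Fintype κ] [DecidableEq κ]
  {c : ι → ι → C} {d : κ → κ → D}

theorem conv_apply {A B E : Type*} [AddCommGroup A] [Module K A] [AddCommGroup B] [Module K B]
    [AddCommGroup E] [Module K E] (hc : IsComatrix K c) (μ : A →ₗ[K] B →ₗ[K] E)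
    (f : C →ₗ[K] A) (g : C →ₗ[K] B) (i j : ι) :
    conv μ f g (c i j) = ∑ k, μ (f (c i k)) (g (c k j)) := by
  simp [conv, hc.comul_eq]

theorem mul_apply (hc : IsComatrix K c) (f g : Module.Dual K C) (i j : ι) :
    (f * g) (c i j) = ∑ k, f (c i k) * g (c k j) := hc.conv_apply _ f g i j

/-- Functionals applied to one tensor factor after the other separate the points of C ⊗ C, so the
formula for Δ may be tested on convolution products. -/
theorem of_dual {c : ι → ι → C} (hmul : ∀ (f g : Module.Dual K C) i j,
    (f * g) (c i j) = ∑ k, f (c i k) * g (c k j))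
    (hone : ∀ i j, Coalgebra.counit (R := K) (c i j) = if i = j then 1 else 0) :
    IsComatrix K c where
  comul_eq i j := by
    refine eq_of_slice fun f => ?_
    rw [← sub_eq_zero, ← Module.forall_dual_apply_eq_zero_iff K]
    intro g
    rw [map_sub, sub_eq_zero]
    refine (apply_coact f g _).trans ((hmul f g i j).trans ?_)
    simp
  counit_eq := hone

theorem tmul (hc : IsComatrix K c) (hd : IsComatrix K d) :
    IsComatrix K (fun i j : ι × κ => c i.1 j.1 ⊗ₜ[K] d i.2 j.2) where
  comul_eq i j := by
    simp only [TensorProduct.comul_tmul, hc.comul_eq, hd.comul_eq, TensorProduct.sum_tmul,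
      TensorProduct.tmul_sum, map_sum, Fintype.sum_prod_type]
    exact Finset.sum_comm
  counit_eq i j := by
    rw [TensorProduct.counit_tmul, hc.counit_eq, hd.counit_eq, smul_eq_mul]
    rcases i with ⟨i, i'⟩
    rcases j with ⟨j, j'⟩
    by_cases h : i = j <;> by_cases h' : i' = j' <;> simp [h, h']

theorem map (hc : IsComatrix K c) (f : C →ₗc[K] D) : IsComatrix K (fun i j => f (c i j)) where
  comul_eq i j := by
    rw [← CoalgHomClass.map_comp_comul_apply, hc.comul_eq, map_sum]
    simp
  counit_eq i j := by rw [CoalgHomClass.counit_comp_apply, hc.counit_eq]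

end IsComatrix

/-- `k ↦ k(x₁) x₂` as a linear map. -/
def orbitMap (x : C) : Module.Dual K C →ₗ[K] C where
  toFun k := coact k x
  map_add' k l := slice_add_left k l _
  map_smul' r k := by
    change slice (r • k) _ = r • slice k _
    simp [slice, TensorProduct.map_smul_left]

theorem finiteDimensional_range_orbitMap (x : C) :
    FiniteDimensional K (LinearMap.range (orbitMap (K := K) x)) := by
  classical
  obtain ⟨S, hS⟩ := TensorProduct.exists_finset (Coalgebra.comul (R := K) x)
  refine Submodule.finiteDimensional_of_le (S₂ := Submodule.span K (S.image Prod.snd : Finset C)) ?_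
  rintro _ ⟨k, rfl⟩
  change slice k _ ∈ _
  rw [hS, map_sum]
  refine Submodule.sum_mem _ fun i hi => ?_
  rw [slice_tmul]
  exact Submodule.smul_mem _ _ (Submodule.subset_span
    (Finset.mem_coe.2 (Finset.mem_image_of_mem _ hi)))

/-- Every element of a coalgebra is a linear combination of the entries of a comatrix. -/
theorem exists_comatrix (x : C) : ∃ (n : ℕ) (c : Fin n → Fin n → C), IsComatrix K c ∧
    x ∈ Submodule.span K (Set.range fun p : Fin n × Fin n => c p.1 p.2) := by
  classical
  let W := LinearMap.range (orbitMap (K := K) x)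
  have : FiniteDimensional K W := finiteDimensional_range_orbitMap x
  let b := Module.finBasis K W
  have hW : ∀ (k : Module.Dual K C) (w : C), w ∈ W → coact k w ∈ W := by
    rintro k _ ⟨l, rfl⟩
    exact ⟨l * k, slice_comul_mul l k x⟩
  choose g hg using fun j => LinearMap.exists_extend (b.coord j)
  have hg' : ∀ j (w : W), g j w = b.coord j w := fun j w => LinearMap.congr_fun (hg j) w
  have hsum : ∀ w : C, w ∈ W → w = ∑ j, g j w • (b j : C) := fun w hw => by
    have h := congrArg (Subtype.val) (b.sum_repr ⟨w, hw⟩)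
    refine h.symm.trans ?_
    simp only [Submodule.coe_sum, Submodule.coe_smul]
    exact Finset.sum_congr rfl fun j _ => by rw [hg' j ⟨w, hw⟩]; rfl
  -- Coefficient matrix of `W`, read off with functionals `g j` that extend the coordinates: Δ(bᵢ) =
  -- ∑ cᵢⱼ ⊗ bⱼ.
  let c : Fin _ → Fin _ → C := fun i j =>
    TensorProduct.rid K C (TensorProduct.map LinearMap.id (g j) (Coalgebra.comul (b i : C)))
  have hc : ∀ (k : Module.Dual K C) i j, k (c i j) = g j (coact k (b i)) := fun k i j => by
    change k (TensorProduct.rid K C _) = g j (slice k _)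
    induction (Coalgebra.comul (R := K) (b i : C)) with
    | zero => simp
    | tmul y z => simp [mul_comm]
    | add y z hy hz => simp only [map_add, hy, hz]
  have hact : ∀ (k : Module.Dual K C) i, coact k (b i : C) = ∑ j, k (c i j) • (b j : C) :=
    fun k i => by
      simp only [hc]
      exact hsum _ (hW k _ (b i).2)
  have hone : ∀ w : C, coact (K := K) Coalgebra.counit w = w := fun w => by
    have h := congrArg (TensorProduct.lid K C) (Coalgebra.rTensor_counit_comul (R := K) w)
    exact h.trans (by simp)
  refine ⟨_, c, IsComatrix.of_dual (fun k l i j => ?_) (fun i j => ?_), ?_⟩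
  · rw [hc, slice_comul_mul, hact k, map_sum, map_sum]
    exact Finset.sum_congr rfl fun p _ => by rw [map_smul, map_smul, hc l, smul_eq_mul]
  · rw [hc, hone, hg']
    simp [Finsupp.single_apply]
  -- Applying ε to the right factor of Δ(bᵢ) = ∑ cᵢⱼ ⊗ bⱼ puts the basis, hence x, in the span of
  -- the entries.
  · have hb : ∀ i, (b i : C) = ∑ j, Coalgebra.counit (R := K) (b j : C) • c i j := fun i => by
      refine sub_eq_zero.1 ((Module.forall_dual_apply_eq_zero_iff K _).1 fun l => ?_)
      refine (map_sub l _ _).trans (sub_eq_zero.2 ?_)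
      have h : Coalgebra.counit (R := K) (coact l (b i : C)) = l (b i : C) :=
        (apply_coact l Coalgebra.counit _).trans (LinearMap.congr_fun (dualMul_counit l) _)
      refine h.symm.trans ?_
      rw [hact, map_sum, map_sum]
      refine Finset.sum_congr rfl fun j _ => ?_
      rw [map_smul, map_smul, smul_eq_mul, smul_eq_mul, mul_comm]
    rw [hsum x ⟨Coalgebra.counit, hone x⟩]
    refine Submodule.sum_mem _ fun i _ => Submodule.smul_mem _ _ ?_
    rw [hb]
    exact Submodule.sum_mem _ fun j _ => Submodule.smul_mem _ _ (Submodule.subset_span ⟨(i, j), rfl⟩)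

/-- Linear maps on a coalgebra that agree on the entries of all comatrices are equal. -/
theorem ext_comatrix {V : Type*} [AddCommGroup V] [Module K V] {f g : C →ₗ[K] V}
    (h : ∀ (n : ℕ) (c : Fin n → Fin n → C), IsComatrix K c → ∀ i j, f (c i j) = g (c i j)) :
    f = g := by
  ext x
  obtain ⟨n, c, hc, hx⟩ := exists_comatrix (K := K) x
  induction hx using Submodule.span_induction with
  | mem y hy => obtain ⟨p, rfl⟩ := hy; exact h n c hc _ _
  | zero => simp
  | add y z _ _ hy hz => rw [map_add, map_add, hy, hz]
  | smul r y _ hy => rw [map_smul, map_smul, hy]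

end Comatrix

end DualQuasi

namespace DualQuasi

attribute [local instance] dualRing dualIsScalarTower dualSMulCommClass

/-! ### Pulling functionals back along coalgebra maps -/

section Pullback

variable {K C D : Type*} [Field K] [AddCommGroup C] [Module K C] [Coalgebra K C]
  [AddCommGroup D] [Module K D] [Coalgebra K D]

theorem mul_comp_coalgHom (F G : Module.Dual K D) (m : C →ₗc[K] D) :
    (F * G) ∘ₗ m.toLinearMap = (F ∘ₗ m.toLinearMap) * (G ∘ₗ m.toLinearMap) :=
  ext_comatrix fun n c hc i j => by
    rw [hc.mul_apply]
    exact (hc.map m).mul_apply F G i j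

theorem one_comp_coalgHom (m : C →ₗc[K] D) : (1 : Module.Dual K D) ∘ₗ m.toLinearMap = 1 :=
  m.counit_comp

/-- With one tensor factor frozen at the entries of a comatrix, convolution becomes multiplication
of matrices over the dual algebra. This is how identities for φ are turned into matrix identities.
-/
theorem flip_curry_mul {ι : Type*} [Fintype ι] [DecidableEq ι] {z : ι → ι → D}
    (hz : IsComatrix K z) (F G : Module.Dual K (C ⊗[K] D)) (i j : ι) :
    (TensorProduct.curry (F * G)).flip (z i j) =
      ∑ k, (TensorProduct.curry F).flip (z i k) * (TensorProduct.curry G).flip (z k j) :=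
  ext_comatrix fun n c hc a b => by
    rw [LinearMap.sum_apply]
    simp only [hc.mul_apply]
    refine ((hc.tmul hz).mul_apply F G (a, i) (b, j)).trans ?_
    rw [Fintype.sum_prod_type, Finset.sum_comm]
    rfl

theorem curry_mul {ι : Type*} [Fintype ι] [DecidableEq ι] {z : ι → ι → C}
    (hz : IsComatrix K z) (F G : Module.Dual K (C ⊗[K] D)) (i j : ι) :
    (TensorProduct.curry (F * G)) (z i j) =
      ∑ k, (TensorProduct.curry F) (z i k) * (TensorProduct.curry G) (z k j) :=
  ext_comatrix fun n c hc a b => by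
    rw [LinearMap.sum_apply]
    simp only [hc.mul_apply]
    refine ((hz.tmul hc).mul_apply F G (i, a) (j, b)).trans ?_
    rw [Fintype.sum_prod_type]
    rfl

/-- `x ↦ a ⊗ x` for a grouplike element `a`. -/
def tmulLeft {a : C} (ha : IsGroupLikeElem K a) : D →ₗc[K] C ⊗[K] D where
  toLinearMap := TensorProduct.mk K C D a
  counit_comp := by ext; simp [ha.counit_eq_one]
  map_comp_comul := ext_comatrix fun n c hc i j => by
    simp [hc.comul_eq, ha.comul_eq_tmul_self, TensorProduct.tmul_sum]

/-- `x ↦ x ⊗ a` for a grouplike element `a`. -/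
def tmulRight {a : C} (ha : IsGroupLikeElem K a) : D →ₗc[K] D ⊗[K] C where
  toLinearMap := (TensorProduct.mk K D C).flip a
  counit_comp := by ext; simp [ha.counit_eq_one]
  map_comp_comul := ext_comatrix fun n c hc i j => by
    simp [hc.comul_eq, ha.comul_eq_tmul_self, TensorProduct.sum_tmul]

end Pullback

/-! ### Contraction of products of matrices -/

section Contraction

variable {K A κ : Type*} [Field K] [Ring A] [Module K A] [IsScalarTower K A A]
  [SMulCommClass K A A] [Fintype κ]

omit [SMulCommClass K A A] in
theorem row_mul (v : κ → K) (F G : κ → κ → A) (j : κ) :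
    ∑ i, v i • ∑ k, F i k * G k j = ∑ k, (∑ i, v i • F i k) * G k j := by
  simp only [Finset.smul_sum, Finset.sum_mul, smul_mul_assoc]
  exact Finset.sum_comm

omit [IsScalarTower K A A] in
theorem mul_col (w : κ → K) (F G : κ → κ → A) (i : κ) :
    ∑ j, w j • ∑ k, F i k * G k j = ∑ k, F i k * ∑ j, w j • G k j := by
  simp only [Finset.smul_sum, Finset.mul_sum, mul_smul_comm]
  exact Finset.sum_comm

omit [SMulCommClass K A A] in
-- A matrix that fixes the weight vector can be deleted from a product contracted with it. The
-- antipode axioms supply such matrices, with weights made of α or β.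
theorem row_mul_of_fixed {v : κ → K} {F : κ → κ → A} (hF : ∀ k, ∑ i, v i • F i k = v k • 1)
    (G : κ → κ → A) (j : κ) : ∑ i, v i • ∑ k, F i k * G k j = ∑ i, v i • G i j := by
  rw [row_mul]
  simp only [hF, smul_mul_assoc, one_mul]

omit [IsScalarTower K A A] in
theorem mul_col_of_fixed {w : κ → K} {G : κ → κ → A} (hG : ∀ k, ∑ j, w j • G k j = w k • 1)
    (F : κ → κ → A) (i : κ) : ∑ j, w j • ∑ k, F i k * G k j = ∑ j, w j • F i j := by
  rw [mul_col]
  simp only [hG, mul_smul_comm, mul_one]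

theorem row_mul_col (v w : κ → K) (F G : κ → κ → A) :
    ∑ j, w j • ∑ i, v i • ∑ k, F i k * G k j =
      ∑ k, (∑ i, v i • F i k) * ∑ j, w j • G k j := by
  simp only [row_mul v F G]
  simp only [Finset.smul_sum (r := w _), Finset.mul_sum, mul_smul_comm]
  exact Finset.sum_comm

end Contraction

/-! ### Rearrangements of the pentagon -/

section MonoidIdentities

variable {M : Type*} [Monoid M] {a b c d e a' b' c' d' e' : M}

/-- The pentagon relates five invertible elements. This rearrangement and its companions bring
together the two factors that contract to `qMap` and `pInvMap`, or to `lMap` and `mMap`. -/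
theorem mul_inv_eq_of_pentagon (h : a * b = c * (d * e)) (ha : a' * a = 1) (he : e * e' = 1) :
    b * e' = a' * (c * d) := by
  calc b * e' = (a' * a) * (b * e') := by rw [ha, one_mul]
    _ = a' * (a * b) * e' := by simp only [mul_assoc]
    _ = a' * (c * d) * (e * e') := by rw [h]; simp only [mul_assoc]
    _ = a' * (c * d) := by rw [he, mul_one]

theorem mul_inv_eq_of_pentagon' (h : a * b = c * (d * e)) (hb : b * b' = 1) (hc : c' * c = 1)
    (hd : d' * d = 1) : e * b' = d' * (c' * a) := by
  calc e * b' = (d' * d) * (e * b') := by rw [hd, one_mul]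
    _ = d' * ((c' * c) * (d * e)) * b' := by rw [hc, one_mul]; simp only [mul_assoc]
    _ = d' * (c' * (a * b)) * b' := by rw [h]; simp only [mul_assoc]
    _ = d' * (c' * a) * (b * b') := by simp only [mul_assoc]
    _ = d' * (c' * a) := by rw [hb, mul_one]

theorem inv_mul_eq_of_pentagon (h : a * b = c * (d * e)) (hc : c' * c = 1) :
    c' * (a * b) = d * e := by
  rw [h, ← mul_assoc, hc, one_mul]

theorem eq_one_of_mul_self (hab : a * b = 1) (h : a * a = a) :
    a = 1 := by
  calc a = a * (a * b) := by rw [hab, mul_one]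
    _ = a * b := by rw [← mul_assoc, h]
    _ = 1 := hab

end MonoidIdentities

/-! ### The pentagon -/

namespace DualQuasiBialgebra

variable {K H : Type*} [Field K] [AddCommGroup H] [Module K H] [Coalgebra K H]
  (Q : DualQuasiBialgebra K H)

open Coalgebra.TensorProduct in
/-- `h ⊗ g ⊗ f ⊗ e ↦ h ⊗ g ⊗ fe`. -/
def mulThird : H ⊗[K] (H ⊗[K] (H ⊗[K] H)) →ₗc[K] H ⊗[K] (H ⊗[K] H) :=
  map (.id K H) (map (.id K H) Q.mul)

open Coalgebra.TensorProduct in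
/-- `h ⊗ g ⊗ f ⊗ e ↦ hg ⊗ f ⊗ e`. -/
def mulFirst : H ⊗[K] (H ⊗[K] (H ⊗[K] H)) →ₗc[K] H ⊗[K] (H ⊗[K] H) :=
  (map Q.mul (.id K (H ⊗[K] H))).comp
    ((Coalgebra.TensorProduct.assoc K K H H (H ⊗[K] H)).symm : _ →ₗc[K] _)

open Coalgebra.TensorProduct in
/-- `h ⊗ g ⊗ f ⊗ e ↦ h ⊗ gf ⊗ e`. -/
def mulSecond : H ⊗[K] (H ⊗[K] (H ⊗[K] H)) →ₗc[K] H ⊗[K] (H ⊗[K] H) :=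
  map (.id K H) ((map Q.mul (.id K H)).comp
    ((Coalgebra.TensorProduct.assoc K K H H H).symm : _ →ₗc[K] _))

variable (K H) in
open Coalgebra.TensorProduct in
/-- `h ⊗ g ⊗ f ⊗ e ↦ ε(h) g ⊗ f ⊗ e`. -/
def dropFirst : H ⊗[K] (H ⊗[K] (H ⊗[K] H)) →ₗc[K] H ⊗[K] (H ⊗[K] H) :=
  (Coalgebra.TensorProduct.lid K (H ⊗[K] (H ⊗[K] H)) : _ →ₗc[K] _).comp
    (map (Coalgebra.counitCoalgHom K H) (.id K _))

variable (K H) in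
open Coalgebra.TensorProduct in
/-- `h ⊗ g ⊗ f ⊗ e ↦ h ⊗ g ⊗ ε(e) f`. -/
def dropLast : H ⊗[K] (H ⊗[K] (H ⊗[K] H)) →ₗc[K] H ⊗[K] (H ⊗[K] H) :=
  map (.id K H) (map (.id K H)
    ((Coalgebra.TensorProduct.rid K K H : _ →ₗc[K] _).comp
      (map (.id K H) (Coalgebra.counitCoalgHom K H))))

/-- The functional `ψ(h,g,fe)`, and its variants along the other maps `H⁴ → H³`. -/
def pull (m : H ⊗[K] (H ⊗[K] (H ⊗[K] H)) →ₗc[K] H ⊗[K] (H ⊗[K] H))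
    (ψ : Module.Dual K (H ⊗[K] (H ⊗[K] H))) : Module.Dual K (H ⊗[K] (H ⊗[K] (H ⊗[K] H))) :=
  ψ ∘ₗ m.toLinearMap

theorem reassoc_mul_inv' : Q.reassoc * Q.reassocInv = 1 := Q.reassoc_mul_inv
theorem reassocInv_mul' : Q.reassocInv * Q.reassoc = 1 := Q.reassocInv_mul

theorem pull_mul_inv (m) : pull m Q.reassoc * pull m Q.reassocInv = 1 := by
  rw [pull, pull, ← mul_comp_coalgHom, reassoc_mul_inv', one_comp_coalgHom]

theorem pull_inv_mul (m) : pull m Q.reassocInv * pull m Q.reassoc = 1 := by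
  rw [pull, pull, ← mul_comp_coalgHom, reassocInv_mul', one_comp_coalgHom]

/-- As pullbacks of φ along coalgebra maps, all five factors are invertible, with the pullbacks of
φ⁻¹ as inverses. -/
theorem pentagon_pull : pull Q.mulThird Q.reassoc * pull Q.mulFirst Q.reassoc =
    pull (dropFirst K H) Q.reassoc *
      (pull Q.mulSecond Q.reassoc * pull (dropLast K H) Q.reassoc) := by
  have h := Q.pentagon
  have h3 : LinearMap.mul' K K ∘ₗ TensorProduct.map Coalgebra.counit Q.reassoc =
      pull (dropFirst K H) Q.reassoc := by
    refine TensorProduct.ext' fun x y => ?_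
    exact (map_smul Q.reassoc (Coalgebra.counit (R := K) x) y).symm
  have h5 : LinearMap.mul' K K ∘ₗ TensorProduct.map Q.reassoc (Coalgebra.counit (R := K) (A := H)) ∘ₗ
          (TensorProduct.assoc K H (H ⊗[K] H) H).symm.toLinearMap ∘ₗ
          TensorProduct.map LinearMap.id (TensorProduct.assoc K H H H).symm.toLinearMap =
      pull (dropLast K H) Q.reassoc := by
    ext x y z w
    change Q.reassoc (x ⊗ₜ (y ⊗ₜ z)) * Coalgebra.counit (R := K) w =
      Q.reassoc (x ⊗ₜ (y ⊗ₜ (Coalgebra.counit (R := K) w • z)))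
    simp [mul_comm]
  rw [h3, h5] at h
  exact h

end DualQuasiBialgebra

end DualQuasi

namespace DualQuasi

attribute [local instance] dualRing dualIsScalarTower dualSMulCommClass

/-! ### Normalization of the reassociator at the unit -/

namespace DualQuasiBialgebra

variable {K H : Type*} [Field K] [AddCommGroup H] [Module K H] [Coalgebra K H]
  (Q : DualQuasiBialgebra K H)

theorem counit_one : Coalgebra.counit (R := K) Q.one = 1 := Q.isGroupLikeElem_one.counit_eq_one

/-- The restriction of a functional on `H ⊗ (H ⊗ H)` to `1 ⊗ H ⊗ H`. -/
def atOneLeft (ψ : Module.Dual K (H ⊗[K] (H ⊗[K] H))) : Module.Dual K (H ⊗[K] H) :=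
  ψ ∘ₗ (tmulLeft Q.isGroupLikeElem_one).toLinearMap

/-- The restriction of a functional on `H ⊗ (H ⊗ H)` to `H ⊗ 1 ⊗ H`. -/
def atOneMid (ψ : Module.Dual K (H ⊗[K] (H ⊗[K] H))) : Module.Dual K (H ⊗[K] H) :=
  ψ ∘ₗ (Coalgebra.TensorProduct.map (.id K H) (tmulLeft Q.isGroupLikeElem_one)).toLinearMap

/-- The restriction of a functional on `H ⊗ (H ⊗ H)` to `H ⊗ H ⊗ 1`. -/
def atOneRight (ψ : Module.Dual K (H ⊗[K] (H ⊗[K] H))) : Module.Dual K (H ⊗[K] H) :=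
  ψ ∘ₗ (Coalgebra.TensorProduct.map (.id K H) (tmulRight Q.isGroupLikeElem_one)).toLinearMap

/-- The pentagon at 1 ⊗ 1 ⊗ x ⊗ y says that φ(1, ·, ·) is idempotent; being invertible, it is the
unit ε. -/
theorem atOneLeft_reassoc : Q.atOneLeft Q.reassoc = 1 := by
  have hab : Q.atOneLeft Q.reassoc * Q.atOneLeft Q.reassocInv = 1 := by
    rw [atOneLeft, atOneLeft, ← mul_comp_coalgHom, reassoc_mul_inv', one_comp_coalgHom]
  refine eq_one_of_mul_self hab ?_
  let m : H ⊗[K] H →ₗc[K] H ⊗[K] (H ⊗[K] (H ⊗[K] H)) :=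
    (tmulLeft Q.isGroupLikeElem_one).comp (tmulLeft Q.isGroupLikeElem_one)
  have h := congrArg (fun F => F ∘ₗ m.toLinearMap) Q.pentagon_pull
  simp only [mul_comp_coalgHom] at h
  have h1 : pull Q.mulThird Q.reassoc ∘ₗ m.toLinearMap = 1 := by
    refine TensorProduct.ext' fun x y => ?_
    change Q.reassoc (Q.one ⊗ₜ (Q.one ⊗ₜ Q.mul (x ⊗ₜ y))) = _
    rw [Q.reassoc_one, counit_one, _root_.one_mul]
    exact CoalgHomClass.counit_comp_apply Q.mul (x ⊗ₜ[K] y)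
  have h2 : pull Q.mulFirst Q.reassoc ∘ₗ m.toLinearMap = Q.atOneLeft Q.reassoc := by
    refine TensorProduct.ext' fun x y => ?_
    change Q.reassoc (Q.mul (Q.one ⊗ₜ Q.one) ⊗ₜ (x ⊗ₜ y)) = _
    rw [Q.one_mul]; rfl
  have h3 : pull (dropFirst K H) Q.reassoc ∘ₗ m.toLinearMap = Q.atOneLeft Q.reassoc := by
    refine TensorProduct.ext' fun x y => ?_
    change Q.reassoc (Coalgebra.counit (R := K) Q.one • (Q.one ⊗ₜ (x ⊗ₜ y))) = _
    rw [counit_one, one_smul]; rfl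
  have h4 : pull Q.mulSecond Q.reassoc ∘ₗ m.toLinearMap = Q.atOneLeft Q.reassoc := by
    refine TensorProduct.ext' fun x y => ?_
    change Q.reassoc (Q.one ⊗ₜ (Q.mul (Q.one ⊗ₜ x) ⊗ₜ y)) = _
    rw [Q.one_mul]; rfl
  have h5 : pull (dropLast K H) Q.reassoc ∘ₗ m.toLinearMap = 1 := by
    refine TensorProduct.ext' fun x y => ?_
    change Q.reassoc (Q.one ⊗ₜ (Q.one ⊗ₜ (Coalgebra.counit (R := K) y • x))) = _
    rw [Q.reassoc_one, counit_one, _root_.one_mul, map_smul]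
    rfl
  rw [h1, h2, h3, h4, h5, _root_.one_mul, _root_.mul_one] at h
  exact h.symm

/-- The pentagon at x ⊗ y ⊗ 1 ⊗ 1 makes φ(·, ·, 1) idempotent, and invertibility concludes. -/
theorem atOneRight_reassoc : Q.atOneRight Q.reassoc = 1 := by
  have hab : Q.atOneRight Q.reassoc * Q.atOneRight Q.reassocInv = 1 := by
    rw [atOneRight, atOneRight, ← mul_comp_coalgHom, reassoc_mul_inv', one_comp_coalgHom]
  refine eq_one_of_mul_self hab ?_
  let m : H ⊗[K] H →ₗc[K] H ⊗[K] (H ⊗[K] (H ⊗[K] H)) :=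
    Coalgebra.TensorProduct.map (.id K H)
      ((Coalgebra.TensorProduct.map (.id K H) (tmulRight Q.isGroupLikeElem_one)).comp
        (tmulRight Q.isGroupLikeElem_one))
  have h := congrArg (fun F => F ∘ₗ m.toLinearMap) Q.pentagon_pull
  simp only [mul_comp_coalgHom] at h
  have h1 : pull Q.mulThird Q.reassoc ∘ₗ m.toLinearMap = Q.atOneRight Q.reassoc := by
    refine TensorProduct.ext' fun x y => ?_
    change Q.reassoc (x ⊗ₜ (y ⊗ₜ Q.mul (Q.one ⊗ₜ Q.one))) = _
    rw [Q.one_mul]; rfl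
  have h2 : pull Q.mulFirst Q.reassoc ∘ₗ m.toLinearMap = 1 := by
    refine TensorProduct.ext' fun x y => ?_
    change Q.reassoc (Q.mul (x ⊗ₜ y) ⊗ₜ (Q.one ⊗ₜ Q.one)) = _
    rw [Q.reassoc_one, counit_one, _root_.mul_one]
    exact CoalgHomClass.counit_comp_apply Q.mul (x ⊗ₜ[K] y)
  have h3 : pull (dropFirst K H) Q.reassoc ∘ₗ m.toLinearMap = 1 := by
    refine TensorProduct.ext' fun x y => ?_
    change Q.reassoc (Coalgebra.counit (R := K) x • (y ⊗ₜ (Q.one ⊗ₜ Q.one))) = _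
    rw [map_smul, Q.reassoc_one, counit_one, _root_.mul_one, smul_eq_mul, mul_comm]
    rfl
  have h4 : pull Q.mulSecond Q.reassoc ∘ₗ m.toLinearMap = Q.atOneRight Q.reassoc := by
    refine TensorProduct.ext' fun x y => ?_
    change Q.reassoc (x ⊗ₜ (Q.mul (y ⊗ₜ Q.one) ⊗ₜ Q.one)) = _
    rw [Q.mul_one]; rfl
  have h5 : pull (dropLast K H) Q.reassoc ∘ₗ m.toLinearMap = Q.atOneRight Q.reassoc := by
    refine TensorProduct.ext' fun x y => ?_
    change Q.reassoc (x ⊗ₜ (y ⊗ₜ (Coalgebra.counit (R := K) Q.one • Q.one))) = _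
    rw [counit_one, one_smul]; rfl
  rw [h1, h2, h3, h4, h5, _root_.one_mul, _root_.mul_one] at h
  exact h.symm

theorem atOneMid_reassoc : Q.atOneMid Q.reassoc = 1 :=
  TensorProduct.ext' fun x y => (Q.reassoc_one x y).trans (mul_comm _ _)

theorem reassoc_one_left (x y : H) : Q.reassoc (Q.one ⊗ₜ[K] (x ⊗ₜ[K] y)) =
    Coalgebra.counit (R := K) x * Coalgebra.counit (R := K) y :=
  (LinearMap.congr_fun Q.atOneLeft_reassoc (x ⊗ₜ[K] y)).trans (mul_comm _ _)

theorem reassoc_one_right (x y : H) : Q.reassoc (x ⊗ₜ[K] (y ⊗ₜ[K] Q.one)) =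
    Coalgebra.counit (R := K) x * Coalgebra.counit (R := K) y :=
  (LinearMap.congr_fun Q.atOneRight_reassoc (x ⊗ₜ[K] y)).trans (mul_comm _ _)

theorem reassocInv_one_left (x y : H) : Q.reassocInv (Q.one ⊗ₜ[K] (x ⊗ₜ[K] y)) =
    Coalgebra.counit (R := K) x * Coalgebra.counit (R := K) y := by
  have h : Q.atOneLeft Q.reassoc * Q.atOneLeft Q.reassocInv = 1 := by
    rw [atOneLeft, atOneLeft, ← mul_comp_coalgHom, reassoc_mul_inv', one_comp_coalgHom]
  rw [atOneLeft_reassoc, _root_.one_mul] at h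
  exact (LinearMap.congr_fun h (x ⊗ₜ[K] y)).trans (mul_comm _ _)

theorem reassocInv_one_mid (x y : H) : Q.reassocInv (x ⊗ₜ[K] (Q.one ⊗ₜ[K] y)) =
    Coalgebra.counit (R := K) x * Coalgebra.counit (R := K) y := by
  have h : Q.atOneMid Q.reassoc * Q.atOneMid Q.reassocInv = 1 := by
    rw [atOneMid, atOneMid, ← mul_comp_coalgHom, reassoc_mul_inv', one_comp_coalgHom]
  rw [atOneMid_reassoc, _root_.one_mul] at h
  exact (LinearMap.congr_fun h (x ⊗ₜ[K] y)).trans (mul_comm _ _)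

theorem reassocInv_one_right (x y : H) : Q.reassocInv (x ⊗ₜ[K] (y ⊗ₜ[K] Q.one)) =
    Coalgebra.counit (R := K) x * Coalgebra.counit (R := K) y := by
  have h : Q.atOneRight Q.reassoc * Q.atOneRight Q.reassocInv = 1 := by
    rw [atOneRight, atOneRight, ← mul_comp_coalgHom, reassoc_mul_inv', one_comp_coalgHom]
  rw [atOneRight_reassoc, _root_.one_mul] at h
  exact (LinearMap.congr_fun h (x ⊗ₜ[K] y)).trans (mul_comm _ _)

/-! ### Translations of functionals -/

/-- `f ↦ (x ↦ f(xz))`. -/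
def ract : H →ₗ[K] Module.Dual K H →ₗ[K] Module.Dual K H :=
  (LinearMap.llcomp K H H K).flip ∘ₗ (TensorProduct.curry Q.mul.toLinearMap).flip

/-- `f ↦ (x ↦ f(zx))`. -/
def lact : H →ₗ[K] Module.Dual K H →ₗ[K] Module.Dual K H :=
  (LinearMap.llcomp K H H K).flip ∘ₗ TensorProduct.curry Q.mul.toLinearMap

theorem ract_apply (z x : H) (f : Module.Dual K H) : Q.ract z f x = f (Q.mul (x ⊗ₜ z)) := rfl

theorem lact_apply (z x : H) (f : Module.Dual K H) : Q.lact z f x = f (Q.mul (z ⊗ₜ x)) := rfl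

theorem ract_one (f : Module.Dual K H) : Q.ract Q.one f = f :=
  LinearMap.ext fun x => by rw [ract_apply, Q.mul_one]

theorem lact_one (f : Module.Dual K H) : Q.lact Q.one f = f :=
  LinearMap.ext fun x => by rw [lact_apply, Q.one_mul]

variable {ι κ : Type*} [Fintype ι] [DecidableEq ι] [Fintype κ] [DecidableEq κ]
  {c : ι → ι → H} {d : κ → κ → H}

/-- Multiplication is a coalgebra map, so translating a convolution product comultiplies the
translating element. -/
theorem ract_mul (hc : IsComatrix K c) (f g : Module.Dual K H) (i j : ι) :
    Q.ract (c i j) (f * g) = ∑ k, Q.ract (c i k) f * Q.ract (c k j) g := by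
  rw [ract, LinearMap.comp_apply]
  change (f * g) ∘ₗ _ = _
  have h := flip_curry_mul hc (f ∘ₗ Q.mul.toLinearMap) (g ∘ₗ Q.mul.toLinearMap) i j
  rw [← mul_comp_coalgHom] at h
  exact h

theorem lact_mul (hc : IsComatrix K c) (f g : Module.Dual K H) (i j : ι) :
    Q.lact (c i j) (f * g) = ∑ k, Q.lact (c i k) f * Q.lact (c k j) g := by
  have h := curry_mul hc (f ∘ₗ Q.mul.toLinearMap) (g ∘ₗ Q.mul.toLinearMap) i j
  rw [← mul_comp_coalgHom] at h
  exact h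

open Coalgebra.TensorProduct in
/-- `h ⊗ g ⊗ f ↦ h(gf)`. -/
def mulRightNested : H ⊗[K] (H ⊗[K] H) →ₗc[K] H := Q.mul.comp (map (.id K H) Q.mul)

open Coalgebra.TensorProduct in
/-- `h ⊗ g ⊗ f ↦ (hg)f`. -/
def mulLeftNested : H ⊗[K] (H ⊗[K] H) →ₗc[K] H :=
  (Q.mul.comp (map Q.mul (.id K H))).comp
    ((Coalgebra.TensorProduct.assoc K K H H H).symm : _ →ₗc[K] _)

theorem comp_mul_reassoc (f : Module.Dual K H) :
    (f ∘ₗ Q.mulRightNested.toLinearMap) * Q.reassoc =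
      Q.reassoc * (f ∘ₗ Q.mulLeftNested.toLinearMap) := by
  have h := congrArg (fun F => f ∘ₗ F) Q.quasi_assoc
  refine LinearMap.ext fun x => ?_
  refine Eq.trans ?_ ((LinearMap.congr_fun h x).trans ?_)
  · rw [dual_mul_apply]
    simp only [LinearMap.comp_apply, convRight, conv]
    induction (Coalgebra.comul (R := K) x) with
    | zero => simp
    | tmul y z => exact (mul_comm (f _) (Q.reassoc z)).trans (map_smul f (Q.reassoc z) _).symm
    | add y z hy hz => simp only [map_add, hy, hz]
  · rw [dual_mul_apply]
    simp only [LinearMap.comp_apply, convLeft, conv]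
    induction (Coalgebra.comul (R := K) x) with
    | zero => simp
    | tmul y z => exact map_smul f (Q.reassoc y) _
    | add y z hy hz => simp only [map_add, hy, hz]

theorem reassocInv_mul_comp (f : Module.Dual K H) :
    Q.reassocInv * (f ∘ₗ Q.mulRightNested.toLinearMap) =
      (f ∘ₗ Q.mulLeftNested.toLinearMap) * Q.reassocInv := by
  calc _ = Q.reassocInv * ((f ∘ₗ Q.mulRightNested.toLinearMap) * Q.reassoc) * Q.reassocInv := by
        rw [mul_assoc, mul_assoc, reassoc_mul_inv', _root_.mul_one]
    _ = _ := by rw [comp_mul_reassoc, ← mul_assoc, reassocInv_mul', _root_.one_mul]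

end DualQuasiBialgebra

/-! ### The antipode axioms on entries of a comatrix -/

namespace DualQuasiHopfAlgebra

variable {K H : Type*} [Field K] [AddCommGroup H] [Module K H] [Coalgebra K H]
  (Q : DualQuasiHopfAlgebra K H)
  {ι : Type*} [Fintype ι] [DecidableEq ι] {c : ι → ι → H}

/-- The transposition compensates for S reversing the comultiplication. -/
theorem isComatrix_antipode (hc : IsComatrix K c) :
    IsComatrix K (fun i j => Q.antipode (c j i)) where
  comul_eq i j := by
    have h := LinearMap.congr_fun Q.comul_antipode (c j i)
    simp only [LinearMap.comp_apply] at h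
    rw [h, hc.comul_eq]
    simp
  counit_eq i j := by
    have h := LinearMap.congr_fun Q.counit_antipode (c j i)
    simp only [LinearMap.comp_apply] at h
    rw [h, hc.counit_eq]
    simp [eq_comm]

theorem convLeft_entry {A : Type*} [AddCommGroup A] [Module K A] (hc : IsComatrix K c)
    (f : Module.Dual K H) (F : H →ₗ[K] A) (i j : ι) :
    convLeft f F (c i j) = ∑ k, f (c i k) • F (c k j) := hc.conv_apply _ f F i j

theorem convRight_entry {A : Type*} [AddCommGroup A] [Module K A] (hc : IsComatrix K c)
    (f : Module.Dual K H) (F : H →ₗ[K] A) (i j : ι) :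
    convRight F f (c i j) = ∑ k, f (c k j) • F (c i k) := hc.conv_apply _ F f i j

theorem sum_antipode_left (hc : IsComatrix K c) (i j : ι) :
    ∑ k, ∑ l, Q.α (c k l) • Q.mul (Q.antipode (c i k) ⊗ₜ[K] c l j) = Q.α (c i j) • Q.one := by
  have h := LinearMap.congr_fun Q.antipode_left (c i j)
  rw [hc.conv_apply] at h
  simp only [convRight_entry hc, map_sum, map_smul, LinearMap.sum_apply,
    LinearMap.smul_apply] at h
  rw [Finset.sum_comm]
  exact h

theorem sum_antipode_right (hc : IsComatrix K c) (i j : ι) :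
    ∑ k, ∑ l, Q.β (c k l) • Q.mul (c i k ⊗ₜ[K] Q.antipode (c l j)) = Q.β (c i j) • Q.one := by
  have h := LinearMap.congr_fun Q.antipode_right (c i j)
  rw [hc.conv_apply] at h
  simp only [convRight_entry hc, map_sum, map_smul, LinearMap.sum_apply,
    LinearMap.smul_apply] at h
  rw [Finset.sum_comm]
  exact h

theorem comul₃_entry (hc : IsComatrix K c) (i n : ι) :
    comul₃ K H (c i n) = ∑ p, ∑ q, c i p ⊗ₜ[K] (c p q ⊗ₜ[K] c q n) := by
  simp [comul₃, hc.comul_eq, TensorProduct.tmul_sum]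

theorem sum_reassoc_antipode (hc : IsComatrix K c) (i n : ι) :
    ∑ j, ∑ k, Q.β (c j k) * ∑ l, ∑ m, Q.α (c l m) *
      Q.reassoc (c i j ⊗ₜ[K] (Q.antipode (c k l) ⊗ₜ[K] c m n)) = if i = n then 1 else 0 := by
  have h := LinearMap.congr_fun Q.reassoc_antipode (c i n)
  rw [hc.counit_eq] at h
  rw [← h]
  simp only [LinearMap.comp_apply, comul₃_entry hc, map_sum, TensorProduct.map_tmul,
    convRight_entry hc, convLeft_entry hc, LinearMap.id_apply]
  rw [Finset.sum_comm]
  refine Finset.sum_congr rfl fun k _ => ?_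
  simp only [TensorProduct.sum_tmul,
    TensorProduct.tmul_sum, ← TensorProduct.smul_tmul', TensorProduct.tmul_smul, map_sum,
    map_smul, smul_eq_mul, Finset.mul_sum]
  rw [Finset.sum_comm]
  refine Finset.sum_congr rfl fun l _ => ?_
  rw [Finset.sum_comm]
  exact Finset.sum_congr rfl fun m _ => Finset.sum_congr rfl fun j _ => mul_left_comm _ _ _

theorem sum_reassocInv_antipode (hc : IsComatrix K c) (i n : ι) :
    ∑ m, ∑ l, Q.β (c m l) * ∑ j, ∑ k, Q.α (c j k) *
      Q.reassocInv (Q.antipode (c i j) ⊗ₜ[K] (c k m ⊗ₜ[K] Q.antipode (c l n))) =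
        if i = n then 1 else 0 := by
  have h := LinearMap.congr_fun Q.reassocInv_antipode (c i n)
  rw [hc.counit_eq] at h
  rw [← h]
  simp only [LinearMap.comp_apply, comul₃_entry hc, map_sum, TensorProduct.map_tmul,
    convLeft_entry hc, LinearMap.id_apply]
  simp only [TensorProduct.sum_tmul,
    TensorProduct.tmul_sum, ← TensorProduct.smul_tmul', TensorProduct.tmul_smul, map_sum,
    map_smul, smul_eq_mul, Finset.mul_sum]
  conv_rhs => rw [Finset.sum_comm]
  refine Finset.sum_congr rfl fun m _ => ?_
  conv_rhs => rw [Finset.sum_comm]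

/-! ### The functionals `q`, `p`, `l`, `m` -/

/-- `q(y)(x) = φ(x, S(y₁), α(y₂)y₃)`. -/
def qMap : H →ₗ[K] Module.Dual K H :=
  Q.sigma ∘ₗ TensorProduct.map Q.antipode (convLeft Q.α LinearMap.id) ∘ₗ Coalgebra.comul

/-- `p(y)(x) = φ⁻¹(x, y₁, β(y₂)S(y₃))`. -/
def pInvMap : H →ₗ[K] Module.Dual K H :=
  Q.sigmaInv ∘ₗ TensorProduct.map (convRight LinearMap.id Q.β) Q.antipode ∘ₗ Coalgebra.comul

/-- `l(y)(x) = φ⁻¹(S(y₁), α(y₂)y₃, x)`. -/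
def lMap : H →ₗ[K] Module.Dual K H :=
  TensorProduct.curry (Q.reassocInv ∘ₗ (TensorProduct.assoc K H H H).toLinearMap) ∘ₗ
    TensorProduct.map Q.antipode (convLeft Q.α LinearMap.id) ∘ₗ Coalgebra.comul

/-- `m(y)(x) = φ(y₁β(y₂), S(y₃), x)`. -/
def mMap : H →ₗ[K] Module.Dual K H :=
  TensorProduct.curry (Q.reassoc ∘ₗ (TensorProduct.assoc K H H H).toLinearMap) ∘ₗ
    TensorProduct.map (convRight LinearMap.id Q.β) Q.antipode ∘ₗ Coalgebra.comul

theorem qMap_entry (hc : IsComatrix K c) (i j : ι) : Q.qMap (c i j) =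
    ∑ k, ∑ l, Q.α (c k l) • Q.sigma (Q.antipode (c i k) ⊗ₜ[K] c l j) := by
  simp [qMap, hc.comul_eq, convLeft_entry hc, TensorProduct.tmul_sum]

theorem pInvMap_entry (hc : IsComatrix K c) (i j : ι) : Q.pInvMap (c i j) =
    ∑ k, ∑ l, Q.β (c k l) • Q.sigmaInv (c i k ⊗ₜ[K] Q.antipode (c l j)) := by
  rw [Finset.sum_comm]
  simp [pInvMap, hc.comul_eq, convRight_entry hc, TensorProduct.sum_tmul,
    ← TensorProduct.smul_tmul']

theorem lMap_entry (hc : IsComatrix K c) (i j : ι) (x : H) : Q.lMap (c i j) x =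
    ∑ k, ∑ l, Q.α (c k l) • Q.reassocInv (Q.antipode (c i k) ⊗ₜ[K] (c l j ⊗ₜ[K] x)) := by
  simp [lMap, hc.comul_eq, convLeft_entry hc, TensorProduct.tmul_sum]

theorem mMap_entry (hc : IsComatrix K c) (i j : ι) (x : H) : Q.mMap (c i j) x =
    ∑ k, ∑ l, Q.β (c k l) • Q.reassoc (c i k ⊗ₜ[K] (Q.antipode (c l j) ⊗ₜ[K] x)) := by
  rw [Finset.sum_comm]
  simp [mMap, hc.comul_eq, convRight_entry hc, TensorProduct.sum_tmul,
    ← TensorProduct.smul_tmul']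

theorem pInvMap_at_one (h : H) : Q.pInvMap h Q.one = Q.β h := by
  refine LinearMap.congr_fun (f := LinearMap.applyₗ Q.one ∘ₗ Q.pInvMap)
    (ext_comatrix fun n c hc i j => ?_) h
  rw [LinearMap.comp_apply, pInvMap_entry Q hc]
  have h1 : ∀ x y : H, Q.sigmaInv (x ⊗ₜ[K] y) Q.one =
    Coalgebra.counit (R := K) x * Coalgebra.counit (R := K) y := Q.reassocInv_one_left
  simp [h1, (Q.isComatrix_antipode hc).counit_eq, hc.counit_eq]

end DualQuasiHopfAlgebra

end DualQuasi

namespace DualQuasi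

attribute [local instance] dualRing dualIsScalarTower dualSMulCommClass

namespace DualQuasiHopfAlgebra

variable {K H : Type*} [Field K] [AddCommGroup H] [Module K H] [Coalgebra K H]
  (Q : DualQuasiHopfAlgebra K H)
  {ι κ : Type*} [Fintype ι] [DecidableEq ι] [Fintype κ] [DecidableEq κ]
  {c : ι → ι → H} {d : κ → κ → H}

/-! ### Consequences of quasi-associativity -/

theorem sum_ract_mul_sigma (hc : IsComatrix K c) (hd : IsComatrix K d) (f : Module.Dual K H)
    (i j : ι × κ) :
    ∑ k : ι × κ, Q.ract (Q.mul (c i.1 k.1 ⊗ₜ[K] d i.2 k.2)) f *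
        Q.sigma (c k.1 j.1 ⊗ₜ[K] d k.2 j.2) =
      ∑ k : ι × κ, Q.sigma (c i.1 k.1 ⊗ₜ[K] d i.2 k.2) *
        Q.ract (c k.1 j.1) (Q.ract (d k.2 j.2) f) := by
  have h := congrArg (fun F => (TensorProduct.curry F).flip (c i.1 j.1 ⊗ₜ[K] d i.2 j.2))
    (Q.comp_mul_reassoc f)
  simp only [flip_curry_mul (hc.tmul hd) _ _ i j] at h
  exact h

theorem sum_sigmaInv_mul_ract (hc : IsComatrix K c) (hd : IsComatrix K d) (f : Module.Dual K H)
    (i j : ι × κ) :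
    ∑ k : ι × κ, Q.sigmaInv (c i.1 k.1 ⊗ₜ[K] d i.2 k.2) *
        Q.ract (Q.mul (c k.1 j.1 ⊗ₜ[K] d k.2 j.2)) f =
      ∑ k : ι × κ, Q.ract (c i.1 k.1) (Q.ract (d i.2 k.2) f) *
        Q.sigmaInv (c k.1 j.1 ⊗ₜ[K] d k.2 j.2) := by
  have h := congrArg (fun F => (TensorProduct.curry F).flip (c i.1 j.1 ⊗ₜ[K] d i.2 j.2))
    (Q.reassocInv_mul_comp f)
  simp only [flip_curry_mul (hc.tmul hd) _ _ i j] at h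
  exact h

/-- A functional on `H ⊗ H ⊗ H` as a map `H ⊗ H → H*`, with the last variable kept. -/
def lastVar (ψ : Module.Dual K (H ⊗[K] (H ⊗[K] H))) : H ⊗[K] H →ₗ[K] Module.Dual K H :=
  TensorProduct.curry (ψ ∘ₗ ((Coalgebra.TensorProduct.assoc K K H H H : _ →ₗc[K] _)).toLinearMap)

theorem lastVar_tmul (ψ : Module.Dual K (H ⊗[K] (H ⊗[K] H))) (x y z : H) :
    lastVar ψ (x ⊗ₜ y) z = ψ (x ⊗ₜ (y ⊗ₜ z)) := rfl

theorem lastVar_mul {z : κ → κ → H ⊗[K] H} (hz : IsComatrix K z)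
    (ψ χ : Module.Dual K (H ⊗[K] (H ⊗[K] H))) (i j : κ) :
    lastVar (ψ * χ) (z i j) = ∑ k, lastVar ψ (z i k) * lastVar χ (z k j) := by
  rw [lastVar, mul_comp_coalgHom]
  exact curry_mul hz _ _ i j

theorem sum_lact_mul_reassocInv (hc : IsComatrix K c) (hd : IsComatrix K d) (f : Module.Dual K H)
    (i j : ι × κ) :
    ∑ k : ι × κ, lastVar Q.reassocInv (c i.1 k.1 ⊗ₜ[K] d i.2 k.2) *
        Q.lact (d k.2 j.2) (Q.lact (c k.1 j.1) f) =
      ∑ k : ι × κ, Q.lact (Q.mul (c i.1 k.1 ⊗ₜ[K] d i.2 k.2)) f *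
        lastVar Q.reassocInv (c k.1 j.1 ⊗ₜ[K] d k.2 j.2) := by
  have h := congrArg (fun F => lastVar F (c i.1 j.1 ⊗ₜ[K] d i.2 j.2))
    (Q.reassocInv_mul_comp f)
  simp only [lastVar_mul (hc.tmul hd) _ _ i j] at h
  exact h

theorem lMap_entry' (hc : IsComatrix K c) (i j : ι) : Q.lMap (c i j) =
    ∑ k, ∑ l, Q.α (c k l) • lastVar Q.reassocInv (Q.antipode (c i k) ⊗ₜ[K] c l j) :=
  LinearMap.ext fun x => by
    rw [Q.lMap_entry hc]; simp [lastVar_tmul]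

theorem mMap_entry' (hc : IsComatrix K c) (i j : ι) : Q.mMap (c i j) =
    ∑ k, ∑ l, Q.β (c k l) • lastVar Q.reassoc (c i k ⊗ₜ[K] Q.antipode (c l j)) :=
  LinearMap.ext fun x => by
    rw [Q.mMap_entry hc]; simp [lastVar_tmul]

/-- The contraction with `α`, inside a linear map. -/
theorem sum_alpha_map {V : Type*} [AddCommGroup V] [Module K V] (hc : IsComatrix K c)
    (F : H →ₗ[K] V) (i j : ι) :
    ∑ k, ∑ l, Q.α (c k l) • F (Q.mul (Q.antipode (c i k) ⊗ₜ[K] c l j)) = Q.α (c i j) • F Q.one := by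
  have h := congrArg F (Q.sum_antipode_left hc i j)
  simpa only [map_sum, map_smul] using h

/-- The contraction with `β`, inside a linear map. -/
theorem sum_beta_map {V : Type*} [AddCommGroup V] [Module K V] (hc : IsComatrix K c)
    (F : H →ₗ[K] V) (i j : ι) :
    ∑ k, ∑ l, Q.β (c k l) • F (Q.mul (c i k ⊗ₜ[K] Q.antipode (c l j))) = Q.β (c i j) • F Q.one := by
  have h := congrArg F (Q.sum_antipode_right hc i j)
  simpa only [map_sum, map_smul] using h

/-- `f * q(y) = q(y₂) * (f translated by S(y₁) and y₃)`. -/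
theorem mul_qMap (hc : IsComatrix K c) (f : Module.Dual K H) (i j : ι) :
    f * Q.qMap (c i j) =
      ∑ k, ∑ l, Q.qMap (c k l) * Q.ract (Q.antipode (c i k)) (Q.ract (c l j) f) := by
  have h := Q.sum_ract_mul_sigma (Q.isComatrix_antipode hc) hc f
  -- Summing against α contracts S(y₁)α(y₂)y₃ to a multiple of 1 in the left-hand translate of f,
  -- which becomes f itself.
  have h' : ∑ p : ι × ι, Q.α (c p.1 p.2) • _ = ∑ p : ι × ι, Q.α (c p.1 p.2) • _ :=
    Finset.sum_congr rfl fun p _ => congrArg (Q.α (c p.1 p.2) • ·) (h p (i, j))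
  rw [row_mul (fun p : ι × ι => Q.α (c p.1 p.2))
      (fun p k => Q.ract (Q.mul (Q.antipode (c k.1 p.1) ⊗ₜ[K] c p.2 k.2)) f)
      (fun k j => Q.sigma (Q.antipode (c j.1 k.1) ⊗ₜ[K] c k.2 j.2)),
    row_mul (fun p : ι × ι => Q.α (c p.1 p.2))
      (fun p k => Q.sigma (Q.antipode (c k.1 p.1) ⊗ₜ[K] c p.2 k.2))
      (fun k j => Q.ract (Q.antipode (c j.1 k.1)) (Q.ract (c k.2 j.2) f))] at h'
  simp only [Fintype.sum_prod_type] at h'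
  have hf := fun a b => Q.sum_alpha_map hc (Q.ract.flip f) a b
  simp only [LinearMap.flip_apply, Q.ract_one] at hf
  simp only [hf, ← Q.qMap_entry hc] at h'
  rw [← h', Q.qMap_entry hc]
  simp only [Finset.mul_sum, smul_mul_assoc, mul_smul_comm]

/-- `p(y) * f = (f translated by S(y₃) and y₁) * p(y₂)`. -/
theorem pInvMap_mul (hc : IsComatrix K c) (f : Module.Dual K H) (i j : ι) :
    Q.pInvMap (c i j) * f =
      ∑ k, ∑ l, Q.ract (c i k) (Q.ract (Q.antipode (c l j)) f) * Q.pInvMap (c k l) := by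
  have h := Q.sum_sigmaInv_mul_ract hc (Q.isComatrix_antipode hc) f
  -- Here β contracts y₁β(y₂)S(y₃) to a multiple of 1, which undoes the translation of f on the
  -- left-hand side.
  have h' : ∑ p : ι × ι, Q.β (c p.1 p.2) • _ = ∑ p : ι × ι, Q.β (c p.1 p.2) • _ :=
    Finset.sum_congr rfl fun p _ => congrArg (Q.β (c p.1 p.2) • ·) (h (i, j) p)
  rw [mul_col (fun p : ι × ι => Q.β (c p.1 p.2))
      (fun i k => Q.sigmaInv (c i.1 k.1 ⊗ₜ[K] Q.antipode (c k.2 i.2)))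
      (fun k p => Q.ract (Q.mul (c k.1 p.1 ⊗ₜ[K] Q.antipode (c p.2 k.2))) f),
    mul_col (fun p : ι × ι => Q.β (c p.1 p.2))
      (fun i k => Q.ract (c i.1 k.1) (Q.ract (Q.antipode (c k.2 i.2)) f))
      (fun k p => Q.sigmaInv (c k.1 p.1 ⊗ₜ[K] Q.antipode (c p.2 k.2)))] at h'
  simp only [Fintype.sum_prod_type] at h'
  have hf := fun a b => Q.sum_beta_map hc (Q.ract.flip f) a b
  simp only [LinearMap.flip_apply, Q.ract_one] at hf
  simp only [hf, ← Q.pInvMap_entry hc] at h'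
  rw [← h', Q.pInvMap_entry hc]
  simp only [Finset.sum_mul, smul_mul_assoc, mul_smul_comm]

/-- `f * l(y) = l(y₂) * (f translated by y₃ and S(y₁))`. -/
theorem mul_lMap (hc : IsComatrix K c) (f : Module.Dual K H) (i j : ι) :
    f * Q.lMap (c i j) =
      ∑ k, ∑ l, Q.lMap (c k l) * Q.lact (c l j) (Q.lact (Q.antipode (c i k)) f) := by
  have h := Q.sum_lact_mul_reassocInv (Q.isComatrix_antipode hc) hc f
  have h' : ∑ p : ι × ι, Q.α (c p.1 p.2) • _ = ∑ p : ι × ι, Q.α (c p.1 p.2) • _ :=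
    Finset.sum_congr rfl fun p _ => congrArg (Q.α (c p.1 p.2) • ·) (h p (i, j))
  rw [row_mul (fun p : ι × ι => Q.α (c p.1 p.2))
      (fun p k => lastVar Q.reassocInv (Q.antipode (c k.1 p.1) ⊗ₜ[K] c p.2 k.2))
      (fun k j => Q.lact (c k.2 j.2) (Q.lact (Q.antipode (c j.1 k.1)) f)),
    row_mul (fun p : ι × ι => Q.α (c p.1 p.2))
      (fun p k => Q.lact (Q.mul (Q.antipode (c k.1 p.1) ⊗ₜ[K] c p.2 k.2)) f)
      (fun k j => lastVar Q.reassocInv (Q.antipode (c j.1 k.1) ⊗ₜ[K] c k.2 j.2))] at h'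
  simp only [Fintype.sum_prod_type] at h'
  have hf := fun a b => Q.sum_alpha_map hc (Q.lact.flip f) a b
  simp only [LinearMap.flip_apply, Q.lact_one] at hf
  simp only [hf, ← Q.lMap_entry' hc] at h'
  rw [h', Q.lMap_entry' hc]
  simp only [Finset.mul_sum, smul_mul_assoc, mul_smul_comm]

end DualQuasiHopfAlgebra

end DualQuasi

namespace DualQuasi

attribute [local instance] dualRing dualIsScalarTower dualSMulCommClass

/-! ### Inverse relations from the contracted pentagon -/

section TripleContraction

variable {K A κ : Type*} [Field K] [Ring A] [Module K A] [IsScalarTower K A A]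
  [SMulCommClass K A A] [Fintype κ]

theorem row_mul_mul_col_of_fixed {v w : κ → K} {F E : κ → κ → A}
    (hF : ∀ k, ∑ i, v i • F i k = v k • 1) (hE : ∀ k, ∑ j, w j • E k j = w k • 1)
    (G : κ → κ → A) :
    ∑ j, w j • ∑ i, v i • ∑ r, F i r * ∑ s, G r s * E s j = ∑ j, w j • ∑ i, v i • G i j := by
  have h1 : ∀ j, ∑ i, v i • ∑ r, F i r * ∑ s, G r s * E s j = ∑ i, v i • ∑ s, G i s * E s j :=
    fun j => row_mul_of_fixed hF (fun r j => ∑ s, G r s * E s j) j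
  have h2 : ∀ X : κ → κ → A, ∑ j, w j • ∑ i, v i • X i j = ∑ i, v i • ∑ j, w j • X i j := by
    intro X
    simp only [Finset.smul_sum]
    rw [Finset.sum_comm]
    exact Finset.sum_congr rfl fun _ _ => Finset.sum_congr rfl fun _ _ => smul_comm _ _ _
  simp only [h1]
  rw [h2, h2]
  exact Finset.sum_congr rfl fun i _ => congrArg _ (mul_col_of_fixed hE G i)

omit [IsScalarTower K A A] [SMulCommClass K A A] in
theorem sum_swap_smul (v w : κ → K) (X : κ → κ → A) :
    ∑ j, w j • ∑ i, v i • X i j = ∑ i, v i • ∑ j, w j • X i j := by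
  simp only [Finset.smul_sum]
  rw [Finset.sum_comm]
  exact Finset.sum_congr rfl fun _ _ => Finset.sum_congr rfl fun _ _ => smul_comm _ _ _

/-- Pattern of the contracted pentagon: the weights absorb the two outer factors on the right and
only the middle one survives. In the applications that factor is a scalar matrix, evaluated by an
axiom relating φ to the antipode. -/
theorem row_mul_col_eq_of_fixed {v w : κ → K} (X Y : κ → κ → A) {F G E : κ → κ → A}
    (h : ∀ i j, ∑ r, X i r * Y r j = ∑ r, F i r * ∑ s, G r s * E s j)
    (hF : ∀ k, ∑ i, v i • F i k = v k • 1) (hE : ∀ k, ∑ j, w j • E k j = w k • 1) :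
    ∑ k, (∑ i, v i • X i k) * ∑ j, w j • Y k j = ∑ j, w j • ∑ i, v i • G i j := by
  rw [← row_mul_mul_col_of_fixed hF hE G, ← row_mul_col]
  simp only [h]

/-- The same pattern when one of the absorbed factors stands at the right end of the left-hand side.
-/
theorem row_mul_col_eq_of_fixed' {v w : κ → K} (X Y : κ → κ → A) {B D E : κ → κ → A}
    (h : ∀ i j, ∑ r, X i r * ∑ s, Y r s * B s j = ∑ r, D i r * E r j)
    (hD : ∀ k, ∑ i, v i • D i k = v k • 1) (hB : ∀ k, ∑ j, w j • B k j = w k • 1) :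
    ∑ k, (∑ i, v i • X i k) * ∑ j, w j • Y k j = ∑ j, w j • ∑ i, v i • E i j := by
  have h1 : ∀ j, ∑ i, v i • ∑ r, D i r * E r j = ∑ i, v i • E i j :=
    fun j => row_mul_of_fixed hD E j
  have h2 : ∀ i, ∑ j, w j • ∑ r, X i r * ∑ s, Y r s * B s j = ∑ j, w j • ∑ r, X i r * Y r j := by
    intro i
    rw [mul_col w X (fun r j => ∑ s, Y r s * B s j), mul_col]
    simp only [mul_col_of_fixed hB]
  calc _ = ∑ j, w j • ∑ i, v i • ∑ r, X i r * Y r j := (row_mul_col v w X Y).symm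
    _ = ∑ i, v i • ∑ j, w j • ∑ r, X i r * ∑ s, Y r s * B s j := by
        rw [sum_swap_smul v w (fun i j => ∑ r, X i r * Y r j)]
        simp only [h2]
    _ = ∑ j, w j • ∑ i, v i • ∑ r, D i r * E r j := by
        rw [sum_swap_smul v w (fun i j => ∑ r, D i r * E r j)]
        simp only [h]
    _ = _ := by simp only [h1]

end TripleContraction

section DeltaSums

variable {K A ι : Type*} [Field K] [AddCommGroup A] [Module K A] [Fintype ι] [DecidableEq ι]

theorem sum_ite_fst (i : ι) (a : ι × ι × ι → K)
    (X : ι × ι × ι → A) : ∑ p, (if p.1 = i then a p else 0) • X p =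
      ∑ j, ∑ k, a (i, j, k) • X (i, j, k) := by
  rw [Fintype.sum_prod_type, Finset.sum_eq_single i]
  · simp [Fintype.sum_prod_type]
  · intro b _ hb
    simp [hb]
  · simp

theorem sum_ite_last (i : ι) (a : ι × ι × ι → K)
    (X : ι × ι × ι → A) : ∑ p, (if p.2.2 = i then a p else 0) • X p =
      ∑ j, ∑ k, a (j, k, i) • X (j, k, i) := by
  simp [Fintype.sum_prod_type]

end DeltaSums

namespace DualQuasiHopfAlgebra

open DualQuasiBialgebra

variable {K H : Type*} [Field K] [AddCommGroup H] [Module K H] [Coalgebra K H]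
  (Q : DualQuasiHopfAlgebra K H)
  {ι : Type*} [Fintype ι] [DecidableEq ι] {c : ι → ι → H}

/-- A functional on `H ⊗ D` as a map `D → H*`, with the first variable kept. -/
abbrev firstVar {D : Type*} [AddCommGroup D] [Module K D] (ψ : Module.Dual K (H ⊗[K] D)) :
    D →ₗ[K] Module.Dual K H := (TensorProduct.curry ψ).flip

theorem sigma_one_left (x : H) :
    Q.sigma (Q.one ⊗ₜ[K] x) = Coalgebra.counit (R := K) x • 1 :=
  LinearMap.ext fun y => (Q.reassoc_one y x).trans (mul_comm _ _)

theorem sigma_one_right (x : H) :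
    Q.sigma (x ⊗ₜ[K] Q.one) = Coalgebra.counit (R := K) x • 1 :=
  LinearMap.ext fun y => (Q.reassoc_one_right y x).trans (mul_comm _ _)

theorem sigmaInv_one_left (x : H) :
    Q.sigmaInv (Q.one ⊗ₜ[K] x) = Coalgebra.counit (R := K) x • 1 :=
  LinearMap.ext fun y => (Q.reassocInv_one_mid y x).trans (mul_comm _ _)

theorem sigmaInv_one_right (x : H) :
    Q.sigmaInv (x ⊗ₜ[K] Q.one) = Coalgebra.counit (R := K) x • 1 :=
  LinearMap.ext fun y => (Q.reassocInv_one_right y x).trans (mul_comm _ _)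

theorem counit_antipode_apply (x : H) :
    Coalgebra.counit (R := K) (Q.antipode x) = Coalgebra.counit (R := K) x :=
  LinearMap.congr_fun Q.counit_antipode x

section FirstVar

variable (ψ : Module.Dual K (H ⊗[K] (H ⊗[K] H))) (x y z : H)

theorem firstVar_mulThird : firstVar (pull Q.mulThird ψ) (x ⊗ₜ[K] (y ⊗ₜ[K] z)) =
    firstVar ψ (x ⊗ₜ[K] Q.mul (y ⊗ₜ[K] z)) := rfl

theorem firstVar_mulFirst : firstVar (pull Q.mulFirst ψ) (x ⊗ₜ[K] (y ⊗ₜ[K] z)) =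
    Q.ract x (firstVar ψ (y ⊗ₜ[K] z)) := rfl

theorem firstVar_mulSecond : firstVar (pull Q.mulSecond ψ) (x ⊗ₜ[K] (y ⊗ₜ[K] z)) =
    firstVar ψ (Q.mul (x ⊗ₜ[K] y) ⊗ₜ[K] z) := rfl

theorem firstVar_dropFirst : firstVar (pull (dropFirst K H) ψ) (x ⊗ₜ[K] (y ⊗ₜ[K] z)) =
    ψ (x ⊗ₜ[K] (y ⊗ₜ[K] z)) • 1 :=
  LinearMap.ext fun w => by
    change ψ (Coalgebra.counit (R := K) w • (x ⊗ₜ[K] (y ⊗ₜ[K] z))) =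
      ψ (x ⊗ₜ[K] (y ⊗ₜ[K] z)) * Coalgebra.counit (R := K) w
    rw [map_smul, smul_eq_mul, mul_comm]

theorem firstVar_dropLast : firstVar (pull (dropLast K H) ψ) (x ⊗ₜ[K] (y ⊗ₜ[K] z)) =
    Coalgebra.counit (R := K) z • firstVar ψ (x ⊗ₜ[K] y) := by
  change firstVar ψ (x ⊗ₜ[K] (Coalgebra.counit (R := K) z • y)) = _
  rw [TensorProduct.tmul_smul, map_smul]

theorem firstVar_reassoc : firstVar Q.reassoc = Q.sigma := rfl

theorem firstVar_reassocInv : firstVar Q.reassocInv = Q.sigmaInv := rfl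

end FirstVar

/-- `(q(y₃) translated by y₁) * p(y₂) = ε(y) ε`. -/
theorem sum_ract_qMap_mul_pInvMap (hc : IsComatrix K c) (i n : ι) :
    ∑ k, ∑ l, Q.ract (c i k) (Q.qMap (c l n)) * Q.pInvMap (c k l) = if i = n then 1 else 0 := by
  -- Pentagon with free first variable and y, S(y), y in the others. In φ⁻¹(x, g, fe) the product fe
  -- collapses under α, and in φ(x, gf, e) the product gf collapses under β. What is left is
  -- φ(y₁β(y₂), S(y₃), α(y₄)y₅) = ε(y).
  have hI := mul_inv_eq_of_pentagon Q.pentagon_pull (pull_inv_mul _ Q.mulThird)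
    (pull_mul_inv _ (dropLast K H))
  have hz := hc.tmul ((Q.isComatrix_antipode hc).tmul hc)
  have h := fun p q : ι × ι × ι =>
    congrArg (fun F : Module.Dual K (H ⊗[K] _) => firstVar F (c p.1 q.1 ⊗ₜ[K] (Q.antipode (c q.2.1 p.2.1) ⊗ₜ[K] c p.2.2 q.2.2))) hI
  simp only [flip_curry_mul (C := H) hz, firstVar_mulThird, firstVar_mulFirst, firstVar_mulSecond,
    firstVar_dropFirst, firstVar_dropLast, firstVar_reassoc, firstVar_reassocInv] at h
  -- Each weight contracts two of the three indices; its Kronecker delta pins the remaining one to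
  -- the outer index i or n.
  have key := row_mul_col_eq_of_fixed
    (v := fun p => if p.1 = i then Q.α (c p.2.1 p.2.2) else 0)
    (w := fun p => if p.2.2 = n then Q.β (c p.1 p.2.1) else 0) _ _ h ?_ ?_
  · have hq : ∀ a b d, ∑ k, ∑ l, Q.α (c k l) • Q.ract (c i a)
        (Q.sigma (Q.antipode (c b k) ⊗ₜ[K] c l d)) = Q.ract (c i a) (Q.qMap (c b d)) :=
      fun a b d => by rw [Q.qMap_entry hc]; simp only [map_sum, map_smul]
    have hp : ∀ a b d, ∑ k, ∑ l, Q.β (c k l) • (if d = n then (1 : K) else 0) •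
        Q.sigmaInv (c a k ⊗ₜ[K] Q.antipode (c l b)) =
          if d = n then Q.pInvMap (c a b) else 0 :=
      fun a b d => by rw [Q.pInvMap_entry hc]; split_ifs <;> simp
    have hr : ∑ j, ∑ k, Q.β (c j k) • ∑ l, ∑ m, Q.α (c l m) • Q.reassoc
        (c i j ⊗ₜ[K] (Q.antipode (c k l) ⊗ₜ[K] c m n)) • (1 : Module.Dual K H) =
          if i = n then 1 else 0 := by
      have := congrArg (· • (1 : Module.Dual K H)) (Q.sum_reassoc_antipode hc i n)
      simpa only [Finset.sum_smul, mul_smul, Finset.mul_sum, Finset.smul_sum, ite_smul, one_smul,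
        zero_smul] using this
    simp only [sum_ite_fst, sum_ite_last, hc.counit_eq] at key
    simp only [hq, hp, hr, mul_ite, mul_zero] at key
    rw [← key]
    simp [Fintype.sum_prod_type]
  · intro r
    simp only [sum_ite_fst]
    have := (Q.sum_alpha_map hc (Q.sigmaInv ∘ₗ TensorProduct.mk K H H (c i r.1)) r.2.1 r.2.2)
    simp only [LinearMap.comp_apply, TensorProduct.mk_apply, sigmaInv_one_right, hc.counit_eq] at this
    rw [this]
    by_cases h : r.1 = i <;> simp [h, eq_comm (a := i)]
  · intro r
    simp only [sum_ite_last]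
    have := (Q.sum_beta_map hc (Q.sigma ∘ₗ (TensorProduct.mk K H H).flip (c r.2.2 n)) r.1 r.2.1)
    simp only [LinearMap.comp_apply, TensorProduct.mk_apply, LinearMap.flip_apply, sigma_one_left,
      hc.counit_eq] at this
    rw [this]
    by_cases h : r.2.2 = n <;> simp [h]

/-- `q(y₂) * (p(y₃) translated by S(y₁)) = ε(y) ε`. -/
theorem sum_qMap_mul_ract_pInvMap (hc : IsComatrix K c) (i n : ι) :
    ∑ k, ∑ l, Q.qMap (c k l) * Q.ract (Q.antipode (c i k)) (Q.pInvMap (c l n)) =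
      if i = n then 1 else 0 := by
  -- Pentagon with free first variable and S(y), y, S(y) in the others: now α collapses gf and β
  -- collapses fe, and the axiom for φ⁻¹ evaluates the rest.
  have hI := mul_inv_eq_of_pentagon' Q.pentagon_pull (pull_mul_inv _ Q.mulFirst)
    (pull_inv_mul _ (dropFirst K H)) (pull_inv_mul _ Q.mulSecond)
  have hz := (Q.isComatrix_antipode hc).tmul (hc.tmul (Q.isComatrix_antipode hc))
  have h := fun p q : ι × ι × ι =>
    congrArg (fun F : Module.Dual K (H ⊗[K] _) => firstVar F
      (Q.antipode (c q.1 p.1) ⊗ₜ[K] (c p.2.1 q.2.1 ⊗ₜ[K] Q.antipode (c q.2.2 p.2.2)))) hI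
  simp only [flip_curry_mul (C := H) hz, firstVar_mulThird, firstVar_mulFirst, firstVar_mulSecond,
    firstVar_dropFirst, firstVar_dropLast, firstVar_reassoc, firstVar_reassocInv] at h
  have key := row_mul_col_eq_of_fixed
    (v := fun p => if p.2.2 = n then Q.α (c p.1 p.2.1) else 0)
    (w := fun p => if p.1 = i then Q.β (c p.2.1 p.2.2) else 0) _ _ h ?_ ?_
  · have hq : ∀ a b d, ∑ k, ∑ l, Q.α (c k l) • (if d = n then (1 : K) else 0) •
        Q.sigma (Q.antipode (c a k) ⊗ₜ[K] c l b) =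
          if d = n then Q.qMap (c a b) else 0 :=
      fun a b d => by rw [Q.qMap_entry hc]; split_ifs <;> simp
    have hp : ∀ a b d, ∑ k, ∑ l, Q.β (c k l) • Q.ract (Q.antipode (c i a))
        (Q.sigmaInv (c b k ⊗ₜ[K] Q.antipode (c l d))) =
          Q.ract (Q.antipode (c i a)) (Q.pInvMap (c b d)) :=
      fun a b d => by rw [Q.pInvMap_entry hc]; simp only [map_sum, map_smul]
    have hr : ∑ m, ∑ l, Q.β (c m l) • ∑ j, ∑ k, Q.α (c j k) • Q.reassocInv
        (Q.antipode (c i j) ⊗ₜ[K] (c k m ⊗ₜ[K] Q.antipode (c l n))) • (1 : Module.Dual K H) =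
          if i = n then 1 else 0 := by
      have := congrArg (· • (1 : Module.Dual K H)) (Q.sum_reassocInv_antipode hc i n)
      simpa only [Finset.sum_smul, mul_smul, Finset.mul_sum, Finset.smul_sum, ite_smul, one_smul,
        zero_smul] using this
    simp only [sum_ite_fst, sum_ite_last, Q.counit_antipode_apply, hc.counit_eq] at key
    simp only [hq, hp, hr, ite_mul, zero_mul] at key
    rw [← key]
    simp [Fintype.sum_prod_type]
  · intro r
    simp only [sum_ite_last]
    have := (Q.sum_alpha_map hc (Q.sigmaInv ∘ₗ (TensorProduct.mk K H H).flip
      (Q.antipode (c r.2.2 n))) r.1 r.2.1)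
    simp only [LinearMap.comp_apply, TensorProduct.mk_apply, LinearMap.flip_apply,
      sigmaInv_one_left, Q.counit_antipode_apply, hc.counit_eq] at this
    rw [this]
    by_cases h : r.2.2 = n <;> simp [h]
  · intro r
    simp only [sum_ite_fst]
    have := (Q.sum_beta_map hc (Q.sigma ∘ₗ TensorProduct.mk K H H (Q.antipode (c i r.1)))
      r.2.1 r.2.2)
    simp only [LinearMap.comp_apply, TensorProduct.mk_apply, sigma_one_right,
      Q.counit_antipode_apply, hc.counit_eq] at this
    rw [this]
    by_cases h : r.1 = i <;> simp [h, eq_comm (a := i)]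

/-- A functional on `H ⊗ H ⊗ H ⊗ H` as a map `H ⊗ H ⊗ H → H*`, with the last variable kept. -/
def lastVar₄ (ψ : Module.Dual K (H ⊗[K] (H ⊗[K] (H ⊗[K] H)))) :
    H ⊗[K] (H ⊗[K] H) →ₗ[K] Module.Dual K H :=
  TensorProduct.curry (ψ ∘ₗ ((Coalgebra.TensorProduct.map (.id K H)
    (Coalgebra.TensorProduct.assoc K K H H H : _ →ₗc[K] _)).comp
      (Coalgebra.TensorProduct.assoc K K H (H ⊗[K] H) H :
        (H ⊗[K] (H ⊗[K] H)) ⊗[K] H →ₗc[K] H ⊗[K] ((H ⊗[K] H) ⊗[K] H))).toLinearMap)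

theorem lastVar₄_mul {κ : Type*} [Fintype κ] [DecidableEq κ] {z : κ → κ → H ⊗[K] (H ⊗[K] H)}
    (hz : IsComatrix K z) (ψ χ : Module.Dual K (H ⊗[K] (H ⊗[K] (H ⊗[K] H)))) (i j : κ) :
    lastVar₄ (ψ * χ) (z i j) = ∑ k, lastVar₄ ψ (z i k) * lastVar₄ χ (z k j) := by
  rw [lastVar₄, mul_comp_coalgHom]
  exact curry_mul hz _ _ i j

section LastVar

variable (ψ : Module.Dual K (H ⊗[K] (H ⊗[K] H))) (x y z : H)

theorem lastVar₄_mulThird : lastVar₄ (pull Q.mulThird ψ) (x ⊗ₜ[K] (y ⊗ₜ[K] z)) =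
    Q.lact z (lastVar ψ (x ⊗ₜ[K] y)) := rfl

theorem lastVar₄_mulFirst : lastVar₄ (pull Q.mulFirst ψ) (x ⊗ₜ[K] (y ⊗ₜ[K] z)) =
    lastVar ψ (Q.mul (x ⊗ₜ[K] y) ⊗ₜ[K] z) := rfl

theorem lastVar₄_mulSecond : lastVar₄ (pull Q.mulSecond ψ) (x ⊗ₜ[K] (y ⊗ₜ[K] z)) =
    lastVar ψ (x ⊗ₜ[K] Q.mul (y ⊗ₜ[K] z)) := rfl

theorem lastVar₄_dropFirst : lastVar₄ (pull (dropFirst K H) ψ) (x ⊗ₜ[K] (y ⊗ₜ[K] z)) =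
    Coalgebra.counit (R := K) x • lastVar ψ (y ⊗ₜ[K] z) :=
  LinearMap.ext fun w => map_smul ψ (Coalgebra.counit (R := K) x) (y ⊗ₜ[K] (z ⊗ₜ[K] w))

theorem lastVar₄_dropLast : lastVar₄ (pull (dropLast K H) ψ) (x ⊗ₜ[K] (y ⊗ₜ[K] z)) =
    ψ (x ⊗ₜ[K] (y ⊗ₜ[K] z)) • 1 :=
  LinearMap.ext fun w => by
    change ψ (x ⊗ₜ[K] (y ⊗ₜ[K] (Coalgebra.counit (R := K) w • z))) =
      ψ (x ⊗ₜ[K] (y ⊗ₜ[K] z)) * Coalgebra.counit (R := K) w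
    simp [mul_comm]

theorem lastVar_reassoc_one_left :
    lastVar Q.reassoc (Q.one ⊗ₜ[K] x) = Coalgebra.counit (R := K) x • 1 :=
  LinearMap.ext fun y => Q.reassoc_one_left x y

theorem lastVar_reassoc_one_right :
    lastVar Q.reassoc (x ⊗ₜ[K] Q.one) = Coalgebra.counit (R := K) x • 1 :=
  LinearMap.ext fun y => Q.reassoc_one x y

end LastVar

/-- `l(y₂) * (m(y₁) translated by y₃) = ε(y) ε`. -/
theorem sum_lMap_mul_lact_mMap (hc : IsComatrix K c) (i n : ι) :
    ∑ k, ∑ l, Q.lMap (c k l) * Q.lact (c l n) (Q.mMap (c i k)) = if i = n then 1 else 0 := by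
  -- Here the last variable is free and the first three are y, S(y), y. The factors φ(hg, f, x) and
  -- φ(h, gf, x) collapse under β and α respectively.
  have hI := inv_mul_eq_of_pentagon Q.pentagon_pull (pull_inv_mul _ (dropFirst K H))
  have hz := hc.tmul ((Q.isComatrix_antipode hc).tmul hc)
  have h := fun p q : ι × ι × ι =>
    congrArg (fun F => lastVar₄ F
      (c p.1 q.1 ⊗ₜ[K] (Q.antipode (c q.2.1 p.2.1) ⊗ₜ[K] c p.2.2 q.2.2))) hI
  simp only [lastVar₄_mul hz, lastVar₄_mulThird, lastVar₄_mulFirst, lastVar₄_mulSecond,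
    lastVar₄_dropFirst, lastVar₄_dropLast] at h
  have key := row_mul_col_eq_of_fixed'
    (v := fun p => if p.1 = i then Q.α (c p.2.1 p.2.2) else 0)
    (w := fun p => if p.2.2 = n then Q.β (c p.1 p.2.1) else 0) _ _ h ?_ ?_
  · have hl : ∀ a b d, ∑ k, ∑ l, Q.α (c k l) • (if i = a then (1 : K) else 0) •
        lastVar Q.reassocInv (Q.antipode (c b k) ⊗ₜ[K] c l d) =
          if i = a then Q.lMap (c b d) else 0 :=
      fun a b d => by rw [Q.lMap_entry' hc]; split_ifs <;> simp
    have hm : ∀ a b d, ∑ k, ∑ l, Q.β (c k l) • Q.lact (c d n)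
        (lastVar Q.reassoc (c a k ⊗ₜ[K] Q.antipode (c l b))) =
          Q.lact (c d n) (Q.mMap (c a b)) :=
      fun a b d => by rw [Q.mMap_entry' hc]; simp only [map_sum, map_smul]
    have hr : ∑ j, ∑ k, Q.β (c j k) • ∑ l, ∑ m, Q.α (c l m) • Q.reassoc
        (c i j ⊗ₜ[K] (Q.antipode (c k l) ⊗ₜ[K] c m n)) • (1 : Module.Dual K H) =
          if i = n then 1 else 0 := by
      have := congrArg (· • (1 : Module.Dual K H)) (Q.sum_reassoc_antipode hc i n)
      simpa only [Finset.sum_smul, mul_smul, Finset.mul_sum, Finset.smul_sum, ite_smul, one_smul,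
        zero_smul] using this
    simp only [sum_ite_fst, sum_ite_last, hc.counit_eq] at key
    simp only [hl, hm, hr] at key
    rw [← key]
    simp [Fintype.sum_prod_type]
  · intro r
    simp only [sum_ite_fst]
    have := (Q.sum_alpha_map hc (lastVar Q.reassoc ∘ₗ TensorProduct.mk K H H (c i r.1))
      r.2.1 r.2.2)
    simp only [LinearMap.comp_apply, TensorProduct.mk_apply, lastVar_reassoc_one_right,
      hc.counit_eq] at this
    rw [this]
    by_cases h : r.1 = i <;> simp [h, eq_comm (a := i)]
  · intro r
    simp only [sum_ite_last]
    have := (Q.sum_beta_map hc (lastVar Q.reassoc ∘ₗ (TensorProduct.mk K H H).flip (c r.2.2 n))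
      r.1 r.2.1)
    simp only [LinearMap.comp_apply, TensorProduct.mk_apply, LinearMap.flip_apply,
      lastVar_reassoc_one_left, hc.counit_eq] at this
    rw [this]
    by_cases h : r.2.2 = n <;> simp [h]

end DualQuasiHopfAlgebra

end DualQuasi

namespace DualQuasi

attribute [local instance] dualRing dualIsScalarTower dualSMulCommClass

/-! ### Coideals and convolution -/

section Coideal

variable {K C V : Type*} [Field K] [AddCommGroup C] [Module K C] [Coalgebra K C]
  [AddCommGroup V] [Module K V]

theorem apply_convRight_id (f g : Module.Dual K C) (x : C) :
    g (convRight LinearMap.id f x) = (g * f) x := by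
  refine LinearMap.congr_fun (f := g ∘ₗ convRight LinearMap.id f) (ext_comatrix fun n c hc i j => ?_) x
  rw [hc.mul_apply, LinearMap.comp_apply, convRight, hc.conv_apply, map_sum]
  exact Finset.sum_congr rfl fun k _ => (map_smul g _ _).trans (mul_comm _ _)

theorem apply_convLeft_id (f g : Module.Dual K C) (x : C) :
    g (convLeft f LinearMap.id x) = (f * g) x := by
  refine LinearMap.congr_fun (f := g ∘ₗ convLeft f LinearMap.id) (ext_comatrix fun n c hc i j => ?_) x
  rw [hc.mul_apply, LinearMap.comp_apply, convLeft, hc.conv_apply, map_sum]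
  exact Finset.sum_congr rfl fun k _ => map_smul g _ _

/-- If `f(x₂)x₁ ∈ N` for all functionals `f`, then `Δ(x) ∈ N ⊗ C`. -/
theorem map_comul_eq_zero_of_convRight {N : Submodule K C} {x : C}
    (hx : ∀ f : Module.Dual K C, convRight LinearMap.id f x ∈ N) (B : C ⊗[K] C →ₗ[K] V)
    (hB : ∀ n ∈ N, ∀ y, B (n ⊗ₜ[K] y) = 0) : B (Coalgebra.comul x) = 0 := by
  classical
  let b := Module.Basis.ofVectorSpace K C
  let e := TensorProduct.equivFinsuppOfBasisRight (M := C) b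
  -- Along a basis of the right factor, the coefficients of Δ(x) are the elements f(x₂)x₁ for
  -- coordinate functionals f, and these lie in `N`.
  have h : Coalgebra.comul (R := K) x = ∑ i ∈ (e (Coalgebra.comul x)).support,
      e (Coalgebra.comul x) i ⊗ₜ[K] b i := by
    conv_lhs => rw [← e.symm_apply_apply (Coalgebra.comul x)]
    exact TensorProduct.equivFinsuppOfBasisRight_symm_apply b _
  rw [h, map_sum]
  refine Finset.sum_eq_zero fun i _ => hB _ ?_ _
  have h2 := hx (b.coord i)
  convert h2 using 1
  rw [TensorProduct.equivFinsuppOfBasisRight_apply]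
  change _ = TensorProduct.lift _ _
  induction (Coalgebra.comul (R := K) x) with
  | zero => simp
  | tmul y z => simp
  | add y z hy hz => simp only [map_add, hy, hz]

/-- If `f(x₁)x₂ ∈ N` for all functionals `f`, then `Δ(x) ∈ C ⊗ N`. -/
theorem map_comul_eq_zero_of_convLeft {N : Submodule K C} {x : C}
    (hx : ∀ f : Module.Dual K C, convLeft f LinearMap.id x ∈ N) (B : C ⊗[K] C →ₗ[K] V)
    (hB : ∀ n ∈ N, ∀ y, B (y ⊗ₜ[K] n) = 0) : B (Coalgebra.comul x) = 0 := by
  classical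
  let b := Module.Basis.ofVectorSpace K C
  let e := TensorProduct.equivFinsuppOfBasisLeft (N := C) b
  have h : Coalgebra.comul (R := K) x = ∑ i ∈ (e (Coalgebra.comul x)).support,
      b i ⊗ₜ[K] e (Coalgebra.comul x) i := by
    conv_lhs => rw [← e.symm_apply_apply (Coalgebra.comul x)]
    exact TensorProduct.equivFinsuppOfBasisLeft_symm_apply b _
  rw [h, map_sum]
  refine Finset.sum_eq_zero fun i _ => hB _ ?_ _
  have h2 := hx (b.coord i)
  convert h2 using 1
  rw [TensorProduct.equivFinsuppOfBasisLeft_apply]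
  change _ = TensorProduct.lift _ _
  induction (Coalgebra.comul (R := K) x) with
  | zero => simp
  | tmul y z => simp
  | add y z hy hz => simp only [map_add, hy, hz]

theorem conv_eq_zero_of_convRight {A B : Type*} [AddCommGroup A] [Module K A] [AddCommGroup B]
    [Module K B] {N : Submodule K C} {x : C}
    (hx : ∀ f : Module.Dual K C, convRight LinearMap.id f x ∈ N) (μ : A →ₗ[K] B →ₗ[K] V)
    (f : C →ₗ[K] A) (g : C →ₗ[K] B) (hf : ∀ n ∈ N, f n = 0) : conv μ f g x = 0 :=
  map_comul_eq_zero_of_convRight hx (TensorProduct.lift (μ.compl₁₂ f g)) fun n hn y => by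
    simp [hf n hn]

theorem conv_eq_zero_of_convLeft {A B : Type*} [AddCommGroup A] [Module K A] [AddCommGroup B]
    [Module K B] {N : Submodule K C} {x : C}
    (hx : ∀ f : Module.Dual K C, convLeft f LinearMap.id x ∈ N) (μ : A →ₗ[K] B →ₗ[K] V)
    (f : C →ₗ[K] A) (g : C →ₗ[K] B) (hg : ∀ n ∈ N, g n = 0) : conv μ f g x = 0 :=
  map_comul_eq_zero_of_convLeft hx (TensorProduct.lift (μ.compl₁₂ f g)) fun n hn y => by
    simp [hg n hn]

/-- A right coideal on which the counit vanishes is zero. -/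
theorem eq_zero_of_counit_convRight {N : Submodule K C}
    (hN : ∀ x ∈ N, ∀ f : Module.Dual K C, convRight LinearMap.id f x ∈ N)
    (hε : ∀ x ∈ N, Coalgebra.counit (R := K) x = 0) {x : C} (hx : x ∈ N) : x = 0 := by
  refine (Module.forall_dual_apply_eq_zero_iff K x).1 fun f => ?_
  have h := hε _ (hN x hx f)
  rw [apply_convRight_id] at h
  exact (LinearMap.congr_fun (one_mul f) x).symm.trans h

/-- A left coideal on which the counit vanishes is zero. -/
theorem eq_zero_of_counit_convLeft {N : Submodule K C}
    (hN : ∀ x ∈ N, ∀ f : Module.Dual K C, convLeft f LinearMap.id x ∈ N)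
    (hε : ∀ x ∈ N, Coalgebra.counit (R := K) x = 0) {x : C} (hx : x ∈ N) : x = 0 := by
  refine (Module.forall_dual_apply_eq_zero_iff K x).1 fun f => ?_
  have h := hε _ (hN x hx f)
  rw [apply_convLeft_id] at h
  exact (LinearMap.congr_fun (mul_one f) x).symm.trans h

end Coideal

/-! ### The map θ of a left integral -/

namespace DualQuasiHopfAlgebra

open DualQuasiBialgebra

variable {K H : Type*} [Field K] [AddCommGroup H] [Module K H] [Coalgebra K H]
  (Q : DualQuasiHopfAlgebra K H)
  {ι : Type*} [Fintype ι] [DecidableEq ι] {c : ι → ι → H}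

theorem IsLeftIntegral.mul_eq {Q : DualQuasiHopfAlgebra K H} {T : Module.Dual K H}
    (hT : Q.IsLeftIntegral T) (f : Module.Dual K H) : f * T = f Q.one • T := hT f

/-- `u(y) = (T translated by y₁) * p(y₂)`. -/
def uMap (T : Module.Dual K H) : H →ₗ[K] Module.Dual K H :=
  conv (dualMul K H) (Q.hit T) Q.pInvMap

/-- `θ(h) = q(h₂) * u(S(h₁))`. -/
def theta (T : Module.Dual K H) : H →ₗ[K] Module.Dual K H :=
  conv (dualMul K H).flip (Q.uMap T ∘ₗ Q.antipode) Q.qMap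

theorem uMap_entry (hc : IsComatrix K c) (T : Module.Dual K H) (i j : ι) :
    Q.uMap T (c i j) = ∑ k, Q.ract (c i k) T * Q.pInvMap (c k j) := hc.conv_apply _ _ _ i j

theorem theta_entry (hc : IsComatrix K c) (T : Module.Dual K H) (i j : ι) :
    Q.theta T (c i j) = ∑ k, Q.qMap (c k j) * Q.uMap T (Q.antipode (c i k)) :=
  hc.conv_apply _ _ _ i j

section LeftIntegral

variable {T : Module.Dual K H}

/-- The translates of g and T combine into a translate of g * T = g(1)T. -/
theorem sum_ract_mul_uMap (hT : Q.IsLeftIntegral T) (hc : IsComatrix K c) (g : Module.Dual K H)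
    (i j : ι) : ∑ k, Q.ract (c i k) g * Q.uMap T (c k j) = g Q.one • Q.uMap T (c i j) := by
  simp only [Q.uMap_entry hc, Finset.mul_sum, Finset.smul_sum]
  rw [Finset.sum_comm]
  refine Finset.sum_congr rfl fun l _ => ?_
  simp only [← mul_assoc]
  rw [← Finset.sum_mul, ← Q.ract_mul hc, hT.mul_eq, map_smul, smul_mul_assoc]

/-- Moving f past q by `mul_qMap` leaves translates of f in front of u(S(·)); the integral property
evaluates the inner translate at 1, which leaves a value of f. -/
theorem mul_theta_entry (hT : Q.IsLeftIntegral T) (hc : IsComatrix K c) (f : Module.Dual K H)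
    (i j : ι) : f * Q.theta T (c i j) = ∑ k, f (c k j) • Q.theta T (c i k) := by
  have hy := Q.isComatrix_antipode hc
  have h1 : ∀ a b, ∑ k, Q.ract (Q.antipode (c k a)) (Q.ract (c b j) f) *
      Q.uMap T (Q.antipode (c i k)) = f (c b j) • Q.uMap T (Q.antipode (c i a)) := by
    intro a b
    rw [Q.sum_ract_mul_uMap hT hy, Q.ract_apply, Q.one_mul]
  calc f * Q.theta T (c i j)
      = ∑ k, ∑ a, ∑ b, Q.qMap (c a b) * (Q.ract (Q.antipode (c k a)) (Q.ract (c b j) f) *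
          Q.uMap T (Q.antipode (c i k))) := by
        rw [Q.theta_entry hc, Finset.mul_sum]
        refine Finset.sum_congr rfl fun k _ => ?_
        rw [← mul_assoc, Q.mul_qMap hc, Finset.sum_mul]
        simp only [Finset.sum_mul, mul_assoc]
    _ = ∑ a, ∑ b, Q.qMap (c a b) * (f (c b j) • Q.uMap T (Q.antipode (c i a))) := by
        rw [Finset.sum_comm]
        refine Finset.sum_congr rfl fun a _ => ?_
        rw [Finset.sum_comm]
        refine Finset.sum_congr rfl fun b _ => ?_
        rw [← Finset.mul_sum, h1]
    _ = _ := by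
        rw [Finset.sum_comm]
        refine Finset.sum_congr rfl fun b _ => ?_
        rw [Q.theta_entry hc, Finset.smul_sum]
        simp only [mul_smul_comm]

theorem mul_theta (hT : Q.IsLeftIntegral T) (f : Module.Dual K H) (h : H) :
    f * Q.theta T h = Q.theta T (convRight LinearMap.id f h) := by
  refine LinearMap.congr_fun (f := dualMul K H f ∘ₗ Q.theta T)
    (g := Q.theta T ∘ₗ convRight LinearMap.id f) (ext_comatrix fun n c hc i j => ?_) h
  refine (Q.mul_theta_entry hT hc f i j).trans ?_
  rw [LinearMap.comp_apply, convRight_entry hc]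
  simp

/-- The inverse relation `sum_qMap_mul_ract_pInvMap` is inserted in front of u(S(h)). The translate
of p is then absorbed by the integral as its value at 1, which is β. -/
theorem uMap_antipode_entry (hT : Q.IsLeftIntegral T) (hc : IsComatrix K c) (i j : ι) :
    Q.uMap T (Q.antipode (c i j)) = ∑ k, Q.β (c k j) • Q.theta T (c i k) := by
  have hy := Q.isComatrix_antipode hc
  have h1 : ∀ a b, ∑ k, Q.ract (Q.antipode (c k a)) (Q.pInvMap (c b j)) *
      Q.uMap T (Q.antipode (c i k)) = Q.β (c b j) • Q.uMap T (Q.antipode (c i a)) := by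
    intro a b
    rw [Q.sum_ract_mul_uMap hT hy, Q.pInvMap_at_one]
  calc Q.uMap T (Q.antipode (c i j))
      = ∑ k, ∑ a, ∑ b, Q.qMap (c a b) * (Q.ract (Q.antipode (c k a)) (Q.pInvMap (c b j)) *
          Q.uMap T (Q.antipode (c i k))) := by
        have h2 : ∀ k, ∑ a, ∑ b, Q.qMap (c a b) *
            (Q.ract (Q.antipode (c k a)) (Q.pInvMap (c b j)) * Q.uMap T (Q.antipode (c i k))) =
            (if k = j then 1 else 0) * Q.uMap T (Q.antipode (c i k)) := by
          intro k
          rw [← Q.sum_qMap_mul_ract_pInvMap hc k j]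
          simp only [Finset.sum_mul, mul_assoc]
        simp [h2]
    _ = ∑ a, ∑ b, Q.qMap (c a b) * (Q.β (c b j) • Q.uMap T (Q.antipode (c i a))) := by
        rw [Finset.sum_comm]
        refine Finset.sum_congr rfl fun a _ => ?_
        rw [Finset.sum_comm]
        refine Finset.sum_congr rfl fun b _ => ?_
        rw [← Finset.mul_sum, h1]
    _ = _ := by
        rw [Finset.sum_comm]
        refine Finset.sum_congr rfl fun b _ => ?_
        rw [Q.theta_entry hc, Finset.smul_sum]
        simp only [mul_smul_comm]

theorem uMap_antipode (hT : Q.IsLeftIntegral T) (h : H) :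
    Q.uMap T (Q.antipode h) = Q.theta T (convRight LinearMap.id Q.β h) := by
  refine LinearMap.congr_fun (f := Q.uMap T ∘ₗ Q.antipode)
    (g := Q.theta T ∘ₗ convRight LinearMap.id Q.β) (ext_comatrix fun n c hc i j => ?_) h
  refine (Q.uMap_antipode_entry hT hc i j).trans ?_
  rw [LinearMap.comp_apply, convRight_entry hc]
  simp

/-- Recovers T from u, for an arbitrary functional T: `mul_qMap` pulls T out to the left, and the
remaining q and p cancel. -/
theorem sum_qMap_mul_ract_uMap (hc : IsComatrix K c) (i j : ι) :
    ∑ k, ∑ l, Q.qMap (c k l) * Q.ract (Q.antipode (c i k)) (Q.uMap T (c l j)) =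
      if i = j then T else 0 := by
  have hy := Q.isComatrix_antipode hc
  have h1 : ∀ k l, Q.ract (Q.antipode (c i k)) (Q.uMap T (c l j)) =
      ∑ m, ∑ r, Q.ract (Q.antipode (c r k)) (Q.ract (c l m) T) *
        Q.ract (Q.antipode (c i r)) (Q.pInvMap (c m j)) := by
    intro k l
    rw [Q.uMap_entry hc, map_sum]
    exact Finset.sum_congr rfl fun m _ => Q.ract_mul hy _ _ k i
  have h2 : ∀ m r, ∑ k, ∑ l, Q.qMap (c k l) *
      (Q.ract (Q.antipode (c r k)) (Q.ract (c l m) T) *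
        Q.ract (Q.antipode (c i r)) (Q.pInvMap (c m j))) =
      T * (Q.qMap (c r m) * Q.ract (Q.antipode (c i r)) (Q.pInvMap (c m j))) := by
    intro m r
    rw [← mul_assoc, Q.mul_qMap hc]
    simp only [Finset.sum_mul, mul_assoc]
  calc _ = ∑ k, ∑ m, ∑ l, ∑ r, Q.qMap (c k l) *
      (Q.ract (Q.antipode (c r k)) (Q.ract (c l m) T) *
        Q.ract (Q.antipode (c i r)) (Q.pInvMap (c m j))) := by
        refine Finset.sum_congr rfl fun k _ => ?_
        rw [Finset.sum_comm]
        simp only [h1, Finset.mul_sum]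
    _ = ∑ m, ∑ r, ∑ k, ∑ l, Q.qMap (c k l) *
      (Q.ract (Q.antipode (c r k)) (Q.ract (c l m) T) *
        Q.ract (Q.antipode (c i r)) (Q.pInvMap (c m j))) := by
        rw [Finset.sum_comm]
        refine Finset.sum_congr rfl fun m _ => ?_
        exact (Finset.sum_congr rfl fun k _ => Finset.sum_comm).trans Finset.sum_comm
    _ = T * ∑ r, ∑ m, Q.qMap (c r m) * Q.ract (Q.antipode (c i r)) (Q.pInvMap (c m j)) := by
        simp only [h2, Finset.mul_sum]
        exact Finset.sum_comm
    _ = _ := by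
        rw [Q.sum_qMap_mul_ract_pInvMap hc]
        simp

/-- The kernel is a right coideal by `mul_theta`, and u ∘ S vanishes on it by `uMap_antipode`. Since
εT is a convolution of u ∘ S with another map, ε vanishes on the kernel as well. -/
theorem theta_injective (hT : Q.IsLeftIntegral T) (hT0 : T ≠ 0) :
    Function.Injective (Q.theta T) := by
  let A := Module.Dual K H
  let E : H →ₗ[K] A →ₗ[K] A := conv (LinearMap.llcomp K A A A ∘ₗ dualMul K H)
    (Q.qMap ∘ₗ Q.antipode) (Q.ract ∘ₗ Q.antipode ∘ₗ Q.antipode)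
  -- This is `sum_qMap_mul_ract_uMap` at y = S(h): the antipode reverses the order, so u receives
  -- S(h₁) and `E` collects the factors in h₂ and h₃.
  have hE : conv LinearMap.applyₗ (Q.uMap T ∘ₗ Q.antipode) E =
      (Coalgebra.counit (R := K) (A := H)).smulRight T := by
    refine ext_comatrix fun n c hc i j => ?_
    have h := Q.sum_qMap_mul_ract_uMap (T := T) (Q.isComatrix_antipode hc) j i
    rw [hc.conv_apply, LinearMap.smulRight_apply, hc.counit_eq]
    simp only [E, hc.conv_apply]
    rw [Finset.sum_comm] at h
    simp only [map_sum]
    refine Eq.trans ?_ (h.trans ?_)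
    · rfl
    · simp [eq_comm]
  have hN : ∀ x ∈ LinearMap.ker (Q.theta T), ∀ f : Module.Dual K H,
      convRight LinearMap.id f x ∈ LinearMap.ker (Q.theta T) := fun x hx f => by
    rw [LinearMap.mem_ker, ← Q.mul_theta hT, LinearMap.mem_ker.1 hx, mul_zero]
  refine LinearMap.ker_eq_bot.1 ((Submodule.eq_bot_iff _).2 fun x hx => ?_)
  refine eq_zero_of_counit_convRight hN (fun y hy => ?_) hx
  have h := conv_eq_zero_of_convRight (hN y hy) LinearMap.applyₗ (Q.uMap T ∘ₗ Q.antipode) E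
    fun n hn => (Q.uMap_antipode hT n).trans (hN n hn _)
  rw [hE] at h
  exact (smul_eq_zero.1 h).resolve_right hT0

end LeftIntegral

end DualQuasiHopfAlgebra

end DualQuasi

namespace DualQuasi

attribute [local instance] dualRing dualIsScalarTower dualSMulCommClass

theorem inv_mul_eq_of_pentagon' {M : Type*} [Monoid M] {a b c d e a' d' e' : M}
    (h : a * b = c * (d * e)) (ha : a' * a = 1) (hd : d * d' = 1) (he : e * e' = 1) :
    a' * c = b * (e' * d') := by
  calc a' * c = a' * c * (d * (e * e') * d') := by rw [he, mul_one, hd, mul_one]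
    _ = a' * (c * (d * e)) * (e' * d') := by simp only [mul_assoc]
    _ = (a' * a) * b * (e' * d') := by rw [← h]; simp only [mul_assoc]
    _ = b * (e' * d') := by rw [ha, one_mul]

/-! ### The second inverse relation between l and m -/

namespace DualQuasiHopfAlgebra

open DualQuasiBialgebra

variable {K H : Type*} [Field K] [AddCommGroup H] [Module K H] [Coalgebra K H]
  (Q : DualQuasiHopfAlgebra K H)
  {ι κ : Type*} [Fintype ι] [DecidableEq ι] [Fintype κ] [DecidableEq κ]
  {c : ι → ι → H} {d : κ → κ → H}

theorem lMap_at_one (h : H) : Q.lMap h Q.one = Q.α h := by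
  refine LinearMap.congr_fun (f := LinearMap.applyₗ Q.one ∘ₗ Q.lMap)
    (ext_comatrix fun n c hc i j => ?_) h
  rw [LinearMap.comp_apply, LinearMap.applyₗ_apply_apply, lMap_entry Q hc]
  simp [Q.reassocInv_one_right, (Q.isComatrix_antipode hc).counit_eq, hc.counit_eq]

theorem sum_lact_mul_reassoc (hc : IsComatrix K c) (hd : IsComatrix K d) (f : Module.Dual K H)
    (i j : ι × κ) :
    ∑ k : ι × κ, Q.lact (d i.2 k.2) (Q.lact (c i.1 k.1) f) *
        lastVar Q.reassoc (c k.1 j.1 ⊗ₜ[K] d k.2 j.2) =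
      ∑ k : ι × κ, lastVar Q.reassoc (c i.1 k.1 ⊗ₜ[K] d i.2 k.2) *
        Q.lact (Q.mul (c k.1 j.1 ⊗ₜ[K] d k.2 j.2)) f := by
  have h := congrArg (fun F => lastVar F (c i.1 j.1 ⊗ₜ[K] d i.2 j.2))
    (Q.comp_mul_reassoc f)
  simp only [lastVar_mul (hc.tmul hd) _ _ i j] at h
  exact h

/-- `m(y) * f = (f translated by y₁ and S(y₃)) * m(y₂)`. -/
theorem mMap_mul (hc : IsComatrix K c) (f : Module.Dual K H) (i j : ι) :
    Q.mMap (c i j) * f =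
      ∑ k, ∑ l, Q.lact (Q.antipode (c l j)) (Q.lact (c i k) f) * Q.mMap (c k l) := by
  have h := Q.sum_lact_mul_reassoc hc (Q.isComatrix_antipode hc) f
  have h' : ∑ p : ι × ι, Q.β (c p.1 p.2) • _ = ∑ p : ι × ι, Q.β (c p.1 p.2) • _ :=
    Finset.sum_congr rfl fun p _ => congrArg (Q.β (c p.1 p.2) • ·) (h (i, j) p)
  rw [mul_col (fun p : ι × ι => Q.β (c p.1 p.2))
      (fun i k => lastVar Q.reassoc (c i.1 k.1 ⊗ₜ[K] Q.antipode (c k.2 i.2)))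
      (fun k p => Q.lact (Q.mul (c k.1 p.1 ⊗ₜ[K] Q.antipode (c p.2 k.2))) f),
    mul_col (fun p : ι × ι => Q.β (c p.1 p.2))
      (fun i k => Q.lact (Q.antipode (c k.2 i.2)) (Q.lact (c i.1 k.1) f))
      (fun k p => lastVar Q.reassoc (c k.1 p.1 ⊗ₜ[K] Q.antipode (c p.2 k.2)))] at h'
  simp only [Fintype.sum_prod_type] at h'
  have hf := fun a b => Q.sum_beta_map hc (Q.lact.flip f) a b
  simp only [LinearMap.flip_apply, Q.lact_one] at hf
  simp only [hf, ← Q.mMap_entry' hc] at h'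
  rw [h', Q.mMap_entry' hc]
  simp only [Finset.sum_mul, smul_mul_assoc, mul_smul_comm]

theorem lastVar_reassocInv_one_right (x : H) :
    lastVar Q.reassocInv (x ⊗ₜ[K] Q.one) = Coalgebra.counit (R := K) x • 1 :=
  LinearMap.ext fun y => Q.reassocInv_one_mid x y

/-- `(l(y₁) translated by S(y₃)) * m(y₂) = ε(y) ε`. -/
theorem sum_lact_lMap_mul_mMap (hc : IsComatrix K c) (i n : ι) :
    ∑ k, ∑ l, Q.lact (Q.antipode (c l n)) (Q.lMap (c i k)) * Q.mMap (c k l) =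
      if i = n then 1 else 0 := by
  -- Pentagon with free last variable and S(y), y, S(y) in the first three; hg collapses under α and
  -- gf under β, leaving the axiom for φ⁻¹.
  have hI := inv_mul_eq_of_pentagon' Q.pentagon_pull (pull_inv_mul _ Q.mulThird)
    (pull_mul_inv _ Q.mulSecond) (pull_mul_inv _ (dropLast K H))
  have hz := (Q.isComatrix_antipode hc).tmul (hc.tmul (Q.isComatrix_antipode hc))
  have h := fun p q : ι × ι × ι =>
    congrArg (fun F => lastVar₄ F
      (Q.antipode (c q.1 p.1) ⊗ₜ[K] (c p.2.1 q.2.1 ⊗ₜ[K] Q.antipode (c q.2.2 p.2.2)))) hI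
  simp only [lastVar₄_mul hz, lastVar₄_mulThird, lastVar₄_mulFirst, lastVar₄_mulSecond,
    lastVar₄_dropFirst, lastVar₄_dropLast] at h
  have key := row_mul_col_eq_of_fixed
    (v := fun p => if p.2.2 = n then Q.α (c p.1 p.2.1) else 0)
    (w := fun p => if p.1 = i then Q.β (c p.2.1 p.2.2) else 0) _ _ h ?_ ?_
  · have hl : ∀ a b d, ∑ k, ∑ l, Q.α (c k l) • Q.lact (Q.antipode (c d n))
        (lastVar Q.reassocInv (Q.antipode (c a k) ⊗ₜ[K] c l b)) =
          Q.lact (Q.antipode (c d n)) (Q.lMap (c a b)) :=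
      fun a b d => by rw [Q.lMap_entry' hc]; simp only [map_sum, map_smul]
    have hm : ∀ a b d, ∑ k, ∑ l, Q.β (c k l) • (if i = d then (1 : K) else 0) •
        lastVar Q.reassoc (c a k ⊗ₜ[K] Q.antipode (c l b)) =
          if i = d then Q.mMap (c a b) else 0 :=
      fun a b d => by rw [Q.mMap_entry' hc]; split_ifs <;> simp
    have hr : ∑ m, ∑ l, Q.β (c m l) • ∑ j, ∑ k, Q.α (c j k) • Q.reassocInv
        (Q.antipode (c i j) ⊗ₜ[K] (c k m ⊗ₜ[K] Q.antipode (c l n))) • (1 : Module.Dual K H) =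
          if i = n then 1 else 0 := by
      have := congrArg (· • (1 : Module.Dual K H)) (Q.sum_reassocInv_antipode hc i n)
      simpa only [Finset.sum_smul, mul_smul, Finset.mul_sum, Finset.smul_sum, ite_smul, one_smul,
        zero_smul] using this
    simp only [sum_ite_fst, sum_ite_last, Q.counit_antipode_apply, hc.counit_eq] at key
    simp only [hl, hm, hr, mul_ite, mul_zero] at key
    rw [← key]
    simp [Fintype.sum_prod_type]
  · intro r
    simp only [sum_ite_last]
    have := (Q.sum_alpha_map hc (lastVar Q.reassoc ∘ₗ (TensorProduct.mk K H H).flip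
      (Q.antipode (c r.2.2 n))) r.1 r.2.1)
    simp only [LinearMap.comp_apply, TensorProduct.mk_apply, LinearMap.flip_apply,
      lastVar_reassoc_one_left, Q.counit_antipode_apply, hc.counit_eq] at this
    rw [this]
    by_cases h : r.2.2 = n <;> simp [h]
  · intro r
    simp only [sum_ite_fst]
    have := (Q.sum_beta_map hc (lastVar Q.reassocInv ∘ₗ
      TensorProduct.mk K H H (Q.antipode (c i r.1))) r.2.1 r.2.2)
    simp only [LinearMap.comp_apply, TensorProduct.mk_apply, lastVar_reassocInv_one_right,
      Q.counit_antipode_apply, hc.counit_eq] at this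
    rw [this]
    by_cases h : r.1 = i <;> simp [h, eq_comm (a := i)]

/-! ### Right integrals -/

/-- Right integrals: `W * f = f(1) W` for all `f`. -/
def IsRightIntegral (W : Module.Dual K H) : Prop :=
  ∀ f : Module.Dual K H, W * f = f Q.one • W

/-- `u'(y) = l(y₁) * (W translated by y₂)`. -/
def rightUMap (W : Module.Dual K H) : H →ₗ[K] Module.Dual K H :=
  conv (dualMul K H) Q.lMap (Q.lact.flip W)

/-- `θ'(h) = u'(S(h₂)) * m(h₁)`. -/
def rightTheta (W : Module.Dual K H) : H →ₗ[K] Module.Dual K H :=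
  conv (dualMul K H).flip Q.mMap (Q.rightUMap W ∘ₗ Q.antipode)

theorem rightUMap_entry (hc : IsComatrix K c) (W : Module.Dual K H) (i j : ι) :
    Q.rightUMap W (c i j) = ∑ k, Q.lMap (c i k) * Q.lact (c k j) W := hc.conv_apply _ _ _ i j

theorem rightTheta_entry (hc : IsComatrix K c) (W : Module.Dual K H) (i j : ι) :
    Q.rightTheta W (c i j) = ∑ k, Q.rightUMap W (Q.antipode (c k j)) * Q.mMap (c i k) :=
  hc.conv_apply _ _ _ i j

variable {W : Module.Dual K H}

theorem sum_rightUMap_mul_lact (hW : Q.IsRightIntegral W) (hc : IsComatrix K c)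
    (g : Module.Dual K H) (i j : ι) :
    ∑ k, Q.rightUMap W (c i k) * Q.lact (c k j) g = g Q.one • Q.rightUMap W (c i j) := by
  simp only [Q.rightUMap_entry hc, Finset.sum_mul, Finset.smul_sum]
  rw [Finset.sum_comm]
  refine Finset.sum_congr rfl fun l _ => ?_
  simp only [mul_assoc]
  rw [← Finset.mul_sum, ← Q.lact_mul hc, hW, map_smul, mul_smul_comm]

theorem rightTheta_entry_mul (hW : Q.IsRightIntegral W) (hc : IsComatrix K c)
    (f : Module.Dual K H) (i j : ι) :
    Q.rightTheta W (c i j) * f = ∑ k, f (c i k) • Q.rightTheta W (c k j) := by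
  have hy := Q.isComatrix_antipode hc
  have h1 : ∀ a b, ∑ k, Q.rightUMap W (Q.antipode (c k j)) *
      Q.lact (Q.antipode (c b k)) (Q.lact (c i a) f) =
        f (c i a) • Q.rightUMap W (Q.antipode (c b j)) := by
    intro a b
    rw [Q.sum_rightUMap_mul_lact hW hy, Q.lact_apply, Q.mul_one]
  calc Q.rightTheta W (c i j) * f
      = ∑ k, ∑ a, ∑ b, Q.rightUMap W (Q.antipode (c k j)) *
          Q.lact (Q.antipode (c b k)) (Q.lact (c i a) f) * Q.mMap (c a b) := by
        rw [Q.rightTheta_entry hc, Finset.sum_mul]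
        refine Finset.sum_congr rfl fun k _ => ?_
        rw [mul_assoc, Q.mMap_mul hc, Finset.mul_sum]
        simp only [Finset.mul_sum, mul_assoc]
    _ = ∑ a, ∑ b, (f (c i a) • Q.rightUMap W (Q.antipode (c b j))) * Q.mMap (c a b) := by
        rw [Finset.sum_comm]
        refine Finset.sum_congr rfl fun a _ => ?_
        rw [Finset.sum_comm]
        refine Finset.sum_congr rfl fun b _ => ?_
        rw [← Finset.sum_mul, h1]
    _ = _ := by
        refine Finset.sum_congr rfl fun a _ => ?_
        rw [Q.rightTheta_entry hc, Finset.smul_sum]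
        simp only [smul_mul_assoc]

theorem rightTheta_mul (hW : Q.IsRightIntegral W) (f : Module.Dual K H) (h : H) :
    Q.rightTheta W h * f = Q.rightTheta W (convLeft f LinearMap.id h) := by
  refine LinearMap.congr_fun (f := (dualMul K H).flip f ∘ₗ Q.rightTheta W)
    (g := Q.rightTheta W ∘ₗ convLeft f LinearMap.id) (ext_comatrix fun n c hc i j => ?_) h
  refine (Q.rightTheta_entry_mul hW hc f i j).trans ?_
  rw [LinearMap.comp_apply, convLeft_entry hc]
  simp

theorem rightUMap_antipode_entry (hW : Q.IsRightIntegral W) (hc : IsComatrix K c) (i j : ι) :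
    Q.rightUMap W (Q.antipode (c i j)) = ∑ k, Q.α (c i k) • Q.rightTheta W (c k j) := by
  have hy := Q.isComatrix_antipode hc
  have h1 : ∀ a b, ∑ k, Q.rightUMap W (Q.antipode (c k j)) *
      Q.lact (Q.antipode (c b k)) (Q.lMap (c i a)) =
        Q.α (c i a) • Q.rightUMap W (Q.antipode (c b j)) := by
    intro a b
    rw [Q.sum_rightUMap_mul_lact hW hy, Q.lMap_at_one]
  calc Q.rightUMap W (Q.antipode (c i j))
      = ∑ k, ∑ a, ∑ b, Q.rightUMap W (Q.antipode (c k j)) *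
          Q.lact (Q.antipode (c b k)) (Q.lMap (c i a)) * Q.mMap (c a b) := by
        have h2 : ∀ k, ∑ a, ∑ b, Q.rightUMap W (Q.antipode (c k j)) *
            Q.lact (Q.antipode (c b k)) (Q.lMap (c i a)) * Q.mMap (c a b) =
            Q.rightUMap W (Q.antipode (c k j)) * (if i = k then 1 else 0) := by
          intro k
          rw [← Q.sum_lact_lMap_mul_mMap hc i k]
          simp only [Finset.mul_sum, mul_assoc]
        simp [h2]
    _ = ∑ a, ∑ b, (Q.α (c i a) • Q.rightUMap W (Q.antipode (c b j))) * Q.mMap (c a b) := by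
        rw [Finset.sum_comm]
        refine Finset.sum_congr rfl fun a _ => ?_
        rw [Finset.sum_comm]
        refine Finset.sum_congr rfl fun b _ => ?_
        rw [← Finset.sum_mul, h1]
    _ = _ := by
        refine Finset.sum_congr rfl fun a _ => ?_
        rw [Q.rightTheta_entry hc, Finset.smul_sum]
        simp only [smul_mul_assoc]

/-- Together with injectivity of `rightTheta`, this gives α(h₁)h₂ = 0 whenever S(h) = 0. -/
theorem rightUMap_antipode (hW : Q.IsRightIntegral W) (h : H) :
    Q.rightUMap W (Q.antipode h) = Q.rightTheta W (convLeft Q.α LinearMap.id h) := by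
  refine LinearMap.congr_fun (f := Q.rightUMap W ∘ₗ Q.antipode)
    (g := Q.rightTheta W ∘ₗ convLeft Q.α LinearMap.id) (ext_comatrix fun n c hc i j => ?_) h
  refine (Q.rightUMap_antipode_entry hW hc i j).trans ?_
  rw [LinearMap.comp_apply, convLeft_entry hc]
  simp

variable (W) in
theorem sum_lact_rightUMap_mul_mMap (hc : IsComatrix K c) (i j : ι) :
    ∑ k, ∑ l, Q.lact (Q.antipode (c l j)) (Q.rightUMap W (c i k)) * Q.mMap (c k l) =
      if i = j then W else 0 := by
  have hy := Q.isComatrix_antipode hc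
  have h1 : ∀ k l, Q.lact (Q.antipode (c l j)) (Q.rightUMap W (c i k)) =
      ∑ m, ∑ r, Q.lact (Q.antipode (c r j)) (Q.lMap (c i m)) *
        Q.lact (Q.antipode (c l r)) (Q.lact (c m k) W) := by
    intro k l
    rw [Q.rightUMap_entry hc, map_sum]
    exact Finset.sum_congr rfl fun m _ => Q.lact_mul hy _ _ j l
  have h2 : ∀ m r, ∑ k, ∑ l, Q.lact (Q.antipode (c r j)) (Q.lMap (c i m)) *
        Q.lact (Q.antipode (c l r)) (Q.lact (c m k) W) * Q.mMap (c k l) =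
      Q.lact (Q.antipode (c r j)) (Q.lMap (c i m)) * Q.mMap (c m r) * W := by
    intro m r
    rw [mul_assoc, Q.mMap_mul hc]
    simp only [Finset.mul_sum, mul_assoc]
  calc _ = ∑ k, ∑ m, ∑ l, ∑ r, Q.lact (Q.antipode (c r j)) (Q.lMap (c i m)) *
        Q.lact (Q.antipode (c l r)) (Q.lact (c m k) W) * Q.mMap (c k l) := by
        refine Finset.sum_congr rfl fun k _ => ?_
        rw [Finset.sum_comm]
        simp only [h1, Finset.sum_mul]
    _ = ∑ m, ∑ r, ∑ k, ∑ l, Q.lact (Q.antipode (c r j)) (Q.lMap (c i m)) *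
        Q.lact (Q.antipode (c l r)) (Q.lact (c m k) W) * Q.mMap (c k l) := by
        rw [Finset.sum_comm]
        refine Finset.sum_congr rfl fun m _ => ?_
        exact (Finset.sum_congr rfl fun k _ => Finset.sum_comm).trans Finset.sum_comm
    _ = (∑ m, ∑ r, Q.lact (Q.antipode (c r j)) (Q.lMap (c i m)) * Q.mMap (c m r)) * W := by
        simp only [h2, Finset.sum_mul]
    _ = _ := by
        rw [Q.sum_lact_lMap_mul_mMap hc]
        simp

/-- Mirror image of `theta_injective`: the kernel is a left coideal killed by u' ∘ S, from which W
is recovered. -/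
theorem rightTheta_injective (hW : Q.IsRightIntegral W) (hW0 : W ≠ 0) :
    Function.Injective (Q.rightTheta W) := by
  let A := Module.Dual K H
  let E : H →ₗ[K] A →ₗ[K] A := conv (LinearMap.llcomp K A A A ∘ₗ (dualMul K H).flip).flip
    (Q.lact ∘ₗ Q.antipode ∘ₗ Q.antipode) (Q.mMap ∘ₗ Q.antipode)
  have hE : conv LinearMap.id E (Q.rightUMap W ∘ₗ Q.antipode) =
      (Coalgebra.counit (R := K) (A := H)).smulRight W := by
    refine ext_comatrix fun n c hc i j => ?_
    have h := Q.sum_lact_rightUMap_mul_mMap W (Q.isComatrix_antipode hc) j i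
    rw [hc.conv_apply, LinearMap.smulRight_apply, hc.counit_eq]
    simp only [E, hc.conv_apply]
    simp only [LinearMap.id_apply, LinearMap.sum_apply]
    refine Eq.trans ?_ (h.trans ?_)
    · rfl
    · simp [eq_comm]
  have hN : ∀ x ∈ LinearMap.ker (Q.rightTheta W), ∀ f : Module.Dual K H,
      convLeft f LinearMap.id x ∈ LinearMap.ker (Q.rightTheta W) := fun x hx f => by
    rw [LinearMap.mem_ker, ← Q.rightTheta_mul hW, LinearMap.mem_ker.1 hx, zero_mul]
  refine LinearMap.ker_eq_bot.1 ((Submodule.eq_bot_iff _).2 fun x hx => ?_)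
  refine eq_zero_of_counit_convLeft hN (fun y hy => ?_) hx
  have h := conv_eq_zero_of_convLeft (hN y hy) LinearMap.id E (Q.rightUMap W ∘ₗ Q.antipode)
    fun n hn => (Q.rightUMap_antipode hW n).trans (hN n hn _)
  rw [hE] at h
  exact (smul_eq_zero.1 h).resolve_right hW0

/-! ### Injectivity of the antipode -/

theorem map_antipode_comul_eq_zero {x : H} (hx : Q.antipode x = 0) :
    TensorProduct.map Q.antipode Q.antipode (Coalgebra.comul (R := K) x) = 0 := by
  have h := LinearMap.congr_fun Q.comul_antipode x
  simp only [LinearMap.comp_apply, LinearEquiv.coe_coe] at h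
  rw [hx, map_zero, TensorProduct.map_comm] at h
  exact (LinearEquiv.map_eq_zero_iff _).1 h.symm

/-- The kernel of the antipode is a coideal. -/
theorem conv_eq_zero_of_antipode {A B V : Type*} [AddCommGroup A] [Module K A] [AddCommGroup B]
    [Module K B] [AddCommGroup V] [Module K V] (μ : A →ₗ[K] B →ₗ[K] V) {f : H →ₗ[K] A}
    {g : H →ₗ[K] B} (hf : ∀ x, Q.antipode x = 0 → f x = 0) (hg : ∀ x, Q.antipode x = 0 → g x = 0)
    {x : H} (hx : Q.antipode x = 0) : conv μ f g x = 0 := by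
  -- The map `R` below satisfies S R S = S, so a map killing ker S equals its composite with R S.
  -- The convolution at x then factors through (S ⊗ S)Δ(x) = 0.
  obtain ⟨r, hr⟩ := LinearMap.exists_rightInverse_of_surjective Q.antipode.rangeRestrict
    (LinearMap.range_rangeRestrict _)
  obtain ⟨R, hR⟩ := LinearMap.exists_extend r
  have hS : ∀ y, Q.antipode (R (Q.antipode y)) = Q.antipode y := fun y => by
    have h1 := LinearMap.congr_fun hR (Q.antipode.rangeRestrict y)
    have h2 := congrArg Subtype.val (LinearMap.congr_fun hr (Q.antipode.rangeRestrict y))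
    exact (congrArg Q.antipode h1).trans h2
  have hk : ∀ y, Q.antipode (y - R (Q.antipode y)) = 0 := fun y => by rw [map_sub, hS, sub_self]
  have hf' : ∀ y, f (R (Q.antipode y)) = f y := fun y =>
    (sub_eq_zero.1 ((map_sub f _ _).symm.trans (hf _ (hk y)))).symm
  have hg' : ∀ y, g (R (Q.antipode y)) = g y := fun y =>
    (sub_eq_zero.1 ((map_sub g _ _).symm.trans (hg _ (hk y)))).symm
  have h := congrArg (TensorProduct.lift (μ.compl₁₂ (f ∘ₗ R) (g ∘ₗ R)))
    (Q.map_antipode_comul_eq_zero hx)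
  rw [map_zero] at h
  rw [← h, conv, LinearMap.comp_apply]
  induction (Coalgebra.comul (R := K) x) with
  | zero => simp
  | tmul y z => simp [hf', hg']
  | add y z hy hz => simp only [map_add, hy, hz]

/-- The antipode is injective in the presence of nonzero left and right integrals. -/
theorem antipode_injective {T W : Module.Dual K H} (hT : Q.IsLeftIntegral T) (hT0 : T ≠ 0)
    (hW : Q.IsRightIntegral W) (hW0 : W ≠ 0) : Function.Injective Q.antipode := by
  refine (injective_iff_map_eq_zero Q.antipode).2 fun x hx => Q.theta_injective hT hT0 ?_
  rw [map_zero]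
  -- θ is a convolution of u ∘ S and q, and ker S is a coideal. As u ∘ S kills ker S, it remains to
  -- see that q does, and for this that α(y₁)y₂ = 0.
  have hα : ∀ y, Q.antipode y = 0 → convLeft Q.α LinearMap.id y = 0 := fun y hy =>
    Q.rightTheta_injective hW hW0 (by rw [← Q.rightUMap_antipode hW, hy, map_zero, map_zero])
  have hq : ∀ y, Q.antipode y = 0 → Q.qMap y = 0 := fun y hy => by
    refine Eq.trans ?_ (Q.conv_eq_zero_of_antipode (TensorProduct.curry Q.sigma)
      (f := Q.antipode) (fun _ h => h) hα hy)
    rw [qMap, conv, LinearMap.comp_apply, LinearMap.comp_apply, LinearMap.comp_apply]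
    induction (Coalgebra.comul (R := K) y) with
    | zero => simp
    | tmul y z => simp
    | add y z hy hz => simp only [map_add, hy, hz]
  exact Q.conv_eq_zero_of_antipode _ (f := Q.uMap T ∘ₗ Q.antipode)
    (fun y hy => by rw [LinearMap.comp_apply, hy, map_zero]) hq hx

end DualQuasiHopfAlgebra

end DualQuasi

namespace DualQuasi

attribute [local instance] dualRing dualIsScalarTower dualSMulCommClass

/-! ### Functionals generating finite dimensional left ideals -/

section LeftRational

variable {K C V : Type*} [Field K] [AddCommGroup C] [Module K C] [Coalgebra K C]
  [AddCommGroup V] [Module K V]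

/-- A linear map on a coalgebra takes values in a submodule if it does so on the entries of all
comatrices. -/
theorem mem_of_comatrix {P : Submodule K V} {F : C →ₗ[K] V}
    (h : ∀ (n : ℕ) (c : Fin n → Fin n → C), IsComatrix K c → ∀ i j, F (c i j) ∈ P) (x : C) :
    F x ∈ P := by
  have h1 : P.mkQ ∘ₗ F = 0 := ext_comatrix fun n c hc i j =>
    (Submodule.Quotient.mk_eq_zero P).2 (h n c hc i j)
  exact (Submodule.Quotient.mk_eq_zero P).1 (LinearMap.congr_fun h1 x)

variable (K C) in
/-- The left rational part of `C*`: the functionals generating a finite dimensional left ideal. -/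
def leftRat : Submodule K (Module.Dual K C) where
  carrier := {f | ∃ V : Submodule K (Module.Dual K C), FiniteDimensional K V ∧
    ∀ k : Module.Dual K C, k * f ∈ V}
  zero_mem' := ⟨⊥, inferInstance, fun k => by rw [mul_zero]; exact zero_mem _⟩
  add_mem' := by
    rintro f g ⟨V, hV, hf⟩ ⟨W, hW, hg⟩
    exact ⟨V ⊔ W, inferInstance, fun k => by
      rw [mul_add]; exact Submodule.add_mem_sup (hf k) (hg k)⟩
  smul_mem' := by
    rintro r f ⟨V, hV, hf⟩
    exact ⟨V, hV, fun k => by rw [mul_smul_comm]; exact V.smul_mem r (hf k)⟩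

theorem mul_mem_leftRat {f : Module.Dual K C} (hf : f ∈ leftRat K C) (k : Module.Dual K C) :
    k * f ∈ leftRat K C := by
  obtain ⟨V, hV, hf⟩ := hf
  exact ⟨V, hV, fun l => by rw [← mul_assoc]; exact hf _⟩

theorem leftRat_mul_mem {f : Module.Dual K C} (hf : f ∈ leftRat K C) (k : Module.Dual K C) :
    f * k ∈ leftRat K C := by
  obtain ⟨V, hV, hf⟩ := hf
  exact ⟨V.map ((dualMul K C).flip k), inferInstance, fun l => by
    rw [← mul_assoc]; exact Submodule.mem_map_of_mem (hf l)⟩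

end LeftRational

namespace DualQuasiHopfAlgebra

open DualQuasiBialgebra

variable {K H : Type*} [Field K] [AddCommGroup H] [Module K H] [Coalgebra K H]
  (Q : DualQuasiHopfAlgebra K H)
  {ι : Type*} [Fintype ι] [DecidableEq ι] {c : ι → ι → H}

/-- By `mul_lMap`, left multiples of u' built from f are again values of u', built from elements of
the left ideal H* * f. So finite dimensionality is inherited. -/
theorem mul_rightUMap_entry (hc : IsComatrix K c) (k f : Module.Dual K H) (i j : ι) :
    k * Q.rightUMap f (c i j) =
      ∑ a, Q.rightUMap (Q.lact (Q.antipode (c i a)) k * f) (c a j) := by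
  simp only [Q.rightUMap_entry hc, Finset.mul_sum, Q.lact_mul hc]
  simp only [← mul_assoc, Q.mul_lMap hc, Finset.sum_mul]
  rw [Finset.sum_comm]
  refine Finset.sum_congr rfl fun a _ => ?_
  rw [Finset.sum_comm]

/-- Since l and m cancel, a translate of f is a sum of values of u' built from the left multiples
m(·) * f. This transfers rationality to translates. -/
theorem sum_rightUMap_mMap_mul (hc : IsComatrix K c) (f : Module.Dual K H) (i j : ι) :
    ∑ k, Q.rightUMap (Q.mMap (c i k) * f) (c k j) = Q.lact (c i j) f := by
  calc ∑ k, Q.rightUMap (Q.mMap (c i k) * f) (c k j)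
      = ∑ k, ∑ a, ∑ b, Q.lMap (c k a) * Q.lact (c a b) (Q.mMap (c i k)) * Q.lact (c b j) f := by
        simp only [Q.rightUMap_entry hc, Q.lact_mul hc, Finset.mul_sum, mul_assoc]
    _ = ∑ b, (∑ k, ∑ a, Q.lMap (c k a) * Q.lact (c a b) (Q.mMap (c i k))) * Q.lact (c b j) f := by
        simp only [Finset.sum_mul]
        exact (Finset.sum_congr rfl fun k _ => Finset.sum_comm).trans Finset.sum_comm
    _ = _ := by
        simp only [Q.sum_lMap_mul_lact_mMap hc, ite_mul, _root_.one_mul, zero_mul]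
        simp

theorem rightUMap_mem_leftRat {f : Module.Dual K H} (hf : f ∈ leftRat K H) (h : H) :
    Q.rightUMap f h ∈ leftRat K H := by
  refine mem_of_comatrix (fun n c hc i j => ?_) h
  obtain ⟨V, hV, hf⟩ := hf
  -- `F a` is the map g ↦ `rightUMap g (c a j)`.
  let F : Fin n → Module.Dual K H →ₗ[K] Module.Dual K H := fun a =>
    ∑ k, dualMul K H (Q.lMap (c a k)) ∘ₗ Q.lact (c k j)
  refine ⟨⨆ a, V.map (F a), inferInstance, fun k => ?_⟩
  rw [Q.mul_rightUMap_entry hc]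
  refine Submodule.sum_mem _ fun a _ => Submodule.mem_iSup_of_mem a ?_
  refine ⟨Q.lact (Q.antipode (c i a)) k * f, hf _, ?_⟩
  rw [Q.rightUMap_entry hc, LinearMap.sum_apply]
  rfl

theorem lact_mem_leftRat {f : Module.Dual K H} (hf : f ∈ leftRat K H) (h : H) :
    Q.lact h f ∈ leftRat K H := by
  refine mem_of_comatrix (F := Q.lact.flip f) (fun n c hc i j => ?_) h
  rw [LinearMap.flip_apply, ← Q.sum_rightUMap_mMap_mul hc]
  exact Submodule.sum_mem _ fun k _ => Q.rightUMap_mem_leftRat (mul_mem_leftRat hf _) _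

theorem IsLeftIntegral.mem_leftRat {Q : DualQuasiHopfAlgebra K H} {T : Module.Dual K H}
    (hT : Q.IsLeftIntegral T) : T ∈ leftRat K H :=
  ⟨K ∙ T, inferInstance, fun k => by
    rw [hT.mul_eq]; exact Submodule.smul_mem _ _ (Submodule.mem_span_singleton_self T)⟩

/-- The first axiom relating φ to the antipode, regrouped as m(h₁)(α(h₂)h₃) = ε(h): ε vanishes on a
left coideal where α(h₁)h₂ does. -/
theorem conv_mMap_alpha :
    conv (LinearMap.id : Module.Dual K H →ₗ[K] Module.Dual K H) Q.mMap
      (convLeft Q.α LinearMap.id) = Coalgebra.counit := by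
  refine ext_comatrix fun n c hc i j => ?_
  rw [hc.conv_apply, hc.counit_eq, ← Q.sum_reassoc_antipode hc]
  simp only [LinearMap.id_apply, convLeft_entry hc, Q.mMap_entry hc, TensorProduct.tmul_sum,
    TensorProduct.tmul_smul, map_sum, map_smul, smul_eq_mul, Finset.mul_sum]
  rw [Finset.sum_comm]
  exact Finset.sum_congr rfl fun _ _ => Finset.sum_comm

/-- The left rational part separates points if there is a nonzero left integral. -/
theorem eq_zero_of_leftRat {T : Module.Dual K H} (hT : Q.IsLeftIntegral T) (hT0 : T ≠ 0) {x : H}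
    (hx : ∀ f ∈ leftRat K H, f x = 0) : x = 0 := by
  let N : Submodule K H := (leftRat K H).dualCoannihilator
  have memN : ∀ y, y ∈ N ↔ ∀ f ∈ leftRat K H, f y = 0 := fun y =>
    Submodule.mem_dualCoannihilator y
  have hL : ∀ y ∈ N, ∀ f : Module.Dual K H, convLeft f LinearMap.id y ∈ N := fun y hy f =>
    (memN _).2 fun g hg => by
      rw [apply_convLeft_id]; exact (memN _).1 hy _ (mul_mem_leftRat hg f)
  have hR : ∀ y ∈ N, ∀ f : Module.Dual K H, convRight LinearMap.id f y ∈ N := fun y hy f =>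
    (memN _).2 fun g hg => by
      rw [apply_convRight_id]; exact (memN _).1 hy _ (leftRat_mul_mem hg f)
  obtain ⟨t, ht⟩ : ∃ t, T t ≠ 0 := by
    by_contra! h
    exact hT0 (LinearMap.ext h)
  -- α(y)T(t) = T(t(S(y₁)α(y₂)y₃)) evaluates iterated left translates of T at y₃. These are left
  -- rational, and the last factor of Δ(y) may be taken in `N`.
  have hα : ∀ y ∈ N, Q.α y = 0 := fun y hy => by
    have h1 := congrArg (Q.lact t T) (LinearMap.congr_fun Q.antipode_left y)
    have h2 := map_comul_eq_zero_of_convLeft (hL y hy) (Q.lact t T ∘ₗ TensorProduct.lift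
      ((TensorProduct.curry Q.mul.toLinearMap).compl₁₂ (convRight Q.antipode Q.α) LinearMap.id))
      fun n hn z => (memN n).1 hn (Q.lact (convRight Q.antipode Q.α z) (Q.lact t T))
        (Q.lact_mem_leftRat (Q.lact_mem_leftRat hT.mem_leftRat t) _)
    rw [LinearMap.smulRight_apply, map_smul, Q.lact_apply t Q.one, Q.mul_one] at h1
    exact (mul_eq_zero.1 (h1.symm.trans h2)).resolve_right ht
  have hαN : ∀ y ∈ N, convLeft Q.α LinearMap.id y = 0 := fun y hy =>
    (Module.forall_dual_apply_eq_zero_iff K _).1 fun f => by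
      rw [apply_convLeft_id, ← apply_convRight_id]
      exact hα _ (hR y hy f)
  refine eq_zero_of_counit_convLeft hL (fun y hy => ?_) ((memN x).2 hx)
  rw [← Q.conv_mMap_alpha]
  exact conv_eq_zero_of_convLeft (hL y hy) _ _ _ hαN

end DualQuasiHopfAlgebra

end DualQuasi

namespace DualQuasi

attribute [local instance] dualRing dualIsScalarTower dualSMulCommClass

theorem sum_comm₄ {M ι : Type*} [AddCommMonoid M] [Fintype ι] (F : ι → ι → ι → ι → M) :
    ∑ k, ∑ l, ∑ r, ∑ m, F k l r m = ∑ m, ∑ r, ∑ k, ∑ l, F k l r m :=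
  calc _ = ∑ k, ∑ m, ∑ r, ∑ l, F k l r m := Finset.sum_congr rfl fun _ _ =>
        (Finset.sum_congr rfl fun _ _ => Finset.sum_comm).trans (Finset.sum_comm.trans
          (Finset.sum_congr rfl fun _ _ => Finset.sum_comm))
    _ = _ := Finset.sum_comm.trans (Finset.sum_congr rfl fun _ _ => Finset.sum_comm)

/-! ### Families on which the dual algebra acts through a comatrix -/

section LeftRational

variable {K C : Type*} [Field K] [AddCommGroup C] [Module K C] [Coalgebra K C]

/-- A finite dimensional space of functionals has a basis with a dual family of points. -/
theorem exists_dual_points {X : Type*} [AddCommGroup X] [Module K X]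
    (V : Submodule K (Module.Dual K X)) [FiniteDimensional K V]
    {n : ℕ} (b : Module.Basis (Fin n) K V) :
    ∃ x : Fin n → X, ∀ (i : Fin n) (v : V), (v : Module.Dual K X) (x i) = b.coord i v := by
  let B : V →ₗ[K] X →ₗ[K] K := V.subtype
  have h : Function.Surjective B.flip :=
    (LinearMap.flip_surjective_iff₁ (K := K) (V₁ := V) (V₂ := X) (B := B)).2 V.injective_subtype
  choose x hx using fun i => h (b.coord i)
  exact ⟨x, fun i v => LinearMap.congr_fun (hx i) v⟩

/-- A left rational functional lies in the span of a finite family on which `C*` acts through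
a comatrix. -/
theorem exists_family_of_mem_leftRat {f : Module.Dual K C} (hf : f ∈ leftRat K C) :
    ∃ (n : ℕ) (c : Fin n → Fin n → C) (b : Fin n → Module.Dual K C), IsComatrix K c ∧
      (∀ (k : Module.Dual K C) j, k * b j = ∑ i, k (c i j) • b i) ∧
      f ∈ Submodule.span K (Set.range b) := by
  let V : Submodule K (Module.Dual K C) := LinearMap.range ((dualMul K C).flip f)
  have hV : ∀ (k v : Module.Dual K C), v ∈ V → k * v ∈ V := by
    rintro k _ ⟨l, rfl⟩
    exact ⟨k * l, mul_assoc k l f⟩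
  have : FiniteDimensional K V := by
    obtain ⟨W, hW, hf⟩ := hf
    exact Submodule.finiteDimensional_of_le (S₂ := W) (by rintro _ ⟨l, rfl⟩; exact hf l)
  let b := Module.finBasis K V
  obtain ⟨x, hx⟩ := exists_dual_points V b
  -- The coefficient of bᵢ in k * bⱼ is (k * bⱼ)(xᵢ), that is, k applied to the element obtained by
  -- evaluating bⱼ on the second factor of Δ(xᵢ).
  let c : Fin _ → Fin _ → C := fun i j => convRight LinearMap.id (b j : Module.Dual K C) (x i)
  have hc : ∀ (k : Module.Dual K C) i j,
      k (c i j) = b.coord i ⟨k * (b j : Module.Dual K C), hV k _ (b j).2⟩ :=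
    fun k i j => (apply_convRight_id _ _ _).trans (hx i ⟨_, hV k _ (b j).2⟩)
  have hact : ∀ (k : Module.Dual K C) j,
      k * (b j : Module.Dual K C) = ∑ i, k (c i j) • (b i : Module.Dual K C) := fun k j => by
    have h := congrArg Subtype.val (b.sum_repr ⟨k * (b j : Module.Dual K C), hV k _ (b j).2⟩)
    refine h.symm.trans ?_
    simp only [Submodule.coe_sum, Submodule.coe_smul]
    exact Finset.sum_congr rfl fun i _ => congrArg (· • (b i : Module.Dual K C)) (hc k i j).symm
  have hpt : ∀ i j, (b j : Module.Dual K C) (x i) = if i = j then 1 else 0 := fun i j => by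
    rw [hx]
    simp [Finsupp.single_apply, eq_comm]
  have hk : ∀ (k : Module.Dual K C) i j, (k * (b j : Module.Dual K C)) (x i) = k (c i j) :=
    fun k i j => (apply_convRight_id _ _ _).symm
  refine ⟨_, c, fun j => b j, IsComatrix.of_dual (fun k l i j => ?_) (fun i j => ?_), hact, ?_⟩
  · let Φ : Module.Dual K C →ₗ[K] K := LinearMap.applyₗ (x i) ∘ₗ dualMul K C k
    calc (k * l) (c i j) = Φ (l * (b j : Module.Dual K C)) := by
          rw [← hk, mul_assoc]; rfl
      _ = ∑ m, l (c m j) • Φ (b m : Module.Dual K C) := by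
          rw [hact l j, map_sum]
          exact Finset.sum_congr rfl fun m _ => map_smul Φ _ _
      _ = _ := Finset.sum_congr rfl fun m _ =>
          (congrArg (l (c m j) • ·) (hk k i m)).trans (mul_comm _ _)
  · refine (hk 1 i j).symm.trans ?_
    rw [one_mul, hpt]
  · have h1 : f ∈ V := ⟨1, one_mul f⟩
    have h := congrArg Subtype.val (b.sum_repr ⟨f, h1⟩)
    rw [← show _ = f from h]
    simp only [Submodule.coe_sum, Submodule.coe_smul]
    exact Submodule.sum_mem _ fun i _ => Submodule.smul_mem _ _ (Submodule.subset_span ⟨i, rfl⟩)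

end LeftRational

/-! ### Left rational functionals are spanned by the values of θ -/

namespace DualQuasiHopfAlgebra

open DualQuasiBialgebra

variable {K H : Type*} [Field K] [AddCommGroup H] [Module K H] [Coalgebra K H]
  (Q : DualQuasiHopfAlgebra K H)
  {ι : Type*} [Fintype ι] [DecidableEq ι] {c : ι → ι → H}

/-- `f ◁ y = q(y₂) * (f translated by S(y₁))`. -/
def antipodeAct (f : Module.Dual K H) : H →ₗ[K] Module.Dual K H :=
  conv (dualMul K H).flip (Q.ract.flip f ∘ₗ Q.antipode) Q.qMap

theorem antipodeAct_entry (hc : IsComatrix K c) (f : Module.Dual K H) (i j : ι) :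
    Q.antipodeAct f (c i j) = ∑ k, Q.qMap (c k j) * Q.ract (Q.antipode (c i k)) f :=
  hc.conv_apply _ _ _ i j

theorem mul_antipodeAct_entry (hc : IsComatrix K c) (g f : Module.Dual K H) (i j : ι) :
    g * Q.antipodeAct f (c i j) = ∑ k, Q.antipodeAct (Q.ract (c k j) g * f) (c i k) := by
  have hy := Q.isComatrix_antipode hc
  simp only [Q.antipodeAct_entry hc, Q.ract_mul hy, Finset.mul_sum, ← mul_assoc,
    Q.mul_qMap hc, Finset.sum_mul]
  rw [Finset.sum_comm]
  conv_lhs => enter [2, a]; rw [Finset.sum_comm]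
  rw [Finset.sum_comm]

theorem antipodeAct_sum_smul {κ : Type*} [Fintype κ] (r : κ → K) (b : κ → Module.Dual K H)
    (y : H) : Q.antipodeAct (∑ m, r m • b m) y = ∑ m, r m • Q.antipodeAct (b m) y := by
  have h : ∀ f : Module.Dual K H, Q.antipodeAct f y = (conv (LinearMap.llcomp K _ _ _ ∘ₗ
      dualMul K H).flip (Q.ract ∘ₗ Q.antipode) Q.qMap y) f := fun f => by
    rw [antipodeAct, conv, conv, LinearMap.comp_apply, LinearMap.comp_apply]
    induction (Coalgebra.comul (R := K) y) with
    | zero => simp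
    | tmul y z => rfl
    | add y z hy hz => simp only [map_add, hy, hz, LinearMap.add_apply]
  simp only [h, map_sum, map_smul]

/-- The left integral attached to the `j`-th member of a family `b` with comatrix `c`. -/
def integralOf (c : ι → ι → H) (b : ι → Module.Dual K H) (j : ι) : Module.Dual K H :=
  ∑ k, ∑ l, Q.β (c k l) • Q.antipodeAct (b k) (Q.antipode (c l j))

variable {b : ι → Module.Dual K H}

/-- Moving g inside the action makes a translate of g multiply bₖ, which yields the scalars g(cₘₖ
S(cₗᵣ)). The weights β contract them to g(1). -/
theorem isLeftIntegral_integralOf (hc : IsComatrix K c)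
    (hb : ∀ (k : Module.Dual K H) j, k * b j = ∑ i, k (c i j) • b i) (j : ι) :
    Q.IsLeftIntegral (Q.integralOf c b j) := fun g => by
  have hy := Q.isComatrix_antipode hc
  calc g * Q.integralOf c b j
      = ∑ k, ∑ l, Q.β (c k l) • ∑ r, ∑ m, g (Q.mul (c m k ⊗ₜ[K] Q.antipode (c l r))) •
          Q.antipodeAct (b m) (Q.antipode (c r j)) := by
        simp only [integralOf, Finset.mul_sum, mul_smul_comm]
        refine Finset.sum_congr rfl fun k _ => Finset.sum_congr rfl fun l _ => congrArg _ ?_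
        refine (Q.mul_antipodeAct_entry hy g (b k) j l).trans ?_
        refine Finset.sum_congr rfl fun r _ => ?_
        rw [hb, Q.antipodeAct_sum_smul]
        rfl
    _ = ∑ m, ∑ r, (∑ k, ∑ l, Q.β (c k l) • g (Q.mul (c m k ⊗ₜ[K] Q.antipode (c l r)))) •
          Q.antipodeAct (b m) (Q.antipode (c r j)) := by
        simp only [Finset.smul_sum, Finset.sum_smul, smul_assoc]
        exact sum_comm₄ _
    _ = g Q.one • Q.integralOf c b j := by
        simp only [Q.sum_beta_map hc, integralOf, Finset.smul_sum]
        refine Finset.sum_congr rfl fun k _ => Finset.sum_congr rfl fun l _ => ?_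
        rw [smul_eq_mul, mul_comm, mul_smul]

/-- u undoes the action ◁: `pInvMap_mul` moves f out to the right, and the translate of q then
cancels p. -/
theorem sum_uMap_antipodeAct (hc : IsComatrix K c) (f : Module.Dual K H) (k r : ι) :
    ∑ i, Q.uMap (Q.antipodeAct f (c i r)) (c k i) = if k = r then f else 0 := by
  have h1 : ∀ t s, ∑ i, ∑ m, Q.ract (c k t) (Q.qMap (c s r)) *
      (Q.ract (c t m) (Q.ract (Q.antipode (c i s)) f) * Q.pInvMap (c m i)) =
      Q.ract (c k t) (Q.qMap (c s r)) * Q.pInvMap (c t s) * f := fun t s => by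
    rw [mul_assoc, Q.pInvMap_mul hc, Finset.sum_comm]
    simp only [Finset.mul_sum]
  calc ∑ i, Q.uMap (Q.antipodeAct f (c i r)) (c k i)
      = ∑ i, ∑ m, ∑ s, ∑ t, Q.ract (c k t) (Q.qMap (c s r)) *
      (Q.ract (c t m) (Q.ract (Q.antipode (c i s)) f) * Q.pInvMap (c m i)) := by
        simp only [Q.uMap_entry hc, Q.antipodeAct_entry hc, map_sum, Q.ract_mul hc,
          Finset.sum_mul, mul_assoc]
    _ = (∑ t, ∑ s, Q.ract (c k t) (Q.qMap (c s r)) * Q.pInvMap (c t s)) * f := by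
        rw [sum_comm₄]
        simp only [h1, Finset.sum_mul]
    _ = _ := by
        rw [Q.sum_ract_qMap_mul_pInvMap hc]
        simp

theorem sum_uMap_integralOf (hc : IsComatrix K c) (k : ι) :
    ∑ i, Q.uMap (Q.integralOf c b i) (Q.antipode (c i k)) = ∑ l, Q.β (c l k) • b l := by
  have hy := Q.isComatrix_antipode hc
  have h1 : ∀ i, Q.uMap (Q.integralOf c b i) (Q.antipode (c i k)) =
      ∑ l, ∑ r, Q.β (c l r) •
        Q.uMap (Q.antipodeAct (b l) (Q.antipode (c r i))) (Q.antipode (c i k)) := fun i => by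
    refine (Q.uMap_entry hy _ k i).trans ?_
    have h2 : ∀ f : Module.Dual K H, Q.uMap f (Q.antipode (c i k)) = _ :=
      fun f => Q.uMap_entry hy f k i
    simp only [h2, integralOf, map_sum, map_smul, Finset.sum_mul, smul_mul_assoc, Finset.smul_sum]
    rw [Finset.sum_comm]
    exact Finset.sum_congr rfl fun _ _ => Finset.sum_comm
  have h3 : ∀ l r, ∑ i, Q.uMap (Q.antipodeAct (b l) (Q.antipode (c r i))) (Q.antipode (c i k)) =
      if k = r then b l else 0 := fun l r => Q.sum_uMap_antipodeAct hy (b l) k r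
  simp only [h1]
  rw [Finset.sum_comm]
  refine Finset.sum_congr rfl fun l _ => ?_
  rw [Finset.sum_comm]
  simp only [← Finset.smul_sum, h3]
  simp

/-- What remains after `sum_uMap_integralOf` is q times a β-weighted sum of the family. The comatrix
rule evaluates q at entries of c, and the coefficients become the axiom φ(h₁β(h₂), S(h₃), α(h₄)h₅) =
ε(h). -/
theorem sum_theta_integralOf (hc : IsComatrix K c)
    (hb : ∀ (k : Module.Dual K H) j, k * b j = ∑ i, k (c i j) • b i) (j : ι) :
    ∑ i, Q.theta (Q.integralOf c b i) (c i j) = b j := by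
  calc ∑ i, Q.theta (Q.integralOf c b i) (c i j)
      = ∑ k, Q.qMap (c k j) * ∑ l, Q.β (c l k) • b l := by
        simp only [Q.theta_entry hc]
        rw [Finset.sum_comm]
        exact Finset.sum_congr rfl fun k _ => by rw [← Finset.mul_sum, Q.sum_uMap_integralOf hc]
    _ = ∑ m, (∑ l, ∑ k, Q.β (c l k) * ∑ a, ∑ d, Q.α (c a d) *
          Q.reassoc (c m l ⊗ₜ[K] (Q.antipode (c k a) ⊗ₜ[K] c d j))) • b m := by
        obtain ⟨X, hX⟩ : ∃ X : ι → ι → ι → K, ∀ m l k, X m l k = ∑ a, ∑ d, Q.α (c a d) *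
          Q.reassoc (c m l ⊗ₜ[K] (Q.antipode (c k a) ⊗ₜ[K] c d j)) := ⟨_, fun _ _ _ => rfl⟩
        have h : ∀ k l, Q.qMap (c k j) * b l = ∑ m, (∑ a, ∑ d, Q.α (c a d) *
          Q.reassoc (c m l ⊗ₜ[K] (Q.antipode (c k a) ⊗ₜ[K] c d j))) • b m := fun k l => by
          rw [hb]
          refine Finset.sum_congr rfl fun m _ => congrArg (· • b m) ?_
          rw [Q.qMap_entry hc]
          simp only [LinearMap.sum_apply]
          rfl
        simp only [← hX] at h ⊢
        simp only [Finset.mul_sum, mul_smul_comm, h, Finset.sum_smul, Finset.smul_sum, mul_smul]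
        rw [Finset.sum_comm]
        conv_rhs => rw [Finset.sum_comm]
        exact Finset.sum_congr rfl fun l _ =>
          (Finset.sum_congr rfl fun k _ => rfl).trans Finset.sum_comm
    _ = b j := by
        simp only [Q.sum_reassoc_antipode hc]
        simp

theorem mem_span_theta {f : Module.Dual K H} (hf : f ∈ leftRat K H) :
    f ∈ Submodule.span K {g | ∃ P h, Q.IsLeftIntegral P ∧ Q.theta P h = g} := by
  obtain ⟨n, c, b, hc, hb, hf⟩ := exists_family_of_mem_leftRat hf
  refine Submodule.span_le.2 ?_ hf
  rintro _ ⟨j, rfl⟩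
  rw [← Q.sum_theta_integralOf hc hb j]
  exact Submodule.sum_mem _ fun i _ => Submodule.subset_span
    ⟨_, _, Q.isLeftIntegral_integralOf hc hb i, rfl⟩

end DualQuasiHopfAlgebra

end DualQuasi

namespace DualQuasi

attribute [local instance] dualRing dualIsScalarTower dualSMulCommClass

/-- A subspace of functionals that separates points realizes every functional on a finite
set of points. -/
theorem exists_mem_forall_eq {K X : Type*} [Field K] [AddCommGroup X] [Module K X]
    {R : Submodule K (Module.Dual K X)} (hR : ∀ x, (∀ f ∈ R, f x = 0) → x = 0)
    (s : Finset X) (e : Module.Dual K X) : ∃ g ∈ R, ∀ x ∈ s, g x = e x := by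
  let V : Submodule K X := Submodule.span K s
  let B : V →ₗ[K] R →ₗ[K] K :=
    LinearMap.flip (((LinearMap.llcomp K V X K).flip V.subtype) ∘ₗ R.subtype)
  have hB : Function.Injective B := (injective_iff_map_eq_zero B).2 fun v hv =>
    Subtype.ext (hR v fun f hf => LinearMap.congr_fun hv ⟨f, hf⟩)
  obtain ⟨g, hg⟩ := (LinearMap.flip_surjective_iff₁ (K := K) (V₁ := V) (V₂ := R) (B := B)).2 hB
    (e ∘ₗ V.subtype)
  exact ⟨g, g.2, fun x hx => LinearMap.congr_fun hg ⟨x, Submodule.subset_span hx⟩⟩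

namespace DualQuasiHopfAlgebra

open DualQuasiBialgebra

variable {K H : Type*} [Field K] [AddCommGroup H] [Module K H] [Coalgebra K H]
  (Q : DualQuasiHopfAlgebra K H)
  {ι : Type*} [Fintype ι] [DecidableEq ι] {c : ι → ι → H}

/-! ### Uniqueness of integrals and the distinguished grouplike -/

/-- `h ↦ θ(h)(1)`. -/
def thetaAtOne (T : Module.Dual K H) : Module.Dual K H := LinearMap.applyₗ Q.one ∘ₗ Q.theta T

theorem uMap_sub_smul (T U : Module.Dual K H) (r : K) :
    Q.uMap (T - r • U) = Q.uMap T - r • Q.uMap U := by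
  refine ext_comatrix fun n c hc i j => ?_
  simp only [LinearMap.sub_apply, LinearMap.smul_apply, Q.uMap_entry hc, map_sub, map_smul,
    sub_mul, smul_mul_assoc, Finset.sum_sub_distrib, Finset.smul_sum]

theorem theta_sub_smul (T U : Module.Dual K H) (r : K) :
    Q.theta (T - r • U) = Q.theta T - r • Q.theta U := by
  refine ext_comatrix fun n c hc i j => ?_
  simp only [LinearMap.sub_apply, LinearMap.smul_apply, Q.theta_entry hc, Q.uMap_sub_smul, mul_sub,
    mul_smul_comm, Finset.sum_sub_distrib, Finset.smul_sum]

section Uniqueness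

variable {Q} {T U V : Module.Dual K H}

theorem IsLeftIntegral.sub_smul (hT : Q.IsLeftIntegral T) (hU : Q.IsLeftIntegral U) (r : K) :
    Q.IsLeftIntegral (T - r • U) := fun f => by
  change f * (T - r • U) = _
  rw [mul_sub, mul_smul_comm, hT.mul_eq, hU.mul_eq, smul_sub, smul_comm]

theorem IsLeftIntegral.mul_right (hT : Q.IsLeftIntegral T) (f : Module.Dual K H) :
    Q.IsLeftIntegral (T * f) := fun g => by
  change g * (T * f) = _
  rw [← mul_assoc, hT.mul_eq, smul_mul_assoc]

/-- The identity f * θ(h) = θ(f(h₂)h₁), evaluated at the grouplike 1. -/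
theorem isRightIntegral_thetaAtOne (hU : Q.IsLeftIntegral U) :
    Q.IsRightIntegral (Q.thetaAtOne U) := fun f => LinearMap.ext fun h => by
  have h1 := LinearMap.congr_fun (Q.mul_theta hU f h) Q.one
  rw [← apply_convRight_id]
  refine h1.symm.trans ?_
  rw [dual_mul_apply, Q.isGroupLikeElem_one.comul_eq_tmul_self]
  rfl

/-- Otherwise all values of θ, hence all left rational functionals, vanish at 1. As these separate
points, 1 = 0, against ε(1) = 1. -/
theorem exists_thetaAtOne_ne_zero (hT : Q.IsLeftIntegral T) (hT0 : T ≠ 0) :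
    ∃ U, Q.IsLeftIntegral U ∧ Q.thetaAtOne U ≠ 0 := by
  by_contra! hU
  have h1 : ∀ f ∈ leftRat K H, f Q.one = 0 := fun f hf => by
    have h := Q.mem_span_theta hf
    clear hf
    induction h using Submodule.span_induction with
    | mem g hg => obtain ⟨P, h, hP, rfl⟩ := hg; exact LinearMap.congr_fun (hU P hP) h
    | zero => rfl
    | add f g _ _ h₁ h₂ => rw [LinearMap.add_apply, h₁, h₂, add_zero]
    | smul r f _ h₁ => rw [LinearMap.smul_apply, h₁, smul_zero]
  have h2 := Q.counit_one
  rw [Q.eq_zero_of_leftRat hT hT0 h1, map_zero] at h2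
  exact zero_ne_one h2

/-- W * θ_V(h) computed in two ways: by the right integral W, and by `mul_theta`. -/
theorem thetaAtOne_smul (hV : Q.IsLeftIntegral V) {W : Module.Dual K H}
    (hW : Q.IsRightIntegral W) (h : H) :
    Q.thetaAtOne V h • W = Q.theta V (convRight LinearMap.id W h) :=
  (hW (Q.theta V h)).symm.trans (Q.mul_theta hV W h)

/-- If V ≠ 0, injectivity of θ_V forces W(h₂)h₁ = 0 for all h, and applying ε gives W = 0. -/
theorem eq_zero_of_thetaAtOne (hV : Q.IsLeftIntegral V) {W : Module.Dual K H}
    (hW : Q.IsRightIntegral W) (hW0 : W ≠ 0) (h0 : Q.thetaAtOne V = 0) : V = 0 := by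
  by_contra hV0
  refine hW0 (LinearMap.ext fun h => ?_)
  have h1 := thetaAtOne_smul hV hW h
  rw [h0, LinearMap.zero_apply, zero_smul] at h1
  have h2 := Q.theta_injective hV hV0 (h1.symm.trans (map_zero _).symm)
  have h3 : (1 * W) h = 0 := by rw [← apply_convRight_id, h2, map_zero]
  rwa [_root_.one_mul] at h3

/-- Left integrals are unique up to a scalar. -/
theorem IsLeftIntegral.exists_eq_smul (hT : Q.IsLeftIntegral T) (hT0 : T ≠ 0)
    (hV : Q.IsLeftIntegral V) : ∃ r : K, V = r • T := by
  obtain ⟨U, hU, hW0⟩ := exists_thetaAtOne_ne_zero hT hT0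
  have hW := isRightIntegral_thetaAtOne hU
  -- All integrals are compared with `U`, for which W = θ_U(·)(1) is nonzero, rather than with `T`
  -- directly.
  have key : ∀ {X : Module.Dual K H}, Q.IsLeftIntegral X → ∃ r : K, X = r • U := fun {X} hX => by
    have hU0 : U ≠ 0 := by
      rintro rfl
      refine hW0 (LinearMap.ext fun h => ?_)
      have h1 := Q.theta_sub_smul 0 0 (1 : K)
      rw [one_smul, sub_self, one_smul, sub_self] at h1
      rw [thetaAtOne, h1]
      rfl
    -- Inclusion of kernels makes θ_X(·)(1) a multiple of θ_U(·)(1); `eq_zero_of_thetaAtOne` then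
    -- transfers the proportionality to X and U.
    have hker : ∀ h, Q.thetaAtOne U h = 0 → Q.thetaAtOne X h = 0 := fun h hh => by
      have h1 := thetaAtOne_smul hU hW h
      rw [hh, zero_smul] at h1
      have h2 := Q.theta_injective hU hU0 (h1.symm.trans (map_zero _).symm)
      have h3 := thetaAtOne_smul hX hW h
      rw [h2, map_zero] at h3
      exact (smul_eq_zero.1 h3).resolve_right hW0
    obtain ⟨h₀, hh₀⟩ : ∃ h, Q.thetaAtOne U h ≠ 0 := by
      by_contra! h
      exact hW0 (LinearMap.ext h)
    refine ⟨Q.thetaAtOne X h₀ / Q.thetaAtOne U h₀, sub_eq_zero.1 ?_⟩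
    refine eq_zero_of_thetaAtOne (hX.sub_smul hU _) hW hW0 (LinearMap.ext fun h => ?_)
    have h1 := hker (h - (Q.thetaAtOne U h / Q.thetaAtOne U h₀) • h₀) (by
      rw [map_sub, map_smul, smul_eq_mul, div_mul_cancel₀ _ hh₀, sub_self])
    rw [map_sub, map_smul, smul_eq_mul] at h1
    rw [thetaAtOne, Q.theta_sub_smul]
    refine Eq.trans ?_ h1
    change Q.thetaAtOne X h - _ * Q.thetaAtOne U h = _
    ring
  obtain ⟨r, hr⟩ := key hT
  obtain ⟨s, hs⟩ := key hV
  have hr0 : r ≠ 0 := fun h => hT0 (by rw [hr, h, zero_smul])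
  exact ⟨s / r, by rw [hs, hr, smul_smul, div_mul_cancel₀ _ hr0]⟩

/-- T * f is again a left integral, hence a multiple of T by uniqueness. Normalizing T(t) = 1
identifies the multiplier as f(a) with a = T(t₁)t₂, and its multiplicativity in f says that a is
grouplike. -/
theorem existsUnique_distinguishedGrouplike (hT : Q.IsLeftIntegral T) (hT0 : T ≠ 0) :
    ∃! a : H, IsDistinguishedGrouplike T a := by
  obtain ⟨t, ht⟩ : ∃ t, T t = 1 := by
    obtain ⟨t, ht⟩ : ∃ t, T t ≠ 0 := by
      by_contra! h
      exact hT0 (LinearMap.ext h)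
    exact ⟨(T t)⁻¹ • t, by rw [map_smul, smul_eq_mul, inv_mul_cancel₀ ht]⟩
  let a := convLeft T LinearMap.id t
  have ha : ∀ f : Module.Dual K H, T * f = f a • T := fun f => by
    obtain ⟨r, hr⟩ := hT.exists_eq_smul hT0 (hT.mul_right f)
    rw [apply_convLeft_id, hr, LinearMap.smul_apply, ht, smul_eq_mul, _root_.mul_one]
  have hinj : ∀ {r s : K}, r • T = s • T → r = s := fun h => smul_left_injective K hT0 h
  -- A grouplike element is a comatrix of size one.
  have hc : IsComatrix K (fun _ _ : Unit => a) := .of_dual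
    (fun f g _ _ => by
      have h : (f * g) a • T = (f a * g a) • T := by
        rw [← ha, ← mul_assoc, ha f, smul_mul_assoc, ha g, smul_smul]
      simpa using hinj h)
    (fun _ _ => by
      have h : (1 : Module.Dual K H) a • T = (1 : K) • T := by
        rw [← ha, _root_.mul_one, one_smul]
      exact (hinj h).trans (if_pos rfl).symm)
  refine ⟨a, ⟨⟨by simpa using hc.counit_eq () (), by simpa using hc.comul_eq () ()⟩, ha⟩,
    fun b hb => ?_⟩
  refine sub_eq_zero.1 ((Module.forall_dual_apply_eq_zero_iff K _).1 fun f => ?_)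
  rw [map_sub, sub_eq_zero]
  exact hinj ((hb.mul_eq f).symm.trans (ha f))

theorem antipode_injective_of_isLeftIntegral (hT : Q.IsLeftIntegral T) (hT0 : T ≠ 0) :
    Function.Injective Q.antipode := by
  obtain ⟨U, hU, hW0⟩ := exists_thetaAtOne_ne_zero hT hT0
  exact Q.antipode_injective hT hT0 (isRightIntegral_thetaAtOne hU) hW0

end Uniqueness

/-! ### The map `p` -/

variable {T : Module.Dual K H} {a : H} {Sl : H →ₗ[K] H}

/-- Moving f to the left of p translates it by an entry of c and by S of another. The former joins
the translation of T, and T * f = f(a)T turns the latter into f(aS(·)). -/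
theorem uMap_entry_mul (ha : IsDistinguishedGrouplike T a) (hc : IsComatrix K c)
    (f : Module.Dual K H) (i j : ι) :
    Q.uMap T (c i j) * f = ∑ k, f (Q.mulAntipode a (c k j)) • Q.uMap T (c i k) := by
  have h1 : ∀ l k, ∑ m, Q.ract (c i m) T * (Q.ract (c m l) (Q.ract (Q.antipode (c k j)) f) *
      Q.pInvMap (c l k)) =
        f (Q.mulAntipode a (c k j)) • (Q.ract (c i l) T * Q.pInvMap (c l k)) := fun l k => by
    simp only [← mul_assoc]
    rw [← Finset.sum_mul, ← Q.ract_mul hc, show T * _ = _ from ha.mul_eq _, map_smul,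
      smul_mul_assoc]
    rfl
  calc Q.uMap T (c i j) * f
      = ∑ m, ∑ l, ∑ k, Q.ract (c i m) T *
        (Q.ract (c m l) (Q.ract (Q.antipode (c k j)) f) * Q.pInvMap (c l k)) := by
        simp only [Q.uMap_entry hc, Finset.sum_mul, mul_assoc, Q.pInvMap_mul hc, Finset.mul_sum]
    _ = ∑ l, ∑ k, f (Q.mulAntipode a (c k j)) • (Q.ract (c i l) T * Q.pInvMap (c l k)) := by
        rw [Finset.sum_comm]
        refine Finset.sum_congr rfl fun l _ => ?_
        rw [Finset.sum_comm]
        simp only [h1]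
    _ = _ := by
        rw [Finset.sum_comm]
        simp only [Q.uMap_entry hc, Finset.smul_sum]

/-- The first factor of the map `p`. -/
def pFirst (Sl : H →ₗ[K] H) : H →ₗ[K] Module.Dual K H :=
  Q.sigma ∘ₗ TensorProduct.map (Q.antipode ∘ₗ Sl) (convRight Sl (Q.α ∘ₗ Sl)) ∘ₗ
    (TensorProduct.comm K H H).toLinearMap ∘ₗ Coalgebra.comul

theorem pMap_entry (hc : IsComatrix K c) (i j : ι) :
    Q.pMap T Sl (c i j) = ∑ k, Q.pFirst Sl (c i k) * Q.uMap T (c k j) :=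
  hc.conv_apply _ _ _ i j

theorem pFirst_antipode (hSl : Sl ∘ₗ Q.antipode = LinearMap.id) (h : H) :
    Q.pFirst Sl (Q.antipode h) = Q.qMap h := by
  refine LinearMap.congr_fun (f := Q.pFirst Sl ∘ₗ Q.antipode) (ext_comatrix fun n c hc i j => ?_) h
  have hs : ∀ x, Sl (Q.antipode x) = x := LinearMap.congr_fun hSl
  have hy := Q.isComatrix_antipode hc
  have h1 := hy.comul_eq j i
  have h2 : ∀ k, convRight Sl (Q.α ∘ₗ Sl) (Q.antipode (c k j)) = ∑ m, Q.α (c k m) • c m j :=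
    fun k => by
      refine (convRight_entry hy (Q.α ∘ₗ Sl) Sl j k).trans ?_
      simp only [LinearMap.comp_apply, hs]
  rw [Q.qMap_entry hc, LinearMap.comp_apply, pFirst]
  simp only [LinearMap.comp_apply, h1, map_sum, LinearEquiv.coe_coe, TensorProduct.comm_tmul,
    TensorProduct.map_tmul, hs, h2, TensorProduct.tmul_sum, TensorProduct.tmul_smul, map_smul]

/-- On S(h) the map `Sl` only meets elements of the image of S, so it cancels and the first factor
becomes q. -/
theorem pMap_antipode (hSl : Sl ∘ₗ Q.antipode = LinearMap.id) (h : H) :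
    Q.pMap T Sl (Q.antipode h) = Q.theta T h := by
  refine LinearMap.congr_fun (f := Q.pMap T Sl ∘ₗ Q.antipode) (ext_comatrix fun n c hc i j => ?_) h
  refine (Q.pMap_entry (Q.isComatrix_antipode hc) j i).trans ?_
  rw [Q.theta_entry hc]
  exact Finset.sum_congr rfl fun k _ => by rw [Q.pFirst_antipode hSl]

/-- Right multiplication only affects the factor u. The formula contains both the rationality of the
values of p and its colinearity. -/
theorem pMap_mul (ha : IsDistinguishedGrouplike T a) (f : Module.Dual K H) (h : H) :
    Q.pMap T Sl h * f =
      Q.pMap T Sl (slice f ((Q.twistedComodule a ha.isGroupLikeElem).coact h)) := by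
  refine LinearMap.congr_fun (f := (dualMul K H).flip f ∘ₗ Q.pMap T Sl)
    (g := Q.pMap T Sl ∘ₗ slice f ∘ₗ (Q.twistedComodule a ha.isGroupLikeElem).coact)
    (ext_comatrix fun n c hc i j => ?_) h
  have h1 : slice f ((Q.twistedComodule a ha.isGroupLikeElem).coact (c i j)) =
      ∑ k, f (Q.mulAntipode a (c k j)) • c i k := by
    simp [twistedComodule, hc.comul_eq]
  rw [LinearMap.comp_apply, LinearMap.comp_apply, LinearMap.comp_apply, h1, map_sum]
  change Q.pMap T Sl (c i j) * f = _
  simp only [map_smul, Q.pMap_entry hc, Finset.sum_mul, mul_assoc, Q.uMap_entry_mul ha hc,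
    Finset.mul_sum, mul_smul_comm, Finset.smul_sum]
  exact Finset.sum_comm

theorem pMap_mem_ratDual (ha : IsDistinguishedGrouplike T a) (h : H) :
    Q.pMap T Sl h ∈ ratDual K H :=
  ⟨TensorProduct.map LinearMap.id (Q.pMap T Sl)
    ((Q.twistedComodule a ha.isGroupLikeElem).coact h), fun f => by
      rw [slice_map_id]; exact Q.pMap_mul ha f h⟩

theorem mem_leftRat_of_mem_ratDual (hT : Q.IsLeftIntegral T) (hT0 : T ≠ 0)
    {f : Module.Dual K H} (hf : f ∈ ratDual K H) : f ∈ leftRat K H := by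
  classical
  obtain ⟨t, ht⟩ := hf
  obtain ⟨s, hs⟩ := TensorProduct.exists_finset t
  -- A left rational g agreeing with ε on the finitely many cᵢ of f gives f = f * g, which is left
  -- rational.
  obtain ⟨g, hg, hgs⟩ := exists_mem_forall_eq
    (fun x hx => Q.eq_zero_of_leftRat hT hT0 hx) (s.image Prod.fst) (1 : Module.Dual K H)
  have h1 : f * g = f * 1 := by
    refine (ht g).trans (Eq.trans ?_ (ht 1).symm)
    rw [hs, map_sum, map_sum]
    exact Finset.sum_congr rfl fun p hp => by
      rw [slice_tmul, slice_tmul, hgs _ (Finset.mem_image_of_mem _ hp)]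
  rw [_root_.mul_one] at h1
  rw [← h1]
  exact mul_mem_leftRat hg f

/-- Uniqueness of integrals replaces the various θ_P by multiples of θ_T, so the span is the range
of a single map. -/
theorem mem_range_theta (hT : Q.IsLeftIntegral T) (hT0 : T ≠ 0) {f : Module.Dual K H}
    (hf : f ∈ leftRat K H) : f ∈ LinearMap.range (Q.theta T) := by
  refine Submodule.span_le.2 ?_ (Q.mem_span_theta hf)
  rintro _ ⟨P, h, hP, rfl⟩
  obtain ⟨r, hr⟩ := hT.exists_eq_smul hT0 hP
  have h1 := Q.theta_sub_smul P T r
  have h2 := Q.theta_sub_smul T T 1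
  rw [one_smul, sub_self, one_smul, sub_self] at h2
  rw [sub_eq_zero.2 hr, h2, eq_comm, sub_eq_zero] at h1
  exact ⟨r • h, by rw [h1, map_smul]; rfl⟩

end DualQuasiHopfAlgebra

end DualQuasi

end

theorem proposition3p1 {K H : Type*} [Field K] [AddCommGroup H] [Module K H] [Coalgebra K H]
    (Q : DualQuasi.DualQuasiHopfAlgebra K H) (T : Module.Dual K H)
    (hT : Q.IsLeftIntegral T) (hT0 : T ≠ 0) :
    (∃! a : H, DualQuasi.IsDistinguishedGrouplike T a) ∧
    (∃ Sl : H →ₗ[K] H, Sl ∘ₗ Q.antipode = LinearMap.id) ∧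
    ∀ (a : H) (ha : DualQuasi.IsDistinguishedGrouplike T a)
      (Sl : H →ₗ[K] H), Sl ∘ₗ Q.antipode = LinearMap.id →
      ∃ p : H →ₗ[K] DualQuasi.ratDual K H,
        (∀ h : H, (p h : Module.Dual K H) = Q.pMap T Sl h) ∧
        DualQuasi.IsColinear (Q.twistedComodule a ha.isGroupLikeElem)
          (DualQuasi.ratComodule K H) p ∧
        Function.Surjective p := by
  refine ⟨DualQuasi.DualQuasiHopfAlgebra.existsUnique_distinguishedGrouplike hT hT0,
    LinearMap.exists_leftInverse_of_injective _ (LinearMap.ker_eq_bot.2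
      (DualQuasi.DualQuasiHopfAlgebra.antipode_injective_of_isLeftIntegral hT hT0)),
    fun a ha Sl hSl => ?_⟩
  let p : H →ₗ[K] DualQuasi.ratDual K H :=
    (Q.pMap T Sl).codRestrict _ fun h => Q.pMap_mem_ratDual ha h
  refine ⟨p, fun h => rfl, LinearMap.ext fun h => DualQuasi.eq_of_slice fun f => Subtype.ext ?_,
    fun f => ?_⟩
  -- Slicing the left factor by f reduces colinearity to `pMap_mul`.
  · refine (congrArg Subtype.val (DualQuasi.slice_map_id p f _)).trans ?_
    exact (Q.pMap_mul ha f h).symm.trans (DualQuasi.slice_ratCoact f (p h)).symm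
  -- A preimage can be taken in the image of the antipode, where p is θ.
  · obtain ⟨h, hh⟩ := Q.mem_range_theta hT hT0 (Q.mem_leftRat_of_mem_ratDual hT hT0 f.2)
    exact ⟨Q.antipode h, Subtype.ext ((Q.pMap_antipode hSl h).trans hh)⟩
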